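/- **Theorem (Construction of multiscale factorizations).** Let $d\ge 1$, $r=\lceil (d-1)/2\rceil$, and let $S\subseteq\mathbb R^d$ be a detection set. *Notation.* $\mathbf F_n f(\xi)=\int_{\mathbb R^n} f(x)e^{-ix\cdot\xi}\,dx$, extended to $L^2(\mathbb R^n)$; $\circledast_x$ is convolution in $\mathbb R^d$. For $f\in C^\infty(\mathbb R^d)$ let $p$ be the smooth solution on $\mathbb R^d\times[0,\infty)$ of $p_{tt}-\Delta p=0$, $p(\cdot,0)=f$, $p_t(\cdot,0)=0$, and let $\mathbf Wf$ be the restriction of $p$ to $S\times(0,\infty)$. For $v\colon\mathbb R\to\mathbb R$ put $(v\circledast_t g)(x,t)=\int_{\mathbb R}v(t-s)\,g(x,|s|)\,ds$, that is, data are extended evenly in time. A family $(u_j)_{j\in\mathbb N}$ ($\mathbb N\ni 0$) of real functions in $L^1(\mathbb R^n)\cap L^2(\mathbb R^n)$ is a *convolutional frame* if there are $A,B>0$ with $A\|f\|_2^2\le\sum_j\|u_j\circledast f\|_2^2\le B\|f\|_2^2$ for all $f\in L^2(\mathbb R^n)$. It is a *multiscale decomposition* in $L^2(\mathbb R^n)$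 if, moreover, there is $\psi\in L^1\cap L^2$ with $u_j(x)=2^{jn}\psi(2^jx)$ for all $j\ge1$. Its *canonical dual* is the family $(u_j^+)_{j\in\mathbb N}$ in $L^2(\mathbb R^n)$ with $\mathbf F_n u_j^+=\mathbf F_n u_j/\sum_k|\mathbf F_n u_k|^2$. A pair $((u_j)_j,(v_j)_j)$ is a *multiscale factorization* of $\mathbf W$ if $(u_j)_j$ and $(v_j)_j$ are multiscale decompositions in $L^2(\mathbb R^d)$ and $L^2(\mathbb R)$, respectively, and $\mathbf W(u_j\circledast_x f)=v_j\circledast_t\mathbf Wf$ for all $j$ and all $f\in C_c^\infty(\mathbb R^d)$. With $D_t=\frac1{2t}\frac{d}{dt}$ put $$\mathbf R^\sharp v(x)=\begin{cases}\dfrac{(-1)^{(d-1)/2}}{\sqrt{\pi^{d-1}}}\,\bigl(D_t^{(d-1)/2}v\bigr)(\|x\|) & d \text{ odd},\\[2ex] \dfrac{2(-1)^{d/2}}{\sqrt{\pi^{d}}}\displaystyle\int_{\|x\|}^\infty\frac{\bigl(D_t^{d/2}v\bigr)(t)}{\sqrt{t^2-\|x\|^2}}\,t\,dt & d\text{ even}.\end{cases}$$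 *Claim.* Let $(v_j)_{j\in\mathbb N}$ be a multiscale decomposition in $L^2(\mathbb R)$ consisting of even functions $v_j\in C^r(\mathbb R)$ such that for each $j$ there are $\varepsilon>0$ and $C$ with $|v_j^{(m)}(t)|\le C(1+|t|)^{-(m+1+\varepsilon)}$ for all $0\le m\le r$ and $t\in\mathbb R$. Put $u_j=\mathbf R^\sharp v_j$. Then: 1. $((u_j)_j,(v_j)_j)$ is a multiscale factorization of $\mathbf W$. 2. The canonical dual $(u_j^+)_j$ of $(u_j)_j$ exists, is unique up to null sets, and for almost every $\xi\in\mathbb R^d$ $$\mathbf F_d u_j^+(\xi)=\frac{\mathbf F_1v_j(\|\xi\|)}{\sum_{k\in\mathbb N}|\mathbf F_1v_k(\|\xi\|)|^2},$$ where the series in the denominator converges and is positive. 3. For all $f\in L^2(\mathbb R^d)$ one has $f=\sum_{j\in\mathbb N}u_j^+\circledast_x(u_j\circledast_x f)$ with unconditional convergence in $L^2(\mathbb R^d)$. For all $f\in C_c^\infty(\mathbb R^d)$ the factors $f_j=u_j\circledast_xf$ are smooth, the initial value problems with data $f$ and $f_j$ are solvable, and $\mathbf Wf_j=v_j\circledast_t\mathbf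 Wf$ (with an absolutely convergent convolution integral). Hence $f$ is recovered from $\mathbf Wf$ by solving these equations and summing the series: if $X\subseteq C^\infty(\mathbb R^d)$ contains all $f_j$ and $\mathbf W$ is injective on $X$, then any $h_j\in X$ with $\mathbf Wh_j=v_j\circledast_t\mathbf Wf$ for all $j$ satisfy $f=\sum_ju_j^+\circledast_xh_j$ in $L^2(\mathbb R^d)$. -/

import Mathlib

open MeasureTheory Set Filter Topology
open scoped ContDiff FourierTransform Laplacian ENNReal

noncomputable section

namespace PAT

/-- `ℝ^d` with its Euclidean norm. -/
abbrev Euc (d : ℕ) : Type := EuclideanSpace ℝ (Fin d)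

/-! ### The wave equation and the forward operator -/

/-- `p` is a classical solution, smooth on `ℝ^d × [0, ∞)`, of `p_tt - Δ p = 0` for `t > 0` with
`p(·, 0) = f` and `p_t(·, 0) = 0`. The values of `p` at negative times are irrelevant. -/
structure IsWaveSolution {d : ℕ} (f : Euc d → ℝ) (p : Euc d → ℝ → ℝ) : Prop where
  smooth : ContDiffOn ℝ ∞ (fun z : Euc d × ℝ => p z.1 z.2) (univ ×ˢ Ici (0 : ℝ))
  wave : ∀ x : Euc d, ∀ t : ℝ, 0 < t →
    iteratedDeriv 2 (fun s : ℝ => p x s) t - Δ (fun y : Euc d => p y t) x = 0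
  init_pos : ∀ x : Euc d, p x 0 = f x
  init_vel : ∀ x : Euc d, derivWithin (fun s : ℝ => p x s) (Ici 0) 0 = 0

open Classical in
/-- The wave operator `f ↦ W f = p`, where `p` is the solution of the initial value problem with
initial pressure `f`. (The solution is unique on `ℝ^d × [0, ∞)`. The data on a detection set `S`
are the values `W f x t` with `x ∈ S` and `t > 0`.) -/
def waveOp {d : ℕ} (f : Euc d → ℝ) : Euc d → ℝ → ℝ :=
  if h : ∃ p, IsWaveSolution f p then h.choose else 0

/-! ### Convolutions -/

/-- Convolution `(u ⊛ f)(x) = ∫ u(y) f(x - y) dy` of a real function with a function that has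
values in a real vector space. -/
def conv {V F : Type*} [AddGroup V] [MeasureSpace V] [NormedAddCommGroup F] [NormedSpace ℝ F]
    (u : V → ℝ) (f : V → F) : V → F :=
  MeasureTheory.convolution u f (ContinuousLinearMap.lsmul ℝ ℝ) volume

/-- Convolution in the time variable, `(v ⊛_t g)(x, t) = ∫ v(t - s) g(x, |s|) ds`: the data `g`,
given for positive times, are extended to all times as an even function of time. -/
def timeConv {X : Type*} (v : ℝ → ℝ) (g : X → ℝ → ℝ) (x : X) (t : ℝ) : ℝ :=
  ∫ s : ℝ, v (t - s) * g x |s|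

/-! ### Fourier transforms, normalised by `∫ f(x) exp(-i x·ξ) dx` -/

/-- The Fourier transform `∫ f(x) exp(-i x·ξ) dx` of an integrable function. -/
def fourierInt {V : Type*} [NormedAddCommGroup V] [InnerProductSpace ℝ V] [MeasureSpace V]
    (f : V → ℝ) (ξ : V) : ℂ :=
  ∫ x : V, Complex.exp (-(Complex.I * ((inner ℝ x ξ : ℝ) : ℂ))) * (f x : ℂ)

/-- `w` is square integrable and `g` is its (Plancherel) Fourier transform in the normalisation
`∫ w(x) exp(-i x·ξ) dx`. Mathlib's transform uses `exp(-2πi x·ξ)`, whence the dilation. -/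
def IsL2Fourier {d : ℕ} (w : Euc d → ℝ) (g : Euc d → ℂ) : Prop :=
  ∃ hw : MemLp (fun x => (w x : ℂ)) 2 (volume : Measure (Euc d)),
    ∀ᵐ ξ : Euc d, (𝓕 (hw.toLp _) : Lp ℂ 2 (volume : Measure (Euc d))) ((2 * Real.pi)⁻¹ • ξ) = g ξ

/-! ### Convolutional frames, multiscale decompositions, canonical duals -/

/-- Convolutional frame: functions `u_i ∈ L¹ ∩ L²` with constants `A, B > 0` such that
`A ‖f‖² ≤ ∑ ‖u_i ⊛ f‖² ≤ B ‖f‖²` for all `f ∈ L²`. -/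
structure IsConvFrame {ι V : Type*} [AddGroup V] [MeasureSpace V] (u : ι → V → ℝ) : Prop where
  memL1 : ∀ i, MemLp (u i) 1 volume
  memL2 : ∀ i, MemLp (u i) 2 volume
  bounds : ∃ A B : ℝ, 0 < A ∧ 0 < B ∧ ∀ f : V → ℂ, MemLp f 2 volume →
    ENNReal.ofReal A * eLpNorm f 2 volume ^ 2 ≤ ∑' i, eLpNorm (conv (u i) f) 2 volume ^ 2 ∧
    ∑' i, eLpNorm (conv (u i) f) 2 volume ^ 2 ≤ ENNReal.ofReal B * eLpNorm f 2 volume ^ 2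

/-- Multiscale (convolution) decomposition: a convolutional frame `(u_j)_{j ∈ ℕ}` in which, for
some `ψ ∈ L¹ ∩ L²`, `u_j(x) = 2^{jn} ψ(2^j x)` for all `j ≥ 1`, with `n` the dimension. -/
def IsMultiscale {V : Type*} [NormedAddCommGroup V] [InnerProductSpace ℝ V] [MeasureSpace V]
    (u : ℕ → V → ℝ) : Prop :=
  IsConvFrame u ∧ ∃ ψ : V → ℝ, MemLp ψ 1 volume ∧ MemLp ψ 2 volume ∧
    ∀ j : ℕ, 1 ≤ j → ∀ x : V, u j x = 2 ^ (j * Module.finrank ℝ V) * ψ ((2 : ℝ) ^ j • x)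

/-- The canonical dual `(w_j)` of `(u_j)`: the family in `L²` with Fourier transforms
`F w_j = F u_j / ∑_k |F u_k|²`. -/
def IsCanonicalDual {d : ℕ} (u w : ℕ → Euc d → ℝ) : Prop :=
  ∀ j, IsL2Fourier (w j) (fun ξ => fourierInt (u j) ξ / ((∑' k, ‖fourierInt (u k) ξ‖ ^ 2 : ℝ) : ℂ))

/-- The series `∑_j g_j` converges (unconditionally) in `L²` to `f`. -/
def HasL2Sum {d : ℕ} (g : ℕ → Euc d → ℝ) (f : Euc d → ℝ) : Prop :=
  (∀ j, MemLp (g j) 2 volume) ∧ MemLp f 2 volume ∧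
    Tendsto (fun s : Finset ℕ => eLpNorm (fun x => (∑ j ∈ s, g j x) - f x) 2 volume) atTop (𝓝 0)

/-! ### Convolution factorizations of the wave operator -/

/-- Convolution factorization for the wave operator with detection set `S`: two convolutional
frames with `W (u_i ⊛ f) = v_i ⊛_t W f` on `S × (0, ∞)` for all `f ∈ C_c^∞(ℝ^d)`. -/
structure IsConvFactorization {ι : Type*} {d : ℕ} (S : Set (Euc d)) (u : ι → Euc d → ℝ)
    (v : ι → ℝ → ℝ) : Prop where
  frame_space : IsConvFrame u
  frame_time : IsConvFrame v
  intertwine : ∀ i, ∀ f : Euc d → ℝ, ContDiff ℝ ∞ f → HasCompactSupport f →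
    ∀ x ∈ S, ∀ t : ℝ, 0 < t → waveOp (conv (u i) f) x t = timeConv (v i) (waveOp f) x t

/-- Multiscale factorization: a convolution factorization made of multiscale decompositions. -/
def IsMultiscaleFactorization {d : ℕ} (S : Set (Euc d)) (u : ℕ → Euc d → ℝ) (v : ℕ → ℝ → ℝ) :
    Prop :=
  IsConvFactorization S u v ∧ IsMultiscale u ∧ IsMultiscale v

/-! ### The inverse `R^♯` of the radial Radon transform -/

/-- The differential operator `(1 / 2t) d/dt`. -/
def derivSq (g : ℝ → ℝ) : ℝ → ℝ := fun t => 1 / (2 * t) * deriv g t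

/-- `R^♯ v : ℝ^d → ℝ`, the radial function whose Radon transform is the even function `v`. -/
def radonSharp (d : ℕ) (v : ℝ → ℝ) : Euc d → ℝ := fun x =>
  if Odd d then
    (-1) ^ ((d - 1) / 2) / √(Real.pi ^ (d - 1)) * (derivSq^[(d - 1) / 2] v) ‖x‖
  else
    2 * (-1) ^ (d / 2) / √(Real.pi ^ d) *
      ∫ t in Ioi ‖x‖, (derivSq^[d / 2] v) t / √(t ^ 2 - ‖x‖ ^ 2) * t

/-- Decay of `v` and its derivatives up to order `k`: for some `ε > 0`, the `m`-th derivative is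
`O((1 + |t|)^{-(m + 1 + ε)})` for every `m ≤ k`. -/
def SufficientDecay (k : ℕ) (v : ℝ → ℝ) : Prop :=
  ∃ ε : ℝ, 0 < ε ∧ ∃ C : ℝ, ∀ m : ℕ, m ≤ k → ∀ t : ℝ,
    |iteratedDeriv m v t| ≤ C * (1 + |t|) ^ (-((m : ℝ) + 1 + ε))

end PAT

end

/-!
Everything is read off on the Fourier side. A convolutional frame is the same thing as a family
whose symbol `∑ |F u_j|²` lies almost everywhere between two positive constants
(`frame_bounds_iff`, by Plancherel and testing on indicator functions of frequency sets). The
operator `R^♯` is built so that `F_d (R^♯ v)(ξ) = F_1 v (‖ξ‖)` (`fourierInt_radonSharp`). In odd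
dimension this is obtained by induction: integrating the radial profile `(1/2t) d/dt G` over planes
gives `-π G` (`integral_plane`), while integration over fibres restricts the Fourier transform to
the base (`fourierInt_slice`), so each application of `(1/2t) d/dt` raises the dimension by two and
keeps the transform. An even dimension is reached from the next odd one by integrating over lines,
which produces the Abel integral in the definition of `R^♯`. Since radial null sets correspond to
null sets of radii, the symbol of `(R^♯ v_j)` has the same bounds as that of `(v_j)`, and `R^♯`
commutes with dilations up to constants (`isMultiscale_radonSharp`). The decay hypotheses make
`R^♯ v` integrable; its square integrability is that of `s^((d-1)/2) F v(s)`, a consequence of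
`v⁽ʳ⁾ ∈ L²` with `r = ⌈(d-1)/2⌉` (`memLp_two_radonSharp`).

The canonical dual exists because its prescribed transform is square integrable and Hermitian
symmetric; as all transforms are real, the partial sums of the expansion are multipliers between
`0` and `1` that increase to `1`, whence convergence by dominated convergence
(`HasFrameSymbol.tendsto_expansion`).

For the wave equation, a test function `f = F K` has the solution
`x ↦ ∫ cos (2π t ‖η‖) K(η) e^{-2πi x·η} dη` (`isWaveSolution_waveInt`). Convolving `f` with a radial
`u` multiplies `K` by `F u(η) = F v(‖η‖)`, and convolving in time with the even function `v` does
the same, because cosines are eigenfunctions of even convolutions (`waveOp_conv`). As the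
operator `W` is defined by an arbitrary choice of a solution, this needs uniqueness
(`IsWaveSolution.eq`), which is proved by an energy estimate with a smooth cutoff to a backward
light cone: since the gradient of the cutoff lies in the dual cone, the localized energy decreases
(`localEnergy_hasDerivAt`).
-/

open scoped SchwartzMap

noncomputable section

namespace PAT

/-! ### Plancherel pairs -/

section Plancherel

variable {V : Type*} [NormedAddCommGroup V] [InnerProductSpace ℝ V] [FiniteDimensional ℝ V]
  [MeasurableSpace V] [BorelSpace V]

/-- `f` is square integrable and `g` represents its Plancherel transform, in Mathlib's
normalisation `exp (-2πi x·ξ)`. Working with representatives spares the coercions of `Lp`. -/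
def IsFourierPair (f g : V → ℂ) : Prop :=
  ∃ hf : MemLp f 2 (volume : Measure V),
    ((𝓕 (hf.toLp f) : Lp ℂ 2 (volume : Measure V)) : V → ℂ) =ᵐ[volume] g

/-- The multiplication formula on `L²`, by density of the Schwartz functions in the second
argument. -/
lemma Lp_integral_fourier_mul (A B : Lp ℂ 2 (volume : Measure V)) :
    ∫ x, (𝓕 A : Lp ℂ 2 (volume : Measure V)) x * B x =
      ∫ x, A x * (𝓕 B : Lp ℂ 2 (volume : Measure V)) x := by
  have key : ∀ A B : Lp ℂ 2 (volume : Measure V),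
      (ContinuousLinearMap.mul ℂ ℂ).lpPairing volume 2 2 A B = ∫ x, A x * B x := by
    intro A B
    rw [ContinuousLinearMap.lpPairing_eq_integral]; rfl
  rw [← key, ← key]
  refine DenseRange.induction_on
    (p := fun B => (ContinuousLinearMap.mul ℂ ℂ).lpPairing volume 2 2 (𝓕 A) B =
      (ContinuousLinearMap.mul ℂ ℂ).lpPairing volume 2 2 A (𝓕 B))
    (SchwartzMap.denseRange_toLpCLM (F := ℂ) (E := V) (p := 2) ENNReal.ofNat_ne_top) B ?_ ?_
  · apply isClosed_eq
    · exact ContinuousLinearMap.continuous _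
    · exact (ContinuousLinearMap.continuous _).comp
        (FourierTransform.fourierCLM ℂ (Lp ℂ 2 (volume : Measure V))).continuous
  · intro φ
    have h := congrArg (fun T => T φ) (Lp.fourier_toTemperedDistribution_eq A)
    simp only [TemperedDistribution.fourier_apply, Lp.toTemperedDistribution_apply] at h
    rw [key, key]
    simp only [SchwartzMap.toLpCLM_apply, SchwartzMap.toLp_fourier_eq]
    calc _ = ∫ x, φ x • (𝓕 A : Lp ℂ 2 (volume : Measure V)) x := by
          apply integral_congr_ae
          filter_upwards [φ.coeFn_toLp 2 volume] with x hx
          rw [hx, smul_eq_mul, mul_comm]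
      _ = ∫ x, (𝓕 φ) x • A x := h.symm
      _ = _ := by
          apply integral_congr_ae
          filter_upwards [(𝓕 φ).coeFn_toLp 2 volume] with x hx
          rw [hx, smul_eq_mul, mul_comm]

namespace IsFourierPair

lemma memLp_left {f g : V → ℂ} (h : IsFourierPair f g) : MemLp f 2 volume := h.1

lemma memLp_right {f g : V → ℂ} (h : IsFourierPair f g) : MemLp g 2 volume :=
  (memLp_congr_ae h.2).1 (Lp.memLp _)

lemma exists_right {f : V → ℂ} (hf : MemLp f 2 volume) : ∃ g, IsFourierPair f g :=
  ⟨_, hf, EventuallyEq.rfl⟩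

lemma exists_left {g : V → ℂ} (hg : MemLp g 2 volume) : ∃ f, IsFourierPair f g := by
  refine ⟨(𝓕⁻ (hg.toLp g) : Lp ℂ 2 (volume : Measure V)), Lp.memLp _, ?_⟩
  rw [Lp.toLp_coeFn, FourierTransform.fourier_fourierInv_eq]
  exact hg.coeFn_toLp

lemma congr {f g f' g' : V → ℂ} (h : IsFourierPair f g) (hf : f =ᵐ[volume] f')
    (hg : g =ᵐ[volume] g') : IsFourierPair f' g' := by
  obtain ⟨h1, h2⟩ := h
  refine ⟨(memLp_congr_ae hf).1 h1, ?_⟩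
  rw [← MemLp.toLp_congr h1 _ hf]
  exact h2.trans hg

lemma unique_left {f f' g : V → ℂ} (h : IsFourierPair f g) (h' : IsFourierPair f' g) :
    f =ᵐ[volume] f' := by
  have e : (𝓕 (h.1.toLp f) : Lp ℂ 2 (volume : Measure V)) = 𝓕 (h'.1.toLp f') :=
    Lp.ext (h.2.trans h'.2.symm)
  have e2 : h.1.toLp f = h'.1.toLp f' := by
    exact (Lp.fourierTransformₗᵢ V ℂ).injective e
  exact h.1.coeFn_toLp.symm.trans (e2 ▸ h'.1.coeFn_toLp)

/-- Plancherel's theorem. -/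
lemma eLpNorm_eq {f g : V → ℂ} (h : IsFourierPair f g) :
    eLpNorm f 2 volume = eLpNorm g 2 volume := by
  rw [← eLpNorm_congr_ae h.2, ← eLpNorm_congr_ae h.1.coeFn_toLp]
  have := Lp.norm_fourier_eq (h.1.toLp f)
  rw [Lp.norm_def, Lp.norm_def, ENNReal.toReal_eq_toReal_iff' (Lp.eLpNorm_ne_top _)
    (Lp.eLpNorm_ne_top _)] at this
  exact this.symm

lemma sub {f g f' g' : V → ℂ} (h : IsFourierPair f g) (h' : IsFourierPair f' g') :
    IsFourierPair (f - f') (g - g') := by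
  refine ⟨h.1.sub h'.1, ?_⟩
  have e : (𝓕 (h.1.toLp f - h'.1.toLp f') : Lp ℂ 2 (volume : Measure V)) =
      𝓕 (h.1.toLp f) - 𝓕 (h'.1.toLp f') := map_sub (Lp.fourierTransformₗᵢ V ℂ) _ _
  rw [MemLp.toLp_sub h.1 h'.1, e]
  exact (Lp.coeFn_sub _ _).trans (h.2.sub h'.2)

lemma add {f g f' g' : V → ℂ} (h : IsFourierPair f g) (h' : IsFourierPair f' g') :
    IsFourierPair (f + f') (g + g') := by
  refine ⟨h.1.add h'.1, ?_⟩
  rw [MemLp.toLp_add h.1 h'.1, FourierTransform.fourier_add]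
  exact (Lp.coeFn_add _ _).trans (h.2.add h'.2)

lemma sum {ι : Type*} (s : Finset ι) {f g : ι → V → ℂ} (h : ∀ i, IsFourierPair (f i) (g i)) :
    IsFourierPair (fun x => ∑ i ∈ s, f i x) (fun x => ∑ i ∈ s, g i x) := by
  classical
  induction s using Finset.induction_on with
  | empty =>
    obtain ⟨g0, hg0⟩ := exists_right (V := V) (f := 0) MemLp.zero
    simpa using! hg0.sub hg0
  | insert a s ha ih =>
    simp only [Finset.sum_insert ha]
    exact (h a).add ih

/-- The multiplication formula for the Plancherel transform. -/
lemma integral_mul_eq {a a' b b' : V → ℂ} (ha : IsFourierPair a a') (hb : IsFourierPair b b') :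
    ∫ x, a' x * b x = ∫ x, a x * b' x := by
  have := Lp_integral_fourier_mul (ha.1.toLp a) (hb.1.toLp b)
  calc _ = _ := integral_congr_ae (ha.2.symm.mul hb.1.coeFn_toLp.symm)
    _ = _ := this
    _ = _ := integral_congr_ae (ha.1.coeFn_toLp.mul hb.2)

end IsFourierPair

lemma isFourierPair_schwartz (φ : 𝓢(V, ℂ)) : IsFourierPair (φ : V → ℂ) (𝓕 φ : 𝓢(V, ℂ)) := by
  refine ⟨φ.memLp 2 volume, ?_⟩
  have : (φ.memLp 2 volume).toLp φ = φ.toLp 2 volume := rfl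
  rw [this, SchwartzMap.toLp_fourier_eq]
  exact (𝓕 φ).coeFn_toLp 2 volume

/-- Locally integrable functions that agree as tempered distributions agree almost everywhere. -/
lemma ae_eq_of_integral_mul_schwartz {f g : V → ℂ} (hf : LocallyIntegrable f volume)
    (hg : LocallyIntegrable g volume)
    (h : ∀ φ : 𝓢(V, ℂ), ∫ x, f x * φ x = ∫ x, g x * φ x) : f =ᵐ[volume] g := by
  apply ae_eq_of_integral_contDiff_smul_eq hf hg
  intro χ χs χc
  have hg₁ : HasCompactSupport (Complex.ofRealCLM ∘ χ) := χc.comp_left rfl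
  have hg₂ : ContDiff ℝ ∞ (Complex.ofRealCLM ∘ χ) := by fun_prop
  have := h (hg₁.toSchwartzMap hg₂)
  simpa [mul_comm] using this

lemma locallyIntegrable_of_memLp_two {f : V → ℂ} (hf : MemLp f 2 volume) :
    LocallyIntegrable f volume := hf.locallyIntegrable (by norm_num)

/-- A pair of square integrable functions satisfying the multiplication formula against all
Schwartz functions is a Fourier pair. -/
lemma isFourierPair_of_schwartz {f g : V → ℂ} (hf : MemLp f 2 volume) (hg : MemLp g 2 volume)
    (h : ∀ φ : 𝓢(V, ℂ), ∫ x, f x * 𝓕 φ x = ∫ x, g x * φ x) : IsFourierPair f g := by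
  obtain ⟨g', hg'⟩ := IsFourierPair.exists_right hf
  refine hg'.congr EventuallyEq.rfl ?_
  refine ae_eq_of_integral_mul_schwartz (locallyIntegrable_of_memLp_two hg'.memLp_right)
    (locallyIntegrable_of_memLp_two hg) fun φ => ?_
  rw [← h φ]
  exact hg'.integral_mul_eq (isFourierPair_schwartz φ)

lemma integral_fourier_mul_eq {f g : V → ℂ} (hf : Integrable f) (hg : Integrable g) :
    ∫ x, 𝓕 f x * g x = ∫ x, f x * 𝓕 g x := by
  have := VectorFourier.integral_fourierIntegral_smul_eq_flip (L := innerₗ V) (μ := volume)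
    (ν := volume) Real.continuous_fourierChar continuous_inner hf hg
  rw [flip_innerₗ] at this
  simpa using! this

lemma continuous_fourier {f : V → ℂ} (hf : Integrable f) : Continuous (𝓕 f) :=
  VectorFourier.fourierIntegral_continuous Real.continuous_fourierChar continuous_inner hf

lemma norm_fourier_le (f : V → ℂ) (ξ : V) : ‖𝓕 f ξ‖ ≤ ∫ x, ‖f x‖ :=
  VectorFourier.norm_fourierIntegral_le_integral_norm _ _ _ _ _

lemma integrable_mul_schwartz {f : V → ℂ} (hf : MemLp f 2 volume) (φ : 𝓢(V, ℂ)) :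
    Integrable (fun x => f x * φ x) := by
  exact hf.integrable_mul (φ.memLp 2 volume)

/-- If an integrable function has a square integrable Fourier transform, then it is itself square
integrable, and the transform given by the integral is the Plancherel transform. -/
lemma isFourierPair_of_integrable {f : V → ℂ} (hf : Integrable f) (hf' : MemLp (𝓕 f) 2 volume) :
    IsFourierPair f (𝓕 f) := by
  obtain ⟨h, hh⟩ := IsFourierPair.exists_left hf'
  refine hh.congr ?_ EventuallyEq.rfl
  refine ae_eq_of_integral_mul_schwartz (locallyIntegrable_of_memLp_two hh.memLp_left)
    hf.locallyIntegrable fun φ => ?_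
  have e : 𝓕 (𝓕⁻ φ) = φ := FourierTransform.fourier_fourierInv_eq φ
  have h1 := hh.integral_mul_eq (isFourierPair_schwartz (𝓕⁻ φ))
  have h2 := integral_fourier_mul_eq hf (𝓕⁻ φ).integrable
  rw [e] at h1
  rw [← SchwartzMap.fourier_coe, e] at h2
  rw [← h1, ← h2]

/-- On `L¹ ∩ L²` the Plancherel transform is given by the Fourier integral. -/
lemma isFourierPair_of_memLp {f : V → ℂ} (hf : Integrable f) (hf2 : MemLp f 2 volume) :
    IsFourierPair f (𝓕 f) := by
  obtain ⟨g, hg⟩ := IsFourierPair.exists_right hf2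
  refine hg.congr EventuallyEq.rfl ?_
  refine ae_eq_of_integral_mul_schwartz (locallyIntegrable_of_memLp_two hg.memLp_right)
    (continuous_fourier hf).locallyIntegrable fun φ => ?_
  rw [hg.integral_mul_eq (isFourierPair_schwartz φ), integral_fourier_mul_eq hf φ.integrable]
  rfl

/-! ### Translations, duality and convolutions of Plancherel pairs -/

lemma isFourierPair_modulate_schwartz (φ : 𝓢(V, ℂ)) (y : V) :
    IsFourierPair (fun ξ => (Real.fourierChar (-(inner ℝ y ξ : ℝ)) : ℂ) * φ ξ)
      (fun x => 𝓕 (φ : V → ℂ) (x + y)) := by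
  have hc : Continuous fun ξ : V => (Real.fourierChar (-(inner ℝ y ξ : ℝ)) : ℂ) := by
    fun_prop
  have hn : ∀ ξ, ‖(Real.fourierChar (-(inner ℝ y ξ : ℝ)) : ℂ) * φ ξ‖ = ‖φ ξ‖ := by
    intro ξ; rw [norm_mul, Circle.norm_coe, one_mul]
  have h1 : Integrable (fun ξ => (Real.fourierChar (-(inner ℝ y ξ : ℝ)) : ℂ) * φ ξ) :=
    φ.integrable.congr' (hc.mul φ.continuous).aestronglyMeasurable
      (ae_of_all _ fun ξ => (hn ξ).symm)
  have h2 : MemLp (fun ξ => (Real.fourierChar (-(inner ℝ y ξ : ℝ)) : ℂ) * φ ξ) 2 volume :=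
    (φ.memLp 2 volume).congr_norm (hc.mul φ.continuous).aestronglyMeasurable
      (ae_of_all _ fun ξ => (hn ξ).symm)
  refine (isFourierPair_of_memLp h1 h2).congr EventuallyEq.rfl (ae_of_all _ fun x => ?_)
  simp only [Real.fourier_eq]
  congr 1; ext ξ
  rw [Circle.smul_def, Circle.smul_def, smul_eq_mul, smul_eq_mul, ← mul_assoc, ← Circle.coe_mul,
    ← AddChar.map_add_eq_mul]
  congr 4
  rw [inner_add_right, real_inner_comm ξ y]; ring

lemma fourier_fourier_schwartz (φ : 𝓢(V, ℂ)) (x : V) :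
    𝓕 (𝓕 φ : 𝓢(V, ℂ)) x = φ (-x) := by
  have e : 𝓕⁻ (𝓕 φ) = φ := FourierTransform.fourierInv_fourier_eq φ
  rw [← congrArg (fun ψ : 𝓢(V, ℂ) => ψ (-x)) e]
  simp only [SchwartzMap.fourierInv_coe, SchwartzMap.fourier_coe]
  rw [Real.fourierInv_eq_fourier_neg, neg_neg]

namespace IsFourierPair

lemma translate {f g : V → ℂ} (h : IsFourierPair f g) (y : V) :
    IsFourierPair (fun x => f (x + y))
      (fun ξ => (Real.fourierChar (inner ℝ y ξ : ℝ) : ℂ) * g ξ) := by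
  have hc : Continuous fun ξ : V => (Real.fourierChar (inner ℝ y ξ : ℝ) : ℂ) := by
    fun_prop
  refine isFourierPair_of_schwartz (h.memLp_left.comp_measurePreserving
    (measurePreserving_add_right volume y)) (h.memLp_right.congr_norm
    (hc.aestronglyMeasurable.mul h.memLp_right.1)
    (ae_of_all _ fun ξ => by rw [norm_mul, Circle.norm_coe, one_mul])) fun φ => ?_
  have h1 := h.integral_mul_eq (isFourierPair_modulate_schwartz φ (-y))
  rw [← integral_sub_right_eq_self _ y]
  simp only [sub_add_cancel]
  simp only [inner_neg_left, neg_neg] at h1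
  rw [SchwartzMap.fourier_coe]
  simp only [sub_eq_add_neg]
  rw [← h1]
  congr 1; ext ξ; ring

/-- Fourier inversion, as a duality of Fourier pairs. -/
lemma dual {f g : V → ℂ} (h : IsFourierPair f g) : IsFourierPair g (fun x => f (-x)) := by
  refine isFourierPair_of_schwartz h.memLp_right (h.memLp_left.comp_measurePreserving
    (Measure.measurePreserving_neg volume)) fun φ => ?_
  rw [h.integral_mul_eq (isFourierPair_schwartz (𝓕 φ))]
  simp only [fourier_fourier_schwartz]
  rw [← integral_neg_eq_self]
  simp

lemma conj {f g : V → ℂ} (h : IsFourierPair f g) :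
    IsFourierPair (fun x => (starRingEnd ℂ) (f x)) (fun ξ => (starRingEnd ℂ) (g (-ξ))) := by
  refine isFourierPair_of_schwartz h.memLp_left.star ((h.memLp_right.comp_measurePreserving
    (Measure.measurePreserving_neg volume)).star) fun φ => ?_
  have hb : IsFourierPair (fun x => (starRingEnd ℂ) (φ (-x)))
      (fun ξ => (starRingEnd ℂ) (𝓕 (φ : V → ℂ) ξ)) := by
    refine (isFourierPair_of_memLp ?_ ?_).congr EventuallyEq.rfl (ae_of_all _ fun x => ?_)
    · exact (φ.integrable.comp_neg).congr' (by
        exact (Complex.continuous_conj.comp (φ.continuous.comp continuous_neg)).aestronglyMeasurable)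
        (ae_of_all _ fun ξ => by simp)
    · exact (((φ.memLp 2 volume).comp_measurePreserving (Measure.measurePreserving_neg volume)).star)
    · simp only [Real.fourier_eq]
      rw [← integral_conj, ← integral_neg_eq_self]
      congr 1; ext ξ
      simp [Circle.smul_def]
  have h1 := congrArg (starRingEnd ℂ) (h.integral_mul_eq hb)
  rw [← integral_conj, ← integral_conj] at h1
  simp only [map_mul, Complex.conj_conj] at h1
  rw [SchwartzMap.fourier_coe, ← h1, ← integral_neg_eq_self]
  simp

end IsFourierPair

/-- Inversion for a function in `L¹ ∩ L²`: its inverse Fourier integral forms a Fourier pair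
with it. -/
lemma isFourierPair_fourierInv {h : V → ℂ} (h1 : Integrable h) (h2 : MemLp h 2 volume) :
    IsFourierPair (𝓕⁻ h) h := by
  have := (isFourierPair_of_memLp (f := fun x => h (-x)) h1.comp_neg
    (h2.comp_measurePreserving (Measure.measurePreserving_neg volume))).dual
  simp only [neg_neg] at this
  rwa [Real.fourierInv_eq_fourier_comp_neg]

lemma conv_apply {F : Type*} [NormedAddCommGroup F] [NormedSpace ℝ F] (u : V → ℝ) (f : V → F)
    (x : V) : conv u f x = ∫ y, u y • f (x - y) := rfl

lemma ofReal_conv (u f : V → ℝ) (x : V) :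
    ((conv u f x : ℝ) : ℂ) = conv u (fun y => (f y : ℂ)) x := by
  rw [conv_apply, conv_apply, ← integral_complex_ofReal]
  simp

/-- The convolution of two square integrable functions is everywhere given by the inverse
Fourier integral of the product of their transforms. -/
lemma conv_eq_fourierInv {w : V → ℝ} {w' g g' : V → ℂ} (hw : IsFourierPair (fun x => (w x : ℂ)) w')
    (hg : IsFourierPair g g') (x : V) : conv w g x = 𝓕⁻ (fun ξ => w' ξ * g' ξ) x := by
  -- `y ↦ g (x - y)` is the reflected translate of `g`, so the formula is Parseval's identity
  have h1 := hw.integral_mul_eq (hg.translate x).dual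
  rw [conv_apply, Real.fourierInv_eq]
  simp only [Complex.real_smul, Circle.smul_def, smul_eq_mul]
  calc _ = _ := by congr 1; ext y; rw [sub_eq_neg_add]
    _ = _ := h1.symm
    _ = _ := by congr 1; ext ξ; rw [real_inner_comm]; ring

lemma isFourierPair_conv_of_memLp_two {w : V → ℝ} {w' g g' : V → ℂ}
    (hw : IsFourierPair (fun x => (w x : ℂ)) w') (hg : IsFourierPair g g')
    (h : MemLp (fun ξ => w' ξ * g' ξ) 2 volume) :
    IsFourierPair (conv w g) (fun ξ => w' ξ * g' ξ) := by
  rw [show conv w g = 𝓕⁻ (fun ξ => w' ξ * g' ξ) from funext (conv_eq_fourierInv hw hg)]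
  exact isFourierPair_fourierInv (hw.memLp_right.integrable_mul hg.memLp_right) h

/-- The integrand of `∫ (u ⊛ f) ψ` is absolutely integrable for `u ∈ L¹` and `f, ψ ∈ L²`. -/
lemma integrable_prod_conv {u : V → ℝ} {f ψ : V → ℂ} (hu : Integrable u) (hf : MemLp f 2 volume)
    (hψ : MemLp ψ 2 volume) :
    Integrable (fun p : V × V => (u p.2 • f (p.1 - p.2)) * ψ p.1) (volume.prod volume) := by
  have hm : AEStronglyMeasurable (fun p : V × V => (u p.2 • f (p.1 - p.2)) * ψ p.1)
      (volume.prod volume) := by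
    have h1 : AEStronglyMeasurable (fun p : V × V => u p.2) (volume.prod volume) := hu.1.comp_snd
    have h2 : AEStronglyMeasurable (fun p : V × V => ψ p.1) (volume.prod volume) := hψ.1.comp_fst
    exact (h1.smul (hf.1.comp_quasiMeasurePreserving
      (quasiMeasurePreserving_sub_of_right_invariant volume volume))).mul h2
  have hf2 : Integrable (fun x => ‖f x‖ ^ 2) := hf.integrable_norm_pow (by norm_num)
  have hψ2 : Integrable (fun x => ‖ψ x‖ ^ 2) := hψ.integrable_norm_pow (by norm_num)
  have hs : ∀ y, MemLp (fun x => f (x - y)) 2 volume := fun y =>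
    hf.comp_measurePreserving (measurePreserving_sub_right volume y)
  rw [integrable_prod_iff' hm]
  constructor
  · refine ae_of_all _ fun y => ?_
    exact ((hs y).const_smul (u y)).integrable_mul hψ
  · refine Integrable.mono' (g := fun y => ‖u y‖ * ((∫ x, ‖f x‖ ^ 2) + ∫ x, ‖ψ x‖ ^ 2))
      (hu.norm.mul_const _) hm.norm.prod_swap.integral_prod_right' (ae_of_all _ fun y => ?_)
    rw [Real.norm_of_nonneg (integral_nonneg fun _ => norm_nonneg _)]
    have e : ∀ x, ‖(u y • f (x - y)) * ψ x‖ = ‖u y‖ * (‖f (x - y)‖ * ‖ψ x‖) := by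
      intro x; rw [norm_mul, norm_smul, mul_assoc]
    simp only [e]
    rw [integral_const_mul]
    refine mul_le_mul_of_nonneg_left ?_ (norm_nonneg _)
    rw [← integral_sub_right_eq_self (fun x => ‖f x‖ ^ 2) y, ← integral_add (hf2.comp_sub_right y) hψ2]
    refine integral_mono_of_nonneg (ae_of_all _ fun x => by positivity)
      ((hf2.comp_sub_right y).add hψ2) (ae_of_all _ fun x => ?_)
    change ‖f (x - y)‖ * ‖ψ x‖ ≤ ‖f (x - y)‖ ^ 2 + ‖ψ x‖ ^ 2
    nlinarith [sq_nonneg (‖f (x - y)‖ - ‖ψ x‖), sq_nonneg (‖f (x - y)‖), sq_nonneg ‖ψ x‖]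

lemma memLp_fourier_mul {u : V → ℂ} (hu : Integrable u) {g : V → ℂ} (hg : MemLp g 2 volume) :
    MemLp (fun ξ => 𝓕 u ξ * g ξ) 2 volume := by
  refine MemLp.of_le_mul (c := ∫ x, ‖u x‖) hg ((continuous_fourier hu).aestronglyMeasurable.mul hg.1)
    (ae_of_all _ fun ξ => ?_)
  rw [norm_mul]
  exact mul_le_mul_of_nonneg_right (norm_fourier_le u ξ) (norm_nonneg _)

/-- Obtained by pairing the convolution with indicator functions of balls. -/
lemma locallyIntegrable_conv {u : V → ℝ} {f : V → ℂ} (hu : Integrable u) (hf : MemLp f 2 volume) :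
    LocallyIntegrable (conv u f) volume := by
  intro x
  refine ⟨Metric.ball x 1, Metric.ball_mem_nhds x one_pos, ?_⟩
  have h1 : MemLp ((Metric.ball x 1).indicator fun _ => (1 : ℂ)) 2 (volume : Measure V) :=
    memLp_indicator_const 2 measurableSet_ball 1 (Or.inr measure_ball_lt_top.ne)
  have h2 := (integrable_prod_conv hu hf h1).integral_prod_left
  rw [← integrable_indicator_iff measurableSet_ball]
  refine h2.congr (ae_of_all _ fun z => ?_)
  by_cases hz : z ∈ Metric.ball x 1
  · simp [hz, conv_apply]
  · simp [hz]

/-- Convolution with an integrable function is a Fourier multiplier on `L²`. -/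
lemma isFourierPair_conv {u : V → ℝ} {f g : V → ℂ} (hu : Integrable u) (h : IsFourierPair f g) :
    IsFourierPair (conv u f) (fun ξ => 𝓕 (fun x => (u x : ℂ)) ξ * g ξ) := by
  have hu' : Integrable (fun x => (u x : ℂ)) := hu.ofReal
  have hM := memLp_fourier_mul hu' h.memLp_right
  obtain ⟨k, hk⟩ := IsFourierPair.exists_left hM
  refine hk.congr ?_ EventuallyEq.rfl
  refine ae_eq_of_integral_mul_schwartz (locallyIntegrable_of_memLp_two hk.memLp_left)
    (locallyIntegrable_conv hu h.memLp_left) fun ψ => ?_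
  have e : 𝓕 (𝓕⁻ ψ) = ψ := FourierTransform.fourier_fourierInv_eq ψ
  set φ := 𝓕⁻ ψ with hφ
  have e' : 𝓕 (φ : V → ℂ) = ψ := by rw [← SchwartzMap.fourier_coe, e]
  rw [← e, ← hk.integral_mul_eq (isFourierPair_schwartz φ)]
  have hgφ : Integrable (fun ξ => g ξ * φ ξ) := integrable_mul_schwartz h.memLp_right φ
  simp only [mul_assoc]
  rw [integral_fourier_mul_eq hu' hgφ]
  have h3 : ∀ y, 𝓕 (fun ξ => g ξ * φ ξ) y = ∫ x, f (x - y) * ψ x := by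
    intro y
    have := h.integral_mul_eq (isFourierPair_modulate_schwartz φ y)
    rw [e'] at this
    rw [← integral_sub_right_eq_self (fun x => f x * ψ (x + y)) y] at this
    simp only [sub_add_cancel] at this
    rw [← this, Real.fourier_eq]
    congr 1; ext ξ
    rw [Circle.smul_def, smul_eq_mul, real_inner_comm]; ring
  simp only [h3, conv_apply]
  rw [e]
  calc _ = ∫ y, ∫ x, (u y • f (x - y)) * ψ x := by
        congr 1; ext y
        rw [← integral_const_mul]
        congr 1; ext x
        rw [Complex.real_smul]; ring
    _ = ∫ x, ∫ y, (u y • f (x - y)) * ψ x :=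
        (integral_integral_swap (f := fun x y => (u y • f (x - y)) * ψ x)
          (integrable_prod_conv hu h.memLp_left (ψ.memLp 2 volume))).symm
    _ = _ := by
        congr 1; ext x
        rw [integral_mul_const]

/-! ### The symbol of a convolutional frame -/

lemma fourierInt_eq_fourier (f : V → ℝ) (ξ : V) :
    fourierInt f ξ = 𝓕 (fun x => (f x : ℂ)) ((2 * Real.pi)⁻¹ • ξ) := by
  rw [Real.fourier_eq, fourierInt]
  congr 1; ext x
  rw [Circle.smul_def, smul_eq_mul, Real.fourierChar_apply, inner_smul_right]
  congr 2
  have : (Real.pi : ℂ) ≠ 0 := by exact_mod_cast Real.pi_ne_zero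
  push_cast
  field_simp

lemma fourier_eq_fourierInt (f : V → ℝ) (ξ : V) :
    𝓕 (fun x => (f x : ℂ)) ξ = fourierInt f ((2 * Real.pi) • ξ) := by
  rw [fourierInt_eq_fourier, smul_smul, inv_mul_cancel₀ (by positivity), one_smul]

lemma eLpNorm_two_sq {α F : Type*} [MeasurableSpace α] [NormedAddCommGroup F] (μ : Measure α)
    (f : α → F) : eLpNorm f 2 μ ^ 2 = ∫⁻ x, ‖f x‖ₑ ^ 2 ∂μ := by
  have := eLpNorm_nnreal_pow_eq_lintegral (μ := μ) (f := f) (p := 2) (by norm_num)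
  simpa using! this

/-- The symbol `∑ |F u_i|²` of a family, with values in `[0, ∞]`. -/
def frameSymbol {ι : Type*} (u : ι → V → ℝ) (ξ : V) : ℝ≥0∞ :=
  ∑' i, ‖𝓕 (fun x => (u i x : ℂ)) ξ‖ₑ ^ 2

lemma measurable_enorm_fourier_sq {u : V → ℝ} (hu : Integrable u) :
    Measurable fun ξ => ‖𝓕 (fun x => (u x : ℂ)) ξ‖ₑ ^ 2 :=
  (continuous_fourier hu.ofReal).measurable.enorm.pow_const 2

lemma measurable_frameSymbol {ι : Type*} [Countable ι] {u : ι → V → ℝ}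
    (hu : ∀ i, Integrable (u i)) : Measurable (frameSymbol u) :=
  Measurable.tsum fun i => measurable_enorm_fourier_sq (hu i)

lemma tsum_eLpNorm_conv_sq {ι : Type*} [Countable ι] {u : ι → V → ℝ}
    (hu : ∀ i, Integrable (u i)) {f g : V → ℂ} (h : IsFourierPair f g) :
    ∑' i, eLpNorm (conv (u i) f) 2 volume ^ 2 = ∫⁻ ξ, frameSymbol u ξ * ‖g ξ‖ₑ ^ 2 := by
  simp only [frameSymbol, ← ENNReal.tsum_mul_right]
  rw [lintegral_tsum]
  · congr 1; ext i
    rw [(isFourierPair_conv (hu i) h).eLpNorm_eq, eLpNorm_two_sq]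
    simp only [enorm_mul, mul_pow]
  · intro i
    exact (measurable_enorm_fourier_sq (hu i)).aemeasurable.mul
      (h.memLp_right.1.enorm.pow_const 2)

/-- The frame inequalities hold if and only if the symbol `∑ |F u_i|²` is bounded above and away
from zero. -/
lemma frame_bounds_iff {ι : Type*} [Countable ι] {u : ι → V → ℝ}
    (hu : ∀ i, Integrable (u i)) (A B : ℝ≥0∞) :
    (∀ f : V → ℂ, MemLp f 2 volume →
      A * eLpNorm f 2 volume ^ 2 ≤ ∑' i, eLpNorm (conv (u i) f) 2 volume ^ 2 ∧
      ∑' i, eLpNorm (conv (u i) f) 2 volume ^ 2 ≤ B * eLpNorm f 2 volume ^ 2) ↔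
    ∀ᵐ ξ : V, A ≤ frameSymbol u ξ ∧ frameSymbol u ξ ≤ B := by
  constructor
  · intro h
    have key : ∀ s : Set V, MeasurableSet s → volume s < ⊤ →
        A * volume s ≤ ∫⁻ ξ in s, frameSymbol u ξ ∧
        ∫⁻ ξ in s, frameSymbol u ξ ≤ B * volume s := by
      intro s hs hsf
      -- test the frame inequalities on the function whose transform is the indicator of `s`
      obtain ⟨f, hf⟩ := IsFourierPair.exists_left
        (memLp_indicator_const 2 hs (1 : ℂ) (Or.inr hsf.ne) : MemLp _ 2 (volume : Measure V))
      have h1 := h f hf.memLp_left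
      rw [tsum_eLpNorm_conv_sq hu hf, hf.eLpNorm_eq, eLpNorm_two_sq] at h1
      have e : ∀ ξ, ‖s.indicator (fun _ => (1 : ℂ)) ξ‖ₑ ^ 2 = s.indicator (fun _ => 1) ξ := by
        intro ξ; by_cases hξ : ξ ∈ s <;> simp [hξ]
      have e2 : ∀ ξ, frameSymbol u ξ * s.indicator (fun _ => 1) ξ =
          s.indicator (frameSymbol u) ξ := by
        intro ξ; by_cases hξ : ξ ∈ s <;> simp [hξ]
      simp only [e, e2] at h1
      rw [lintegral_indicator hs, lintegral_indicator hs, setLIntegral_one] at h1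
      exact h1
    have hm := measurable_frameSymbol hu
    have hA : (fun _ => A) ≤ᵐ[volume] frameSymbol u :=
      ae_le_of_forall_setLIntegral_le_of_sigmaFinite measurable_const fun s hs hsf => by
        rw [setLIntegral_const]; exact (key s hs hsf).1
    have hB : frameSymbol u ≤ᵐ[volume] fun _ => B :=
      ae_le_of_forall_setLIntegral_le_of_sigmaFinite hm fun s hs hsf => by
        rw [setLIntegral_const]; exact (key s hs hsf).2
    exact hA.and hB
  · intro h f hf
    obtain ⟨g, hg⟩ := IsFourierPair.exists_right hf
    have hmg : AEMeasurable (fun ξ => ‖g ξ‖ₑ ^ 2) volume := hg.memLp_right.1.enorm.pow_const 2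
    rw [tsum_eLpNorm_conv_sq hu hg, hg.eLpNorm_eq, eLpNorm_two_sq,
      ← lintegral_const_mul'' _ hmg, ← lintegral_const_mul'' _ hmg]
    constructor
    · exact lintegral_mono_ae (h.mono fun ξ hξ => mul_le_mul_left hξ.1 _)
    · exact lintegral_mono_ae (h.mono fun ξ hξ => mul_le_mul_left hξ.2 _)

/-- Null sets are invariant under dilations. -/
lemma ae_comp_smul {p : V → Prop} (h : ∀ᵐ ξ : V, p ξ) {c : ℝ} (hc : c ≠ 0) :
    ∀ᵐ ξ : V, p (c • ξ) := by
  have : Measure.QuasiMeasurePreserving (fun ξ : V => c • ξ) volume volume := by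
    refine ⟨measurable_const_smul c, ?_⟩
    rw [Measure.map_addHaar_smul volume hc]
    exact Measure.smul_absolutelyContinuous
  exact this.ae h

lemma ae_comp_smul_iff {p : V → Prop} {c : ℝ} (hc : c ≠ 0) :
    (∀ᵐ ξ : V, p (c • ξ)) ↔ ∀ᵐ ξ : V, p ξ := by
  refine ⟨fun h => ?_, fun h => ae_comp_smul h hc⟩
  simpa [smul_smul, mul_inv_cancel₀ hc] using ae_comp_smul h (inv_ne_zero hc)

/-- The series form of an almost everywhere two-sided bound on the symbol. -/
lemma summable_of_frameSymbol {ι : Type*} {u : ι → V → ℝ} {A B : ℝ} (hA : 0 < A) {ξ : V}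
    (h : ENNReal.ofReal A ≤ frameSymbol u ξ ∧ frameSymbol u ξ ≤ ENNReal.ofReal B) :
    Summable (fun i => ‖𝓕 (fun x => (u i x : ℂ)) ξ‖ ^ 2) ∧
      A ≤ ∑' i, ‖𝓕 (fun x => (u i x : ℂ)) ξ‖ ^ 2 := by
  have e : ∀ i, ‖𝓕 (fun x => (u i x : ℂ)) ξ‖ₑ ^ 2 =
      ENNReal.ofReal (‖𝓕 (fun x => (u i x : ℂ)) ξ‖ ^ 2) := by
    intro i
    rw [ENNReal.ofReal_pow (norm_nonneg _), ofReal_norm]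
  have hfin : frameSymbol u ξ ≠ ⊤ := (h.2.trans_lt ENNReal.ofReal_lt_top).ne
  have hs : Summable (fun i => ‖𝓕 (fun x => (u i x : ℂ)) ξ‖ ^ 2) := by
    have := ENNReal.summable_toReal hfin
    simpa using this
  refine ⟨hs, ?_⟩
  have h1 := h.1
  simp only [frameSymbol, e] at h1
  rw [← ENNReal.ofReal_tsum_of_nonneg (fun _ => by positivity) hs] at h1
  exact (ENNReal.ofReal_le_ofReal_iff'.1 h1).resolve_right (fun h => absurd h (not_le.2 hA))

end Plancherel

/-! ### Canonical duals and the frame expansion -/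

lemma two_pi_inv_ne_zero : (2 * Real.pi)⁻¹ ≠ 0 := inv_ne_zero (by positivity)

lemma isL2Fourier_iff {d : ℕ} (w : Euc d → ℝ) (g : Euc d → ℂ) :
    IsL2Fourier w g ↔ IsFourierPair (fun x => (w x : ℂ)) (fun ξ => g ((2 * Real.pi) • ξ)) := by
  unfold IsL2Fourier IsFourierPair
  refine exists_congr fun hw => ?_
  unfold EventuallyEq
  rw [← ae_comp_smul_iff (p := fun ξ => ((𝓕 (hw.toLp _) : Lp ℂ 2 (volume : Measure (Euc d))) ξ =
    g ((2 * Real.pi) • ξ))) two_pi_inv_ne_zero]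
  simp only [smul_smul, mul_inv_cancel₀ (show (2 * Real.pi) ≠ 0 by positivity), one_smul]

lemma memLp_of_ofReal {α : Type*} [MeasurableSpace α] {μ : Measure α} {f : α → ℝ} {p : ℝ≥0∞}
    (h : MemLp (fun x => (f x : ℂ)) p μ) : MemLp f p μ := by
  simpa using! h.re

section General

variable {V : Type*} [NormedAddCommGroup V] [InnerProductSpace ℝ V] [FiniteDimensional ℝ V]
  [MeasurableSpace V] [BorelSpace V]

lemma fourier_ofReal_neg (u : V → ℝ) (ξ : V) :
    𝓕 (fun x => (u x : ℂ)) (-ξ) = (starRingEnd ℂ) (𝓕 (fun x => (u x : ℂ)) ξ) := by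
  simp only [Real.fourier_eq]
  rw [← integral_conj]
  congr 1; ext x
  simp [Circle.smul_def]

/-- The Fourier transform `F u_j / ∑_k |F u_k|²` of the canonical dual. -/
def dualSymbol (u : ℕ → V → ℝ) (j : ℕ) (ξ : V) : ℂ :=
  𝓕 (fun x => (u j x : ℂ)) ξ / ((∑' k, ‖𝓕 (fun x => (u k x : ℂ)) ξ‖ ^ 2 : ℝ) : ℂ)

/-- Functions whose symbol lies between two positive constants. -/
structure HasFrameSymbol (u : ℕ → V → ℝ) (A B : ℝ) : Prop where
  integrable : ∀ i, Integrable (u i)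
  memL2 : ∀ i, MemLp (u i) 2 volume
  pos : 0 < A
  bounds : ∀ᵐ ξ : V, ENNReal.ofReal A ≤ frameSymbol u ξ ∧ frameSymbol u ξ ≤ ENNReal.ofReal B

namespace HasFrameSymbol

variable {u : ℕ → V → ℝ} {A B : ℝ}

lemma memLp_fourier (h : HasFrameSymbol u A B) (j : ℕ) :
    MemLp (𝓕 (fun x => (u j x : ℂ))) 2 volume :=
  (isFourierPair_of_memLp (h.integrable j).ofReal (h.memL2 j).ofReal).memLp_right

lemma measurable_dualSymbol (h : HasFrameSymbol u A B) (j : ℕ) : Measurable (dualSymbol u j) := by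
  refine (continuous_fourier (h.integrable j).ofReal).measurable.div
    (Complex.measurable_ofReal.comp ?_)
  have : (fun ξ => ∑' k, ‖𝓕 (fun x => (u k x : ℂ)) ξ‖ ^ 2) =
      fun ξ => (∑' k, ‖𝓕 (fun x => (u k x : ℂ)) ξ‖ₑ ^ 2).toReal := by
    ext ξ
    rw [ENNReal.tsum_toReal_eq (fun k => by finiteness)]
    simp
  rw [this]
  exact (measurable_frameSymbol h.integrable).ennreal_toReal

lemma memLp_dualSymbol (h : HasFrameSymbol u A B) (j : ℕ) :
    MemLp (dualSymbol u j) 2 volume := by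
  refine MemLp.of_le_mul (c := A⁻¹) (h.memLp_fourier j)
    (h.measurable_dualSymbol j).aestronglyMeasurable ?_
  filter_upwards [h.bounds] with ξ hξ
  have h1 := (summable_of_frameSymbol h.pos hξ).2
  rw [dualSymbol, norm_div, Complex.norm_real, Real.norm_of_nonneg (h.pos.le.trans h1),
    div_eq_inv_mul]
  exact mul_le_mul_of_nonneg_right (inv_anti₀ h.pos h1) (norm_nonneg _)

/-- A real function with Plancherel transform `dualSymbol u j` exists, because that symbol is
Hermitian symmetric. -/
lemma exists_dual (h : HasFrameSymbol u A B) (j : ℕ) :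
    ∃ w : V → ℝ, IsFourierPair (fun x => (w x : ℂ)) (dualSymbol u j) := by
  obtain ⟨f, hf⟩ := IsFourierPair.exists_left (h.memLp_dualSymbol j)
  have e : (fun ξ => (starRingEnd ℂ) (dualSymbol u j (-ξ))) = dualSymbol u j := by
    ext ξ
    simp [dualSymbol, fourier_ofReal_neg]
  have h2 := hf.conj
  rw [e] at h2
  refine ⟨fun x => (f x).re, hf.congr ?_ EventuallyEq.rfl⟩
  filter_upwards [hf.unique_left h2] with x hx
  exact (Complex.conj_eq_iff_re.1 hx.symm).symm

/-- Expansion with respect to the canonical dual, for a frame with real Fourier transforms. -/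
lemma tendsto_expansion (h : HasFrameSymbol u A B)
    (hreal : ∀ j ξ, (starRingEnd ℂ) (𝓕 (fun x => (u j x : ℂ)) ξ) = 𝓕 (fun x => (u j x : ℂ)) ξ)
    {w : ℕ → V → ℝ} (hw : ∀ j, IsFourierPair (fun x => (w j x : ℂ)) (dualSymbol u j))
    {f : V → ℝ} (hf : MemLp f 2 volume) :
    (∀ j, MemLp (conv (w j) (conv (u j) f)) 2 volume) ∧
    Tendsto (fun s : Finset ℕ =>
      eLpNorm (fun x => (∑ j ∈ s, conv (w j) (conv (u j) f) x) - f x) 2 volume) atTop (𝓝 0) := by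
  obtain ⟨g, hg⟩ := IsFourierPair.exists_right (V := V) hf.ofReal
  let a : ℕ → V → ℝ := fun j ξ => ‖𝓕 (fun x => (u j x : ℂ)) ξ‖ ^ 2
  let m : V → ℝ := fun ξ => ∑' k, a k ξ
  have hm : ∀ᵐ ξ, Summable (fun j => a j ξ) ∧ 0 < m ξ := by
    filter_upwards [h.bounds] with ξ hξ
    exact ⟨(summable_of_frameSymbol h.pos hξ).1,
      h.pos.trans_le (summable_of_frameSymbol h.pos hξ).2⟩
  -- the `j`-th term of the expansion acts as multiplication by `a j / m`, as `F u_j` is real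
  have hprod : ∀ j ξ, dualSymbol u j ξ * (𝓕 (fun x => (u j x : ℂ)) ξ * g ξ) =
      ((a j ξ / m ξ : ℝ) : ℂ) * g ξ := by
    intro j ξ
    have : ((a j ξ : ℝ) : ℂ) = 𝓕 (fun x => (u j x : ℂ)) ξ * 𝓕 (fun x => (u j x : ℂ)) ξ := by
      nth_rewrite 1 [← hreal j ξ]
      rw [← Complex.normSq_eq_conj_mul_self, Complex.normSq_eq_norm_sq]
    rw [Complex.ofReal_div, this, dualSymbol]
    simp only [m, a]
    ring
  have hpart : ∀ s : Finset ℕ, ∀ᵐ ξ, 0 ≤ (∑ j ∈ s, a j ξ / m ξ) ∧ (∑ j ∈ s, a j ξ / m ξ) ≤ 1 := by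
    intro s
    filter_upwards [hm] with ξ hξ
    rw [← Finset.sum_div]
    have h0 : 0 ≤ ∑ j ∈ s, a j ξ := Finset.sum_nonneg fun j _ => by positivity
    exact ⟨div_nonneg h0 hξ.2.le, (div_le_one hξ.2).2
      (hξ.1.sum_le_tsum s (fun j _ => by positivity))⟩
  have hmem : ∀ j, MemLp (fun ξ => dualSymbol u j ξ * (𝓕 (fun x => (u j x : ℂ)) ξ * g ξ)) 2
      volume := by
    intro j
    have hms := ((h.measurable_dualSymbol j).aestronglyMeasurable.mul
      ((continuous_fourier (h.integrable j).ofReal).aestronglyMeasurable.mul hg.memLp_right.1))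
    refine hg.memLp_right.of_le hms ?_
    filter_upwards [hpart {j}] with ξ hξ
    rw [hprod, norm_mul, Complex.norm_real]
    simp only [Finset.sum_singleton] at hξ
    rw [Real.norm_of_nonneg hξ.1]
    exact mul_le_of_le_one_left (norm_nonneg _) hξ.2
  have hpair : ∀ j, IsFourierPair (fun x => ((conv (w j) (conv (u j) f) x : ℝ) : ℂ))
      (fun ξ => ((a j ξ / m ξ : ℝ) : ℂ) * g ξ) := by
    intro j
    have h1 := isFourierPair_conv_of_memLp_two (hw j) (isFourierPair_conv (h.integrable j) hg)
      (hmem j)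
    simp only [hprod] at h1
    refine h1.congr (ae_of_all _ fun x => ?_) EventuallyEq.rfl
    have e : conv (u j) (fun y => (f y : ℂ)) = fun y => ((conv (u j) f y : ℝ) : ℂ) :=
      funext fun y => (ofReal_conv (u j) f y).symm
    simp only [ofReal_conv (w j), ← e]
    rfl
  refine ⟨fun j => memLp_of_ofReal (hpair j).memLp_left, ?_⟩
  have hnorm : ∀ s : Finset ℕ,
      eLpNorm (fun x => (∑ j ∈ s, conv (w j) (conv (u j) f) x) - f x) 2 volume =
      (∫⁻ ξ, ‖((∑ j ∈ s, a j ξ / m ξ - 1 : ℝ) : ℂ) * g ξ‖ₑ ^ 2) ^ (1 / 2 : ℝ) := by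
    intro s
    have h1 := ((IsFourierPair.sum s hpair).sub hg).eLpNorm_eq
    rw [← eLpNorm_two_sq, ← ENNReal.rpow_natCast, ← ENNReal.rpow_mul]
    simp only [Nat.cast_ofNat, one_div, ne_eq, OfNat.ofNat_ne_zero, not_false_eq_true,
      mul_inv_cancel₀, ENNReal.rpow_one]
    calc _ = eLpNorm ((fun x => ∑ j ∈ s, ((conv (w j) (conv (u j) f) x : ℝ) : ℂ)) -
          fun x => (f x : ℂ)) 2 volume := by
          apply eLpNorm_congr_norm_ae
          refine ae_of_all _ fun x => ?_
          rw [Pi.sub_apply, ← Complex.ofReal_sum, ← Complex.ofReal_sub, Complex.norm_real]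
      _ = _ := h1
      _ = _ := by
          congr 1; ext ξ
          rw [Pi.sub_apply, ← Finset.sum_mul]
          push_cast
          ring
  simp only [hnorm]
  have hlim : Tendsto (fun s : Finset ℕ =>
      ∫⁻ ξ, ‖((∑ j ∈ s, a j ξ / m ξ - 1 : ℝ) : ℂ) * g ξ‖ₑ ^ 2) atTop (𝓝 (∫⁻ _ : V, 0)) := by
    refine tendsto_lintegral_filter_of_dominated_convergence' (fun ξ => ‖g ξ‖ₑ ^ 2)
      (Eventually.of_forall fun s => ?_) (Eventually.of_forall fun s => ?_) ?_ ?_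
    · have := ((IsFourierPair.sum s hpair).sub hg).memLp_right.1.enorm.pow_const 2
      refine this.congr (ae_of_all _ fun ξ => ?_)
      simp only [Pi.sub_apply, ← Finset.sum_mul]
      rw [show ∀ z : ℂ, z * g ξ - g ξ = (z - 1) * g ξ from fun z => by ring]
      push_cast
      rfl
    · filter_upwards [hpart s] with ξ hξ
      gcongr
      rw [enorm_le_iff_norm_le, norm_mul, Complex.norm_real]
      refine mul_le_of_le_one_left (norm_nonneg _) ?_
      rw [Real.norm_eq_abs, abs_le]
      constructor <;> linarith [hξ.1, hξ.2]
    · rw [← eLpNorm_two_sq]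
      exact ENNReal.pow_ne_top hg.memLp_right.2.ne
    · filter_upwards [hm] with ξ hξ
      have h1 : Tendsto (fun s : Finset ℕ => (∑ j ∈ s, a j ξ / m ξ - 1 : ℝ)) atTop (𝓝 0) := by
        have h2 : HasSum (fun j => a j ξ / m ξ) (m ξ / m ξ) := hξ.1.hasSum.div_const _
        rw [div_self hξ.2.ne'] at h2
        simpa using! Tendsto.sub_const h2 1
      have h3 : Continuous fun r : ℝ => ‖(r : ℂ) * g ξ‖ₑ ^ 2 := by fun_prop
      have h4 := (h3.tendsto 0).comp h1
      simp only [Complex.ofReal_zero, zero_mul, enorm_zero, ne_eq, OfNat.ofNat_ne_zero,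
        not_false_eq_true, zero_pow] at h4
      exact h4
  have := (ENNReal.continuous_rpow_const (y := (1 / 2 : ℝ))).tendsto (∫⁻ _ : V, 0)
  simpa using! this.comp hlim

end HasFrameSymbol

end General

/-! ### Radial functions and slices of the Fourier transform -/

section Radial

variable {V₁ V₂ V E : Type*}
  [NormedAddCommGroup V₁] [InnerProductSpace ℝ V₁] [FiniteDimensional ℝ V₁]
  [MeasurableSpace V₁] [BorelSpace V₁]
  [NormedAddCommGroup V₂] [InnerProductSpace ℝ V₂] [FiniteDimensional ℝ V₂]
  [MeasurableSpace V₂] [BorelSpace V₂]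
  [NormedAddCommGroup V] [InnerProductSpace ℝ V] [FiniteDimensional ℝ V]
  [MeasurableSpace V] [BorelSpace V]
  [NormedAddCommGroup E] [InnerProductSpace ℝ E] [FiniteDimensional ℝ E]
  [MeasurableSpace E] [BorelSpace E]

lemma fourierInt_radial_isometry (e : V₁ ≃ₗᵢ[ℝ] V₂) (U : ℝ → ℝ) (ξ : V₁) :
    fourierInt (fun x : V₂ => U ‖x‖) (e ξ) = fourierInt (fun x : V₁ => U ‖x‖) ξ := by
  rw [fourierInt, fourierInt,
    ← (LinearIsometryEquiv.measurePreserving e).integral_comp e.toHomeomorph.measurableEmbedding]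
  simp

/-- The Fourier transform of a radial function is radial, and does not depend on the model of
the Euclidean space. -/
lemma fourierInt_radial_congr (e : V₁ ≃ₗᵢ[ℝ] V₂) (U : ℝ → ℝ) {ξ₁ : V₁} {ξ₂ : V₂}
    (h : ‖ξ₁‖ = ‖ξ₂‖) :
    fourierInt (fun x : V₁ => U ‖x‖) ξ₁ = fourierInt (fun x : V₂ => U ‖x‖) ξ₂ := by
  have h' : ‖e ξ₁‖ = ‖ξ₂‖ := by rw [e.norm_map, h]
  -- a reflection matches two frequencies of equal norm
  have h1 := Submodule.reflection_sub h'
  rw [← fourierInt_radial_isometry (e.trans (Submodule.reflection (ℝ ∙ (e ξ₁ - ξ₂))ᗮ)) U ξ₁]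
  simp only [LinearIsometryEquiv.trans_apply, h1]

lemma integrable_radial_iff (e : V₁ ≃ₗᵢ[ℝ] V₂) (U : ℝ → ℝ) :
    Integrable (fun x : V₁ => U ‖x‖) ↔ Integrable (fun x : V₂ => U ‖x‖) := by
  rw [← (LinearIsometryEquiv.measurePreserving e).integrable_comp_emb
    e.toHomeomorph.measurableEmbedding]
  simp [Function.comp_def]

/-- **Slicing.** The Fourier transform of a radial function on `V × E` restricted to `V` is the
Fourier transform of its integral over the fibres `E`, which is a radial function on `V`. -/
lemma fourierInt_slice (U : ℝ → ℝ) (hU : Integrable (fun z : WithLp 2 (V × E) => U ‖z‖)) :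
    Integrable (fun x : V => ∫ y : E, U (√(‖x‖ ^ 2 + ‖y‖ ^ 2))) ∧
    ∀ ξ : V, fourierInt (fun z : WithLp 2 (V × E) => U ‖z‖) (WithLp.toLp 2 (ξ, 0)) =
      fourierInt (fun x : V => ∫ y : E, U (√(‖x‖ ^ 2 + ‖y‖ ^ 2))) ξ := by
  have hmp := WithLp.volume_preserving_toLp V E
  have hemb : MeasurableEmbedding (WithLp.toLp 2 : V × E → WithLp 2 (V × E)) :=
    (MeasurableEquiv.toLp 2 (V × E)).measurableEmbedding
  have hn : ∀ p : V × E, ‖WithLp.toLp 2 p‖ = √(‖p.1‖ ^ 2 + ‖p.2‖ ^ 2) := fun p =>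
    WithLp.prod_norm_eq_of_L2 _
  have h1 : Integrable (fun p : V × E => U (√(‖p.1‖ ^ 2 + ‖p.2‖ ^ 2)))
      (volume.prod volume) := by
    have := (hmp.integrable_comp_emb hemb).2 hU
    simpa only [Function.comp_def, hn] using! this
  refine ⟨h1.integral_prod_left, fun ξ => ?_⟩
  rw [fourierInt, fourierInt, ← hmp.integral_comp hemb]
  have hin : ∀ p : V × E, (inner ℝ (WithLp.toLp 2 p) (WithLp.toLp 2 (ξ, (0 : E))) : ℝ) =
      inner ℝ p.1 ξ := by
    intro p; simp [WithLp.prod_inner_apply]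
  simp only [hin, hn]
  have h2 : Integrable (fun p : V × E => Complex.exp (-(Complex.I * ((inner ℝ p.1 ξ : ℝ) : ℂ))) *
      ((U (√(‖p.1‖ ^ 2 + ‖p.2‖ ^ 2)) : ℝ) : ℂ)) (volume.prod volume) := by
    refine h1.ofReal.bdd_mul (c := 1) (Continuous.aestronglyMeasurable (by fun_prop))
      (ae_of_all _ fun p => ?_)
    rw [Complex.norm_exp]
    simp
  calc _ = ∫ p : V × E, Complex.exp (-(Complex.I * ((inner ℝ p.1 ξ : ℝ) : ℂ))) *
      ((U (√(‖p.1‖ ^ 2 + ‖p.2‖ ^ 2)) : ℝ) : ℂ) ∂(volume.prod volume) := rfl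
    _ = _ := integral_prod _ h2
    _ = _ := by
      congr 1; ext x
      simp only
      rw [integral_const_mul, integral_complex_ofReal]

end Radial

/-- The radial function with profile `U` is integrable on `ℝ^d` and has Fourier transform
`ξ ↦ g ‖ξ‖`. -/
def HasRadialFourier (d : ℕ) (U : ℝ → ℝ) (g : ℝ → ℂ) : Prop :=
  Integrable (fun x : Euc d => U ‖x‖) ∧ ∀ ξ : Euc d, fourierInt (fun x : Euc d => U ‖x‖) ξ = g ‖ξ‖

/-- Two radial profiles agreeing on `(0, ∞)` define almost everywhere equal functions. -/
lemma radial_ae_eq {d : ℕ} (hd : 1 ≤ d) {U U' : ℝ → ℝ} (h : ∀ s, 0 < s → U s = U' s) :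
    (fun x : Euc d => U ‖x‖) =ᵐ[volume] fun x => U' ‖x‖ := by
  have : Nonempty (Fin d) := ⟨⟨0, hd⟩⟩
  have : ∀ᵐ x : Euc d, x ≠ 0 := by
    rw [ae_iff]; simp
  filter_upwards [this] with x hx
  exact h _ (norm_pos_iff.2 hx)

lemma fourierInt_congr_ae {V : Type*} [NormedAddCommGroup V] [InnerProductSpace ℝ V]
    [MeasureSpace V] {f f' : V → ℝ} (h : f =ᵐ[volume] f') (ξ : V) :
    fourierInt f ξ = fourierInt f' ξ := by
  refine integral_congr_ae ?_
  filter_upwards [h] with x hx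
  rw [hx]

lemma nonempty_isometry_of_finrank {V : Type*} [NormedAddCommGroup V] [InnerProductSpace ℝ V]
    [FiniteDimensional ℝ V] {n : ℕ} (h : Module.finrank ℝ V = n) : Nonempty (V ≃ₗᵢ[ℝ] Euc n) :=
  ⟨(stdOrthonormalBasis ℝ V).repr.trans (LinearIsometryEquiv.piLpCongrLeft 2 ℝ ℝ (finCongr h))⟩

lemma nonempty_isometry_prod (n m : ℕ) :
    Nonempty (WithLp 2 (Euc n × Euc m) ≃ₗᵢ[ℝ] Euc (n + m)) := by
  refine nonempty_isometry_of_finrank ?_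
  rw [(WithLp.linearEquiv 2 ℝ (Euc n × Euc m)).finrank_eq, Module.finrank_prod]
  simp

lemma exists_norm_eq_euc {d : ℕ} (hd : 1 ≤ d) {a : ℝ} (ha : 0 ≤ a) : ∃ ξ : Euc d, ‖ξ‖ = a := by
  have : Nonempty (Fin d) := ⟨⟨0, hd⟩⟩
  have : Nontrivial (Euc d) := inferInstance
  exact _root_.exists_norm_eq (Euc d) ha

lemma fourierInt_slice_euc {n m : ℕ} {U : ℝ → ℝ} (hU : Integrable (fun z : Euc (n + m) => U ‖z‖)) :
    Integrable (fun x : Euc n => ∫ y : Euc m, U (√(‖x‖ ^ 2 + ‖y‖ ^ 2))) ∧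
    ∀ (ξ : Euc n) (η : Euc (n + m)), ‖ξ‖ = ‖η‖ → fourierInt (fun z : Euc (n + m) => U ‖z‖) η =
      fourierInt (fun x : Euc n => ∫ y : Euc m, U (√(‖x‖ ^ 2 + ‖y‖ ^ 2))) ξ := by
  obtain ⟨e⟩ := nonempty_isometry_prod n m
  obtain ⟨h1, h2⟩ := fourierInt_slice (V := Euc n) (E := Euc m) U
    ((integrable_radial_iff e U).2 hU)
  refine ⟨h1, fun ξ η h => ?_⟩
  rw [← h2 ξ]
  refine (fourierInt_radial_congr e U ?_).symm
  rw [← h, WithLp.prod_norm_eq_of_L2]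
  simp

/-- Raising the dimension: a radial profile whose fibre integrals reproduce `U` has the same
radial Fourier transform as `U`. -/
lemma HasRadialFourier.raise {n m : ℕ} (hn : 1 ≤ n) {U U' : ℝ → ℝ} {g : ℝ → ℂ}
    (h : HasRadialFourier n U g) (hU' : Integrable (fun z : Euc (n + m) => U' ‖z‖))
    (hs : ∀ s, 0 < s → ∫ y : Euc m, U' (√(s ^ 2 + ‖y‖ ^ 2)) = U s) :
    HasRadialFourier (n + m) U' g := by
  refine ⟨hU', fun η => ?_⟩
  obtain ⟨ξ, hξ⟩ := exists_norm_eq_euc hn (norm_nonneg η)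
  rw [(fourierInt_slice_euc hU').2 ξ η hξ, ← hξ, ← h.2 ξ]
  exact fourierInt_congr_ae (radial_ae_eq hn hs) ξ

/-- Lowering the dimension by integration over the fibres. -/
lemma HasRadialFourier.lower {n m : ℕ} (hn : 1 ≤ n) {U U' : ℝ → ℝ} {g : ℝ → ℂ}
    (h : HasRadialFourier (n + m) U' g)
    (hs : ∀ s, 0 < s → ∫ y : Euc m, U' (√(s ^ 2 + ‖y‖ ^ 2)) = U s) :
    HasRadialFourier n U g := by
  have hae : (fun x : Euc n => ∫ y : Euc m, U' (√(‖x‖ ^ 2 + ‖y‖ ^ 2))) =ᵐ[volume]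
    fun x => U ‖x‖ := radial_ae_eq hn hs
  refine ⟨(fourierInt_slice_euc h.1).1.congr hae, fun ξ => ?_⟩
  obtain ⟨η, hη⟩ := exists_norm_eq_euc (d := n + m) (by omega) (norm_nonneg ξ)
  rw [← hη, ← h.2 η, (fourierInt_slice_euc h.1).2 ξ η hη.symm]
  exact fourierInt_congr_ae hae.symm ξ

lemma hasRadialFourier_one {v : ℝ → ℝ} (hv : Integrable v) (heven : ∀ t, v (-t) = v t) :
    HasRadialFourier 1 v (fun s => fourierInt v s) := by
  have habs : (fun t : ℝ => v ‖t‖) = v := by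
    ext t
    rcases abs_cases t with h | h <;> simp [Real.norm_eq_abs, h.1, heven]
  obtain ⟨e⟩ := nonempty_isometry_of_finrank (Module.finrank_self ℝ)
  refine ⟨(integrable_radial_iff e v).1 (by rwa [habs]), fun ξ => ?_⟩
  rw [← fourierInt_radial_congr e v (ξ₁ := ‖ξ‖) (by simp), habs]

/-! ### The operator `(1 / 2t) d/dt` and integration over planes -/

lemma derivSq_iterate_succ (k : ℕ) (v : ℝ → ℝ) (t : ℝ) :
    derivSq^[k + 1] v t = 1 / (2 * t) * deriv (derivSq^[k] v) t := by
  rw [Function.iterate_succ_apply']; rfl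

/-- On `(0, ∞)`, the iterate `((1/2t) d/dt)^k v` is a combination of the terms
`v⁽ᵐ⁾(t) t^(m-2k)`, `m ≤ k`. -/
lemma exists_derivSq_iterate_eq {r : ℕ} {v : ℝ → ℝ} (hv : ContDiff ℝ r v) {k : ℕ} (hk : k ≤ r) :
    ∃ c : ℕ → ℝ, ∀ t : ℝ, 0 < t → derivSq^[k] v t =
      ∑ m ∈ Finset.range (k + 1), c m * (iteratedDeriv m v t * t ^ ((m : ℤ) - 2 * k)) := by
  induction k with
  | zero => exact ⟨fun _ => 1, fun t ht => by simp⟩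
  | succ k ih =>
    obtain ⟨c, hc⟩ := ih (by omega)
    refine ⟨fun m => (if m = 0 then 0 else c (m - 1) / 2) +
      (if m < k + 1 then c m * ((m : ℤ) - 2 * k : ℤ) / 2 else 0), fun t ht => ?_⟩
    have hd : HasDerivAt (derivSq^[k] v) (∑ m ∈ Finset.range (k + 1), c m *
        (iteratedDeriv (m + 1) v t * t ^ ((m : ℤ) - 2 * k) +
          iteratedDeriv m v t * (((m : ℤ) - 2 * k : ℤ) * t ^ ((m : ℤ) - 2 * k - 1)))) t := by
      have h1 : HasDerivAt (fun t => ∑ m ∈ Finset.range (k + 1), c m *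
          (iteratedDeriv m v t * t ^ ((m : ℤ) - 2 * k))) (∑ m ∈ Finset.range (k + 1), c m *
        (iteratedDeriv (m + 1) v t * t ^ ((m : ℤ) - 2 * k) +
          iteratedDeriv m v t * (((m : ℤ) - 2 * k : ℤ) * t ^ ((m : ℤ) - 2 * k - 1)))) t := by
        refine HasDerivAt.fun_sum fun m hm => ?_
        refine HasDerivAt.const_mul _ (HasDerivAt.mul ?_ (hasDerivAt_zpow _ _ (Or.inl ht.ne')))
        have hm' : m < r := by have := Finset.mem_range.1 hm; omega
        rw [iteratedDeriv_succ]
        exact (hv.differentiable_iteratedDeriv m (by exact_mod_cast hm') t).hasDerivAt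
      refine h1.congr_of_eventuallyEq ?_
      filter_upwards [lt_mem_nhds ht] with s hs using hc s hs
    rw [derivSq_iterate_succ, hd.deriv]
    have hz : ∀ n : ℤ, t ^ n = t ^ (n + 1) * t⁻¹ := fun n => by
      rw [zpow_add_one₀ ht.ne', mul_assoc, mul_inv_cancel₀ ht.ne', mul_one]
    have hsum : ∀ a b T : ℕ → ℝ, ∑ m ∈ Finset.range (k + 1 + 1),
        ((if m = 0 then 0 else a (m - 1)) + (if m < k + 1 then b m else 0)) * T m =
        (∑ m ∈ Finset.range (k + 1), a m * T (m + 1)) + ∑ m ∈ Finset.range (k + 1), b m * T m := by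
      intro a b T
      simp only [add_mul, Finset.sum_add_distrib]
      congr 1
      · rw [Finset.sum_range_succ']
        simp
      · rw [Finset.sum_range_succ]
        simp only [lt_irrefl, if_false, zero_mul, add_zero]
        exact Finset.sum_congr rfl fun m hm => by rw [if_pos (Finset.mem_range.1 hm)]
    refine Eq.trans ?_ (hsum (fun m => c m / 2) (fun m => c m * ((m : ℤ) - 2 * k : ℤ) / 2) _).symm
    rw [Finset.mul_sum, ← Finset.sum_add_distrib]
    refine Finset.sum_congr rfl fun m hm => ?_
    have e1 : t ^ (((m + 1 : ℕ) : ℤ) - 2 * ((k + 1 : ℕ) : ℤ)) = t ^ ((m : ℤ) - 2 * k) * t⁻¹ := by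
      rw [hz]; congr 2; push_cast; ring
    have e2 : t ^ ((m : ℤ) - 2 * ((k + 1 : ℕ) : ℤ)) = t ^ ((m : ℤ) - 2 * k - 1) * t⁻¹ := by
      rw [hz]; congr 2; push_cast; ring
    rw [e1, e2]
    field_simp

/-- Off the origin the operator `(1/2t) d/dt` can be iterated on `C^r` functions `r` times. -/
lemma hasDerivAt_derivSq_iterate {r : ℕ} {v : ℝ → ℝ} (hv : ContDiff ℝ r v) {k : ℕ} (hk : k < r)
    {t : ℝ} (ht : 0 < t) : HasDerivAt (derivSq^[k] v) (2 * t * derivSq^[k + 1] v t) t := by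
  obtain ⟨c, hc⟩ := exists_derivSq_iterate_eq hv hk.le
  have h1 : DifferentiableAt ℝ (fun t => ∑ m ∈ Finset.range (k + 1), c m *
      (iteratedDeriv m v t * t ^ ((m : ℤ) - 2 * k))) t := by
    refine DifferentiableAt.fun_sum fun m hm => ?_
    have hm' : m < r := by have := Finset.mem_range.1 hm; omega
    exact ((hv.differentiable_iteratedDeriv m (by exact_mod_cast hm') t).mul
      (hasDerivAt_zpow _ _ (Or.inl ht.ne')).differentiableAt).const_mul _
  have h2 : DifferentiableAt ℝ (derivSq^[k] v) t := by
    refine h1.congr_of_eventuallyEq ?_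
    filter_upwards [lt_mem_nhds ht] with s hs using hc s hs
  rw [derivSq_iterate_succ, ← mul_assoc, mul_one_div_cancel (by positivity), one_mul]
  exact h2.hasDerivAt

lemma continuousOn_derivSq_iterate {r : ℕ} {v : ℝ → ℝ} (hv : ContDiff ℝ r v) {k : ℕ}
    (hk : k ≤ r) : ContinuousOn (derivSq^[k] v) (Ioi 0) := by
  obtain ⟨c, hc⟩ := exists_derivSq_iterate_eq hv hk
  refine ContinuousOn.congr (f := fun t => ∑ m ∈ Finset.range (k + 1), c m *
      (iteratedDeriv m v t * t ^ ((m : ℤ) - 2 * k))) ?_ fun t ht => hc t ht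
  refine continuousOn_finsetSum _ fun m hm => ?_
  have hm' : m ≤ r := by have := Finset.mem_range.1 hm; omega
  exact continuousOn_const.mul ((hv.continuous_iteratedDeriv m
    (by exact_mod_cast hm')).continuousOn.mul
      (continuousOn_id.zpow₀ _ fun t ht => Or.inl (ne_of_gt ht)))

/-- The decay of `(1/2t) d/dt` iterates: integrable against `t^(2k) dt`, including at the origin,
where the singularity `t^(-2k)` may occur. -/
lemma derivSq_iterate_bound {r : ℕ} {v : ℝ → ℝ} (hv : ContDiff ℝ r v) {ε C : ℝ}
    (hC : ∀ m : ℕ, m ≤ r → ∀ t : ℝ, |iteratedDeriv m v t| ≤ C * (1 + |t|) ^ (-((m : ℝ) + 1 + ε)))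
    {k : ℕ} (hk : k ≤ r) :
    ∃ K : ℝ, 0 ≤ K ∧ ∀ t : ℝ, 0 < t →
      t ^ (2 * k) * |derivSq^[k] v t| ≤ K * (1 + t) ^ (-(1 + ε)) := by
  obtain ⟨c, hc⟩ := exists_derivSq_iterate_eq hv hk
  have hC0 : 0 ≤ C := by
    have := (abs_nonneg _).trans (hC 0 (by omega) 0)
    simpa using this
  refine ⟨∑ m ∈ Finset.range (k + 1), |c m| * C, Finset.sum_nonneg fun m _ => by positivity,
    fun t ht => ?_⟩
  rw [hc t ht, Finset.sum_mul]
  calc _ ≤ t ^ (2 * k) * ∑ m ∈ Finset.range (k + 1),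
        |c m * (iteratedDeriv m v t * t ^ ((m : ℤ) - 2 * k))| := by
        gcongr; exact Finset.abs_sum_le_sum_abs _ _
    _ = ∑ m ∈ Finset.range (k + 1),
        t ^ (2 * k) * |c m * (iteratedDeriv m v t * t ^ ((m : ℤ) - 2 * k))| := Finset.mul_sum _ _ _
    _ ≤ _ := by
      refine Finset.sum_le_sum fun m hm => ?_
      have hm' : m ≤ r := by have := Finset.mem_range.1 hm; omega
      have e : t ^ (2 * k) * t ^ ((m : ℤ) - 2 * k) = t ^ m := by
        rw [← zpow_natCast, ← zpow_add₀ ht.ne', ← zpow_natCast]; congr 1; push_cast; ring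
      rw [abs_mul, abs_mul, abs_of_pos (zpow_pos ht ((m : ℤ) - 2 * k))]
      have h1 := hC m hm' t
      rw [abs_of_pos ht] at h1
      have h2 : t ^ m * (1 + t) ^ (-((m : ℝ) + 1 + ε)) ≤ (1 + t) ^ (-(1 + ε)) := by
        have h3 : (1 + t) ^ (-(1 + ε)) = (1 + t) ^ m * (1 + t) ^ (-((m : ℝ) + 1 + ε)) := by
          rw [← Real.rpow_natCast, ← Real.rpow_add (by positivity)]; congr 1; ring
        rw [h3]
        gcongr
        linarith
      calc t ^ (2 * k) * (|c m| * (|iteratedDeriv m v t| * t ^ ((m : ℤ) - 2 * k)))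
          = |c m| * ((t ^ (2 * k) * t ^ ((m : ℤ) - 2 * k)) * |iteratedDeriv m v t|) := by ring
        _ ≤ |c m| * (t ^ m * (C * (1 + t) ^ (-((m : ℝ) + 1 + ε)))) := by
          rw [e]; gcongr
        _ = |c m| * C * (t ^ m * (1 + t) ^ (-((m : ℝ) + 1 + ε))) := by ring
        _ ≤ _ := by gcongr

lemma integrable_of_decay {w : ℝ → ℝ} (hw : Continuous w) {a C : ℝ} (ha : 1 < a)
    (h : ∀ t, |w t| ≤ C * (1 + |t|) ^ (-a)) : Integrable w := by
  have h1 : Integrable (fun t : ℝ => C * (1 + ‖t‖) ^ (-a)) :=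
    (integrable_one_add_norm (E := ℝ) (μ := volume) (by simpa using ha)).const_mul C
  exact h1.mono' hw.aestronglyMeasurable (ae_of_all _ h)

/-- `((1/2t) d/dt)^k v` is an integrable radial profile in dimension `2k + 1`. -/
lemma integrable_derivSq_iterate {r : ℕ} {v : ℝ → ℝ} (hv : ContDiff ℝ r v) {ε C : ℝ} (hε : 0 < ε)
    (hC : ∀ m : ℕ, m ≤ r → ∀ t : ℝ, |iteratedDeriv m v t| ≤ C * (1 + |t|) ^ (-((m : ℝ) + 1 + ε)))
    {k : ℕ} (hk : k ≤ r) :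
    Integrable (fun x : Euc (2 * k + 1) => derivSq^[k] v ‖x‖) := by
  obtain ⟨K, hK0, hK⟩ := derivSq_iterate_bound hv hC hk
  rw [integrable_fun_norm_addHaar, finrank_euclideanSpace_fin, Nat.add_sub_cancel]
  have h1 : Integrable (fun t : ℝ => K * (1 + ‖t‖) ^ (-(1 + ε))) :=
    (integrable_one_add_norm (E := ℝ) (μ := volume) (by simpa using hε)).const_mul K
  refine h1.integrableOn.mono' (ContinuousOn.aestronglyMeasurable (ContinuousOn.smul
    (continuous_pow _).continuousOn (continuousOn_derivSq_iterate hv hk)) measurableSet_Ioi) ?_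
  filter_upwards [ae_restrict_mem measurableSet_Ioi] with t ht
  have ht' : 0 < t := ht
  rw [smul_eq_mul, norm_mul, Real.norm_of_nonneg (by positivity), Real.norm_of_nonneg ht'.le]
  exact hK t ht'

/-- Integration over planes undoes the operator `(1/2t) d/dt`. -/
lemma integral_plane {F G : ℝ → ℝ} (hF : ContinuousOn F (Ioi 0))
    (hG : ∀ t, 0 < t → HasDerivAt G (2 * t * F t) t) (hlim : Tendsto G atTop (𝓝 0))
    {s : ℝ} (hs : 0 < s) {K : ℝ} (hK : ∀ t, s ≤ t → |F t| ≤ K * (t ^ 3)⁻¹) :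
    ∫ y : Euc 2, F (√(s ^ 2 + ‖y‖ ^ 2)) = -Real.pi * G s := by
  have hpos : ∀ y : ℝ, 0 < s ^ 2 + y ^ 2 := fun y => by positivity
  rw [integral_fun_norm_addHaar volume (fun y => F (√(s ^ 2 + y ^ 2))),
    finrank_euclideanSpace_fin, Measure.real, EuclideanSpace.volume_ball_fin_two]
  -- in polar coordinates the integrand is a derivative
  have hd : ∀ y ∈ Ioi (0 : ℝ), HasDerivAt (fun y => G (√(s ^ 2 + y ^ 2)) / 2)
      (y ^ (2 - 1) • F (√(s ^ 2 + y ^ 2))) y := by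
    intro y _
    have h1 : HasDerivAt (fun y => √(s ^ 2 + y ^ 2)) (2 * y / (2 * √(s ^ 2 + y ^ 2))) y := by
      have h2 : HasDerivAt (fun y => s ^ 2 + y ^ 2) (2 * y) y := by
        simpa using (hasDerivAt_pow 2 y).const_add (s ^ 2)
      exact h2.sqrt (hpos y).ne'
    have hq : 0 < √(s ^ 2 + y ^ 2) := Real.sqrt_pos.2 (hpos y)
    have h3 := ((hG _ hq).comp y h1).div_const 2
    refine h3.congr_deriv ?_
    rw [smul_eq_mul, show 2 - 1 = 1 from rfl, pow_one]
    field_simp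
  have hs0 : √(s ^ 2 + 0 ^ 2) = s := by simp [Real.sqrt_sq hs.le]
  have hK0 : 0 ≤ K := by
    have := (abs_nonneg _).trans (hK s le_rfl)
    exact nonneg_of_mul_nonneg_left this (by positivity)
  have hint : IntegrableOn (fun y => y ^ (2 - 1) • F (√(s ^ 2 + y ^ 2))) (Ioi 0) := by
    have h1 : Integrable (fun y : ℝ => K * (s⁻¹ ^ 2 * (1 + (s⁻¹ * y) ^ 2)⁻¹)) :=
      ((integrable_inv_one_add_sq.comp_mul_left' (inv_ne_zero hs.ne')).const_mul _).const_mul _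
    refine h1.integrableOn.mono' (ContinuousOn.aestronglyMeasurable (ContinuousOn.smul
      (continuous_pow _).continuousOn (hF.comp (by fun_prop) fun y _ => Real.sqrt_pos.2 (hpos y)))
        measurableSet_Ioi) ?_
    filter_upwards [ae_restrict_mem measurableSet_Ioi] with y hy
    have hy' : 0 < y := hy
    have hq : 0 < √(s ^ 2 + y ^ 2) := Real.sqrt_pos.2 (hpos y)
    have hsq : √(s ^ 2 + y ^ 2) ^ 2 = s ^ 2 + y ^ 2 := Real.sq_sqrt (hpos y).le
    have hyq : y ≤ √(s ^ 2 + y ^ 2) := Real.le_sqrt_of_sq_le (by nlinarith)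
    have h2 := hK (√(s ^ 2 + y ^ 2)) (Real.le_sqrt_of_sq_le (by nlinarith))
    rw [smul_eq_mul, norm_mul, Real.norm_eq_abs, Real.norm_eq_abs]
    simp only [Nat.add_one_sub_one, pow_one]
    rw [abs_of_pos hy']
    calc y * |F (√(s ^ 2 + y ^ 2))| ≤ √(s ^ 2 + y ^ 2) * (K * (√(s ^ 2 + y ^ 2) ^ 3)⁻¹) := by
          gcongr
      _ = K * (√(s ^ 2 + y ^ 2) ^ 2)⁻¹ := by field_simp
      _ = _ := by rw [hsq]; congr 1; rw [inv_pow, ← mul_inv]; congr 1; field_simp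
  have hlim' : Tendsto (fun y => G (√(s ^ 2 + y ^ 2)) / 2) atTop (𝓝 (0 / 2)) := by
    refine Tendsto.div_const (hlim.comp ?_) 2
    refine tendsto_atTop_mono (f := fun y => y) (fun y => Real.le_sqrt_of_sq_le (by nlinarith))
      tendsto_id
  have hcont : ContinuousWithinAt (fun y => G (√(s ^ 2 + y ^ 2)) / 2) (Ici 0) 0 := by
    have h1 : ContinuousAt G (√(s ^ 2 + 0 ^ 2)) := by rw [hs0]; exact (hG s hs).continuousAt
    have h2 : ContinuousAt (fun y : ℝ => √(s ^ 2 + y ^ 2)) 0 := by fun_prop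
    exact ((ContinuousAt.comp (f := fun y : ℝ => √(s ^ 2 + y ^ 2)) h1 h2).div_const
      2).continuousWithinAt
  rw [integral_Ioi_of_hasDerivAt_of_tendsto hcont hd hint hlim', hs0]
  simp [Real.pi_pos.le]
  ring

/-! ### The Fourier transform of `R^♯ v` -/

lemma HasRadialFourier.const_mul {d : ℕ} {U : ℝ → ℝ} {g : ℝ → ℂ} (h : HasRadialFourier d U g)
    (c : ℝ) : HasRadialFourier d (fun s => c * U s) (fun s => c * g s) := by
  refine ⟨h.1.const_mul c, fun ξ => ?_⟩
  simp only
  rw [← h.2 ξ, fourierInt, fourierInt, ← integral_const_mul]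
  congr 1; ext x
  push_cast; ring

section Profile

variable {r : ℕ} {v : ℝ → ℝ} {ε C : ℝ}

/-- The Fourier slice theorem in odd dimensions: `((1/2t) d/dt)^k v` is, up to the factor
`(-π)^k`, the profile on `ℝ^(2k+1)` with Fourier transform `F v`. -/
lemma hasRadialFourier_derivSq_iterate (hv : ContDiff ℝ r v) (heven : ∀ t, v (-t) = v t)
    (hε : 0 < ε)
    (hC : ∀ m : ℕ, m ≤ r → ∀ t : ℝ, |iteratedDeriv m v t| ≤ C * (1 + |t|) ^ (-((m : ℝ) + 1 + ε)))
    {k : ℕ} (hk : k ≤ r) :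
    HasRadialFourier (2 * k + 1) (derivSq^[k] v)
      (fun s => (((-Real.pi) ^ k : ℝ) : ℂ) * fourierInt v s) := by
  induction k with
  | zero =>
    have hi : Integrable v := integrable_of_decay hv.continuous (a := 1 + ε) (C := C)
      (by linarith) fun t => by simpa using hC 0 (by omega) t
    simpa using! hasRadialFourier_one hi heven
  | succ k ih =>
    have h1 := (ih (by omega)).const_mul (-Real.pi)
    have h2 := h1.raise (m := 2) (by omega) (U' := derivSq^[k + 1] v)
      (integrable_derivSq_iterate hv hε hC hk) fun s hs => ?_
    · have e : (fun s => (((-Real.pi) ^ (k + 1) : ℝ) : ℂ) * fourierInt v s) =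
          fun s => ((-Real.pi : ℝ) : ℂ) * ((((-Real.pi) ^ k : ℝ) : ℂ) * fourierInt v s) := by
        ext s; push_cast; ring
      rw [e]
      exact h2
    · obtain ⟨K, hK0, hK⟩ := derivSq_iterate_bound hv hC hk
      obtain ⟨K', hK0', hK'⟩ := derivSq_iterate_bound hv hC (show k ≤ r by omega)
      refine integral_plane (continuousOn_derivSq_iterate hv hk)
        (fun t ht => hasDerivAt_derivSq_iterate hv (by omega) ht) ?_ hs
        (K := K * (s ^ (2 * k))⁻¹) fun t hst => ?_
      · refine squeeze_zero_norm' (a := fun t : ℝ => K' * (1 + t) ^ (-(1 + ε))) ?_ ?_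
        · filter_upwards [eventually_ge_atTop 1] with t ht
          have ht0 : 0 < t := by linarith
          refine le_trans ?_ (hK' t ht0)
          exact le_mul_of_one_le_left (abs_nonneg _) (one_le_pow₀ ht)
        · have h3 := ((tendsto_rpow_neg_atTop (show 0 < 1 + ε by linarith)).comp
            (tendsto_atTop_add_const_left atTop (1 : ℝ) tendsto_id)).const_mul K'
          simpa using! h3
      · have ht : 0 < t := hs.trans_le hst
        have h3 : (1 + t) ^ (-(1 + ε)) ≤ t⁻¹ := by
          rw [Real.rpow_neg (by positivity)]
          refine inv_anti₀ ht ?_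
          calc t ≤ (1 + t) ^ (1 : ℝ) := by rw [Real.rpow_one]; linarith
            _ ≤ _ := Real.rpow_le_rpow_of_exponent_le (by linarith) (by linarith)
        have h4 : t ^ (2 * (k + 1)) * |derivSq^[k + 1] v t| ≤ K * t⁻¹ :=
          (hK t ht).trans (by gcongr)
        have h5 : |derivSq^[k + 1] v t| ≤ K * (t ^ (2 * k))⁻¹ * (t ^ 3)⁻¹ := by
          have : |derivSq^[k + 1] v t| =
              (t ^ (2 * (k + 1)))⁻¹ * (t ^ (2 * (k + 1)) * |derivSq^[k + 1] v t|) := by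
            field_simp
          rw [this]
          calc _ ≤ (t ^ (2 * (k + 1)))⁻¹ * (K * t⁻¹) := by gcongr
            _ = _ := by field_simp; ring
        refine h5.trans ?_
        gcongr

end Profile

lemma integral_euc_one (f : ℝ → ℝ) : ∫ y : Euc 1, f ‖y‖ = 2 * ∫ y in Ioi (0 : ℝ), f y := by
  obtain ⟨e⟩ := nonempty_isometry_of_finrank (Module.finrank_self ℝ)
  rw [← (LinearIsometryEquiv.measurePreserving e).integral_comp e.toHomeomorph.measurableEmbedding]
  simp only [LinearIsometryEquiv.norm_map, Real.norm_eq_abs]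
  exact integral_comp_abs

/-- The Abel-type integral of `F` written as an integral over a line at distance `s`. -/
lemma integral_abel (F : ℝ → ℝ) {s : ℝ} (hs : 0 < s) :
    ∫ t in Ioi s, F t / √(t ^ 2 - s ^ 2) * t = ∫ y in Ioi (0 : ℝ), F (√(s ^ 2 + y ^ 2)) := by
  have hpos : ∀ y : ℝ, 0 < s ^ 2 + y ^ 2 := fun y => by positivity
  have himg : (fun y : ℝ => √(s ^ 2 + y ^ 2)) '' Ioi 0 = Ioi s := by
    ext t
    constructor
    · rintro ⟨y, hy, rfl⟩
      have hy' : 0 < y := hy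
      exact Real.lt_sqrt_of_sq_lt (by nlinarith)
    · intro ht
      have ht' : s < t := ht
      have h0 : 0 < t ^ 2 - s ^ 2 := by nlinarith
      refine ⟨√(t ^ 2 - s ^ 2), Real.sqrt_pos.2 h0, ?_⟩
      simp only
      rw [Real.sq_sqrt h0.le, add_sub_cancel, Real.sqrt_sq (by linarith)]
  have hd : ∀ y ∈ Ioi (0 : ℝ), HasDerivWithinAt (fun y => √(s ^ 2 + y ^ 2))
      (y / √(s ^ 2 + y ^ 2)) (Ioi 0) y := by
    intro y _
    have h2 : HasDerivAt (fun y => s ^ 2 + y ^ 2) (2 * y) y := by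
      simpa using (hasDerivAt_pow 2 y).const_add (s ^ 2)
    refine ((h2.sqrt (hpos y).ne').congr_deriv ?_).hasDerivWithinAt
    rw [mul_div_mul_left _ _ two_ne_zero]
  have hinj : InjOn (fun y : ℝ => √(s ^ 2 + y ^ 2)) (Ioi 0) := by
    intro a ha b hb hab
    have ha' : 0 < a := ha
    have hb' : 0 < b := hb
    have := (Real.sqrt_inj (hpos a).le (hpos b).le).1 hab
    nlinarith [mul_self_inj_of_nonneg ha'.le hb'.le]
  rw [← himg, integral_image_eq_integral_abs_deriv_smul measurableSet_Ioi hd hinj]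
  refine setIntegral_congr_fun measurableSet_Ioi fun y hy => ?_
  have hy' : 0 < y := hy
  have hq : 0 < √(s ^ 2 + y ^ 2) := Real.sqrt_pos.2 (hpos y)
  rw [Real.sq_sqrt (hpos y).le, add_sub_cancel_left, Real.sqrt_sq hy'.le, abs_of_pos (by positivity),
    smul_eq_mul]
  field_simp

/-- The profile of the radial function `R^♯ v`. -/
def radonProfile (d : ℕ) (v : ℝ → ℝ) (s : ℝ) : ℝ :=
  if Odd d then
    (-1) ^ ((d - 1) / 2) / √(Real.pi ^ (d - 1)) * (derivSq^[(d - 1) / 2] v) s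
  else
    2 * (-1) ^ (d / 2) / √(Real.pi ^ d) *
      ∫ t in Ioi s, (derivSq^[d / 2] v) t / √(t ^ 2 - s ^ 2) * t

lemma radonSharp_eq_profile (d : ℕ) (v : ℝ → ℝ) :
    radonSharp d v = fun x => radonProfile d v ‖x‖ := rfl

/-- The Fourier slice theorem for `R^♯ v`. The even-dimensional case follows from the next odd
dimension, since `R^♯ v` on `ℝ^(2k)` is the integral of `R^♯ v` on `ℝ^(2k+1)` over lines. -/
lemma hasRadialFourier_radonProfile {d : ℕ} (hd : 1 ≤ d) {v : ℝ → ℝ}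
    (hv : ContDiff ℝ (d / 2 : ℕ) v) (heven : ∀ t, v (-t) = v t)
    (hdecay : SufficientDecay (d / 2) v) :
    HasRadialFourier d (radonProfile d v) (fun s => fourierInt v s) := by
  obtain ⟨ε, hε, C, hC⟩ := hdecay
  have hπ := Real.pi_pos
  have hc : ∀ k : ℕ, (-1) ^ k / √(Real.pi ^ (2 * k)) * (-Real.pi) ^ k = 1 := by
    intro k
    rw [pow_mul', Real.sqrt_sq (by positivity), neg_pow Real.pi, div_mul_eq_mul_div, ← mul_assoc,
      ← mul_pow]
    field_simp
    simp
  have key : ∀ k, k ≤ d / 2 → HasRadialFourier (2 * k + 1)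
      (fun s => (-1) ^ k / √(Real.pi ^ (2 * k)) * derivSq^[k] v s) (fun s => fourierInt v s) := by
    intro k hk
    have h := (hasRadialFourier_derivSq_iterate hv heven hε hC hk).const_mul
      ((-1) ^ k / √(Real.pi ^ (2 * k)))
    simp only [← mul_assoc, ← Complex.ofReal_mul, hc, Complex.ofReal_one, one_mul] at h
    exact h
  rcases Nat.even_or_odd' d with ⟨k, rfl | rfl⟩
  · have h := key k (by omega)
    refine HasRadialFourier.lower (by omega) h fun s hs => ?_
    rw [integral_euc_one (fun y => (-1) ^ k / √(Real.pi ^ (2 * k)) *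
      derivSq^[k] v (√(s ^ 2 + y ^ 2))), integral_const_mul, ← integral_abel _ hs, radonProfile,
      if_neg (by simp)]
    rw [show 2 * k / 2 = k by omega]
    ring
  · have h := key k (by omega)
    have e : radonProfile (2 * k + 1) v =
        fun s => (-1) ^ k / √(Real.pi ^ (2 * k)) * derivSq^[k] v s := by
      ext s
      rw [radonProfile, if_pos ⟨k, rfl⟩, show (2 * k + 1 - 1) / 2 = k by omega,
        Nat.add_sub_cancel]
    rw [e]
    exact h

/-! ### Multiscale decompositions under `R^♯` -/

/-- Null sets of radii correspond to null sets of points. -/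
lemma ae_norm_of_ae {d : ℕ} (hd : 1 ≤ d) {p : ℝ → Prop} (h : ∀ᵐ s : ℝ, p s) :
    ∀ᵐ x : Euc d, p ‖x‖ := by
  have : Nonempty (Fin d) := ⟨⟨0, hd⟩⟩
  have hN : volume (toMeasurable volume {s | ¬ p s}) = 0 := by rw [measure_toMeasurable]; exact h
  -- integrate the indicator of a measurable null hull of the exceptional radii
  set N := toMeasurable volume {s | ¬ p s} with hNdef
  have hN' : ∀ᵐ s : ℝ, s ∉ N := measure_eq_zero_iff_ae_notMem.1 hN
  set f : ℝ → ℝ := N.indicator fun _ => 1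
  have hz : (fun y : ℝ => y ^ (Module.finrank ℝ (Euc d) - 1) • f y) =ᵐ[volume] fun _ => 0 := by
    filter_upwards [hN'] with s hs
    simp [f, hs]
  have hz' : (fun y : ℝ => y ^ (Module.finrank ℝ (Euc d) - 1) • f y)
      =ᵐ[volume.restrict (Ioi 0)] fun _ => 0 := ae_restrict_of_ae hz
  have h1 : Integrable (fun x : Euc d => f ‖x‖) := by
    rw [integrable_fun_norm_addHaar]
    exact (integrable_zero _ _ _).congr hz'.symm
  have h2 : ∫ x : Euc d, f ‖x‖ = 0 := by
    rw [integral_fun_norm_addHaar, integral_congr_ae hz']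
    simp
  rw [integral_eq_zero_iff_of_nonneg
    (fun x => indicator_nonneg (fun _ _ => zero_le_one) _) h1] at h2
  filter_upwards [h2] with x hx
  by_contra hp
  have : ‖x‖ ∈ N := subset_toMeasurable volume {s | ¬ p s} hp
  simp [this] at hx

lemma memLp_two_of_decay {w : ℝ → ℝ} (hw : Continuous w) {a C : ℝ} (ha : 1 < a)
    (h : ∀ t, |w t| ≤ C * (1 + |t|) ^ (-a)) : MemLp w 2 volume := by
  rw [memLp_two_iff_integrable_sq hw.aestronglyMeasurable]
  refine ((integrable_of_decay hw ha h).abs.const_mul C).mono' (by fun_prop)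
    (ae_of_all _ fun t => ?_)
  have hC : 0 ≤ C := by simpa using (abs_nonneg _).trans (h 0)
  have h1 : |w t| ≤ C := (h t).trans (mul_le_of_le_one_right hC
    (Real.rpow_le_one_of_one_le_of_nonpos (by linarith [abs_nonneg t]) (by linarith)))
  rw [Real.norm_eq_abs, abs_pow, sq]
  exact mul_le_mul_of_nonneg_right h1 (abs_nonneg _)

lemma iteratedDeriv_ofReal {r : ℕ} {v : ℝ → ℝ} (hv : ContDiff ℝ r v) {m : ℕ} (hm : m ≤ r) :
    iteratedDeriv m (fun t => (v t : ℂ)) = fun t => ((iteratedDeriv m v t : ℝ) : ℂ) := by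
  induction m with
  | zero => simp
  | succ m ih =>
    rw [iteratedDeriv_succ, ih (by omega)]
    ext t
    rw [iteratedDeriv_succ]
    exact (hv.differentiable_iteratedDeriv m
      (by exact_mod_cast hm) t).hasDerivAt.ofReal_comp.deriv

/-- The transform of an `H^r` function is square integrable against `s^n`, `n ≤ 2r`. -/
lemma integrableOn_pow_mul_fourier {r : ℕ} {v : ℝ → ℝ} (hv : ContDiff ℝ r v)
    (hdecay : SufficientDecay r v) {n : ℕ} (hn : n ≤ 2 * r) :
    IntegrableOn (fun s : ℝ => s ^ n * ‖𝓕 (fun t => (v t : ℂ)) s‖ ^ 2) (Ioi 0) := by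
  obtain ⟨ε, hε, C, hC⟩ := hdecay
  have hcont : ∀ m, m ≤ r → Continuous (iteratedDeriv m v) := fun m hm =>
    hv.continuous_iteratedDeriv m (by exact_mod_cast hm)
  have ha : ∀ m : ℕ, 1 < (m : ℝ) + 1 + ε := fun m => by
    have : (0 : ℝ) ≤ m := m.cast_nonneg
    linarith
  have hi : ∀ m, m ≤ r → Integrable (iteratedDeriv m (fun t => (v t : ℂ))) := fun m hm => by
    rw [iteratedDeriv_ofReal hv hm]
    exact (integrable_of_decay (hcont m hm) (ha m) (hC m hm)).ofReal
  have hL : ∀ m, m ≤ r →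
      Integrable (fun s => ‖𝓕 (iteratedDeriv m (fun t => (v t : ℂ))) s‖ ^ 2) := fun m hm => by
    have h2 : MemLp (iteratedDeriv m (fun t => (v t : ℂ))) 2 volume := by
      rw [iteratedDeriv_ofReal hv hm]
      exact (memLp_two_of_decay (hcont m hm) (ha m) (hC m hm)).ofReal
    exact (isFourierPair_of_memLp (hi m hm) h2).memLp_right.integrable_norm_pow (by norm_num)
  have h0 := hL 0 (by omega)
  rw [iteratedDeriv_zero] at h0
  have hF := Real.fourier_iteratedDeriv (N := r) (n := r) (f := fun t => (v t : ℂ))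
    (Complex.ofRealCLM.contDiff.comp hv) (fun m hm => hi m (by exact_mod_cast hm)) le_rfl
  have hr := hL r le_rfl
  have hv1 : Integrable (fun t => (v t : ℂ)) := by simpa using hi 0 (by omega)
  refine (h0.add hr).integrableOn.mono' (Continuous.aestronglyMeasurable ?_) ?_
  · have := continuous_fourier hv1
    fun_prop
  · filter_upwards [ae_restrict_mem measurableSet_Ioi] with s hs
    have hs' : 0 < s := hs
    -- `s ^ n ≤ 1 + (2 π s) ^ (2 r)`, treating `s ≤ 1` and `s ≥ 1` separately
    rw [Pi.add_apply, hF, norm_smul, mul_pow, Real.norm_of_nonneg (by positivity), norm_pow,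
      ← pow_mul, ← one_add_mul]
    refine mul_le_mul_of_nonneg_right ?_ (by positivity)
    have e : ‖2 * (Real.pi : ℂ) * Complex.I * (s : ℂ)‖ = 2 * Real.pi * s := by
      simp [abs_of_pos Real.pi_pos, abs_of_pos hs']
    rw [e]
    rcases le_total s 1 with h | h
    · have := pow_le_one₀ (n := n) hs'.le h
      have : 0 ≤ (2 * Real.pi * s) ^ (r * 2) := by positivity
      linarith
    · have h1 : s ^ n ≤ s ^ (r * 2) := pow_le_pow_right₀ h (by omega)
      have h2 : s ^ (r * 2) ≤ (2 * Real.pi * s) ^ (r * 2) := by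
        gcongr
        nlinarith [Real.pi_gt_three]
      linarith

section RadonSharp

variable {d : ℕ} {v : ℝ → ℝ}

lemma integrable_radonSharp (hd : 1 ≤ d) (hv : ContDiff ℝ (d / 2 : ℕ) v)
    (heven : ∀ t, v (-t) = v t) (hdecay : SufficientDecay (d / 2) v) :
    Integrable (radonSharp d v) :=
  (hasRadialFourier_radonProfile hd hv heven hdecay).1

/-- Fourier slice theorem for `R^♯`. -/
lemma fourierInt_radonSharp (hd : 1 ≤ d) (hv : ContDiff ℝ (d / 2 : ℕ) v)
    (heven : ∀ t, v (-t) = v t) (hdecay : SufficientDecay (d / 2) v) (ξ : Euc d) :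
    fourierInt (radonSharp d v) ξ = fourierInt v ‖ξ‖ :=
  (hasRadialFourier_radonProfile hd hv heven hdecay).2 ξ

lemma fourier_radonSharp (hd : 1 ≤ d) (hv : ContDiff ℝ (d / 2 : ℕ) v)
    (heven : ∀ t, v (-t) = v t) (hdecay : SufficientDecay (d / 2) v) (ξ : Euc d) :
    𝓕 (fun x => (radonSharp d v x : ℂ)) ξ = 𝓕 (fun t => (v t : ℂ)) ‖ξ‖ := by
  rw [fourier_eq_fourierInt, fourier_eq_fourierInt, fourierInt_radonSharp hd hv heven hdecay,
    norm_smul, Real.norm_of_nonneg (by positivity), smul_eq_mul]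

/-- Square integrability is checked on the Fourier side, where it is a weighted bound on `F v`. -/
lemma memLp_two_radonSharp (hd : 1 ≤ d) (hv : ContDiff ℝ (d / 2 : ℕ) v)
    (heven : ∀ t, v (-t) = v t) (hdecay : SufficientDecay (d / 2) v) :
    MemLp (radonSharp d v) 2 volume := by
  have : Nonempty (Fin d) := ⟨⟨0, hd⟩⟩
  have hi := (integrable_radonSharp hd hv heven hdecay).ofReal (𝕜 := ℂ)
  refine memLp_of_ofReal (isFourierPair_of_integrable hi ?_).memLp_left
  rw [memLp_two_iff_integrable_sq_norm (continuous_fourier hi).aestronglyMeasurable]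
  have e : ∀ ξ, 𝓕 (fun x => (radonSharp d v x : ℂ)) ξ = 𝓕 (fun t => (v t : ℂ)) ‖ξ‖ :=
    fourier_radonSharp hd hv heven hdecay
  have h1 := (integrable_fun_norm_addHaar (E := Euc d) volume
    (f := fun s => ‖𝓕 (fun t => (v t : ℂ)) s‖ ^ 2)).2 (by
      rw [finrank_euclideanSpace_fin]
      exact integrableOn_pow_mul_fourier hv hdecay (by omega))
  refine h1.congr (ae_of_all _ fun ξ => ?_)
  exact (congrArg (fun z => ‖z‖ ^ 2) (e ξ)).symm

lemma derivSq_scale (φ : ℝ → ℝ) {a : ℝ} (ha : a ≠ 0) (c : ℝ) :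
    derivSq (fun t => c * φ (a * t)) = fun t => c * a ^ 2 * derivSq φ (a * t) := by
  ext t
  simp only [derivSq]
  rw [deriv_const_mul_field, deriv_comp_mul_left, smul_eq_mul]
  rcases eq_or_ne t 0 with rfl | ht
  -- at the origin both sides vanish, since `1 / 0 = 0`
  · simp
  · field_simp

lemma derivSq_iterate_scale (φ : ℝ → ℝ) {a : ℝ} (ha : a ≠ 0) (c : ℝ) (k : ℕ) :
    derivSq^[k] (fun t => c * φ (a * t)) = fun t => c * a ^ (2 * k) * derivSq^[k] φ (a * t) := by
  induction k with
  | zero => simp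
  | succ k ih =>
    rw [Function.iterate_succ_apply', ih, derivSq_scale _ ha, Function.iterate_succ_apply']
    ext t; ring

/-- The operator `R^♯` intertwines dilations. -/
lemma radonSharp_scale (hd : 1 ≤ d) (φ : ℝ → ℝ) {a : ℝ} (ha : 0 < a) (c : ℝ) (x : Euc d) :
    radonSharp d (fun t => c * φ (a * t)) x = c * a ^ (d - 1) * radonSharp d φ (a • x) := by
  rw [radonSharp_eq_profile, radonSharp_eq_profile]
  simp only [radonProfile, norm_smul, Real.norm_of_nonneg ha.le, derivSq_iterate_scale φ ha.ne']
  rcases Nat.even_or_odd' d with ⟨k, rfl | rfl⟩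
  · rw [if_neg (by simp), if_neg (by simp), show 2 * k / 2 = k by omega]
    have e : ∀ t, c * a ^ (2 * k) * derivSq^[k] φ (a * t) / √(t ^ 2 - ‖x‖ ^ 2) * t =
        (c * a ^ (2 * k)) * (derivSq^[k] φ (a * t) / √((a * t) ^ 2 - (a * ‖x‖) ^ 2) * (a * t)) := by
      intro t
      rw [mul_pow, mul_pow, ← mul_sub, Real.sqrt_mul (by positivity), Real.sqrt_sq ha.le]
      field_simp
    simp only [e]
    rw [integral_const_mul, integral_comp_mul_left_Ioi
      (fun t => derivSq^[k] φ t / √(t ^ 2 - (a * ‖x‖) ^ 2) * t) _ ha, smul_eq_mul]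
    have hp : a ^ (2 * k) * a⁻¹ = a ^ (2 * k - 1) := by
      rw [← pow_sub_one_mul (show 2 * k ≠ 0 by omega) a, mul_assoc, mul_inv_cancel₀ ha.ne', mul_one]
    rw [← hp]
    ring
  · rw [if_pos ⟨k, rfl⟩, if_pos ⟨k, rfl⟩, show (2 * k + 1 - 1) / 2 = k by omega,
      Nat.add_sub_cancel]
    ring

end RadonSharp

lemma memLp_two_comp_smul {d : ℕ} {f : Euc d → ℝ} (hf : MemLp f 2 volume) {a : ℝ} (ha : a ≠ 0) :
    MemLp (fun x => f (a • x)) 2 volume := by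
  have hm : AEStronglyMeasurable (fun x => f (a • x)) volume := by
    refine hf.1.comp_quasiMeasurePreserving ⟨measurable_const_smul a, ?_⟩
    rw [Measure.map_addHaar_smul volume ha]
    exact Measure.smul_absolutelyContinuous
  rw [memLp_two_iff_integrable_sq hm]
  exact hf.integrable_sq.comp_smul ha

/-- Frames have an almost everywhere bounded and bounded below symbol. -/
lemma IsConvFrame.exists_hasFrameSymbol {V : Type*} [NormedAddCommGroup V] [InnerProductSpace ℝ V]
    [FiniteDimensional ℝ V] [MeasurableSpace V] [BorelSpace V] {u : ℕ → V → ℝ}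
    (h : IsConvFrame u) : ∃ A B, 0 < B ∧ HasFrameSymbol u A B := by
  obtain ⟨A, B, hA, hB, hf⟩ := h.bounds
  have hi : ∀ i, Integrable (u i) := fun i => memLp_one_iff_integrable.1 (h.memL1 i)
  exact ⟨A, B, hB, hi, h.memL2, hA, (frame_bounds_iff hi _ _).1 hf⟩

lemma HasFrameSymbol.isConvFrame {V : Type*} [NormedAddCommGroup V] [InnerProductSpace ℝ V]
    [FiniteDimensional ℝ V] [MeasurableSpace V] [BorelSpace V] {u : ℕ → V → ℝ} {A B : ℝ}
    (hB : 0 < B) (h : HasFrameSymbol u A B) : IsConvFrame u :=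
  ⟨fun i => memLp_one_iff_integrable.2 (h.integrable i), h.memL2, A, B, h.pos, hB,
    (frame_bounds_iff h.integrable _ _).2 h.bounds⟩

/-- The frame bounds of `(v_j)` on the line pass to `(R^♯ v_j)` on `ℝ^d`. -/
lemma HasFrameSymbol.radonSharp {d : ℕ} (hd : 1 ≤ d) {v : ℕ → ℝ → ℝ} {A B : ℝ}
    (h : HasFrameSymbol v A B) (hv : ∀ j, ContDiff ℝ (d / 2 : ℕ) (v j))
    (heven : ∀ j t, v j (-t) = v j t) (hdecay : ∀ j, SufficientDecay (d / 2) (v j)) :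
    HasFrameSymbol (fun j => radonSharp d (v j)) A B := by
  refine ⟨fun j => integrable_radonSharp hd (hv j) (heven j) (hdecay j),
    fun j => memLp_two_radonSharp hd (hv j) (heven j) (hdecay j), h.pos, ?_⟩
  filter_upwards [ae_norm_of_ae hd h.bounds] with ξ hξ
  have e : frameSymbol (fun j => PAT.radonSharp d (v j)) ξ = frameSymbol v ‖ξ‖ := by
    simp only [frameSymbol, fourier_radonSharp hd (hv _) (heven _) (hdecay _)]
  rwa [e]

/-- The operator `R^♯` preserves multiscale decompositions; the generator is `R^♯ φ`. -/
lemma isMultiscale_radonSharp {d : ℕ} (hd : 1 ≤ d) {v : ℕ → ℝ → ℝ} (h : IsMultiscale v)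
    (hv : ∀ j, ContDiff ℝ (d / 2 : ℕ) (v j))
    (heven : ∀ j t, v j (-t) = v j t) (hdecay : ∀ j, SufficientDecay (d / 2) (v j)) :
    IsMultiscale (fun j => radonSharp d (v j)) := by
  obtain ⟨hf, φ, -, -, hφ⟩ := h
  obtain ⟨A, B, hB, hA⟩ := hf.exists_hasFrameSymbol
  have hU := hA.radonSharp hd hv heven hdecay
  have hscale : ∀ j, 1 ≤ j → ∀ x : Euc d, radonSharp d (v j) x =
      2 ^ (j * d) * radonSharp d φ ((2 : ℝ) ^ j • x) := by
    intro j hj x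
    have e : v j = fun t => 2 ^ j * φ (2 ^ j * t) := by
      ext t; rw [hφ j hj t]; simp
    obtain ⟨n, rfl⟩ : ∃ n, d = n + 1 := ⟨d - 1, by omega⟩
    rw [e, radonSharp_scale hd φ (by positivity), Nat.add_sub_cancel, ← pow_mul, ← pow_add]
    congr 2; ring
  -- `φ` is a dilate of `v 1`, so the integrability of `R^♯ φ` is that of `R^♯ (v 1)`
  have hψ : radonSharp d φ = fun x => (2 ^ d)⁻¹ * radonSharp d (v 1) ((2 : ℝ)⁻¹ • x) := by
    ext x
    rw [hscale 1 le_rfl, smul_smul]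
    simp
  refine ⟨hU.isConvFrame hB, radonSharp d φ, ?_, ?_, ?_⟩
  · rw [memLp_one_iff_integrable, hψ]
    exact ((hU.integrable 1).comp_smul (by norm_num)).const_mul _
  · rw [hψ]
    exact (memLp_two_comp_smul (hU.memL2 1) (by norm_num)).const_mul _
  · intro j hj x
    rw [finrank_euclideanSpace_fin]
    exact hscale j hj x

/-! ### Solutions of the wave equation as Fourier integrals -/

/-- Continuous functions all of whose polynomial moments are absolutely integrable: the
frequency profiles of smooth solutions of the wave equation. -/
structure HasMoments {d : ℕ} (K : Euc d → ℂ) : Prop where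
  cont : Continuous K
  moments : ∀ n : ℕ, Integrable (fun η => ‖η‖ ^ n * ‖K η‖)

namespace HasMoments

variable {d : ℕ} {K : Euc d → ℂ}

lemma integrable (h : HasMoments K) : Integrable K := by
  have := h.moments 0
  simp only [pow_zero, one_mul] at this
  exact (integrable_norm_iff h.cont.aestronglyMeasurable).1 this

lemma bdd_mul (h : HasMoments K) {a : Euc d → ℂ} (ha : Continuous a) {C : ℝ}
    (hC : ∀ η, ‖a η‖ ≤ C) : HasMoments (fun η => a η * K η) := by
  refine ⟨ha.mul h.cont, fun n => ?_⟩
  refine ((h.moments n).const_mul C).mono' ?_ (ae_of_all _ fun η => ?_)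
  · have := h.cont
    exact Continuous.aestronglyMeasurable (by fun_prop)
  · rw [Real.norm_of_nonneg (by positivity), norm_mul]
    calc ‖η‖ ^ n * (‖a η‖ * ‖K η‖) ≤ ‖η‖ ^ n * (C * ‖K η‖) := by gcongr; exact hC η
      _ = _ := by ring

lemma norm_mul (h : HasMoments K) : HasMoments (fun η => (‖η‖ : ℂ) * K η) := by
  refine ⟨(Complex.continuous_ofReal.comp continuous_norm).mul h.cont, fun n => ?_⟩
  refine (h.moments (n + 1)).congr (ae_of_all _ fun η => ?_)
  simp [pow_succ, mul_assoc]

end HasMoments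

lemma SchwartzMap.hasMoments {d : ℕ} (φ : 𝓢(Euc d, ℂ)) : HasMoments (φ : Euc d → ℂ) :=
  ⟨φ.continuous, fun n => φ.integrable_pow_mul volume n⟩

/-- The function `cos (2π t ‖η‖) K(η)`: the frequency profile at time `t`. -/
def waveSymbol {d : ℕ} (K : Euc d → ℂ) (t : ℝ) (η : Euc d) : ℂ :=
  (Real.cos (2 * Real.pi * t * ‖η‖) : ℂ) * K η

/-- The solution of the wave equation with frequency profile `K`, at rest at time `0`. -/
def waveInt {d : ℕ} (K : Euc d → ℂ) (x : Euc d) (t : ℝ) : ℝ := (𝓕 (waveSymbol K t) x).re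

section Time

variable {d : ℕ} {K : Euc d → ℂ}

lemma HasMoments.waveSymbol (h : HasMoments K) (t : ℝ) : HasMoments (waveSymbol K t) := by
  refine h.bdd_mul (C := 1) (by fun_prop) fun η => ?_
  rw [Complex.norm_real]
  exact Real.abs_cos_le_one _

lemma norm_two_pi_mul_le {c a : ℂ} (hc : ‖c‖ = ‖(2 * Real.pi : ℂ)‖) (η : Euc d) (k : ℂ)
    (ha : ‖a‖ ≤ 1) : ‖c * (a * (‖η‖ * k))‖ ≤ 2 * Real.pi * (‖η‖ ^ 1 * ‖k‖) := by
  have e : ‖(2 * Real.pi : ℂ)‖ = 2 * Real.pi := by simp [abs_of_pos Real.pi_pos]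
  rw [_root_.norm_mul, hc, e, _root_.norm_mul, _root_.norm_mul, Complex.norm_real, norm_norm,
    pow_one]
  exact mul_le_mul_of_nonneg_left (mul_le_of_le_one_left (by positivity) ha) Real.two_pi_pos.le

lemma hasDerivAt_integral_cos (h : HasMoments K) (t : ℝ) :
    HasDerivAt (fun s => ∫ η, (Real.cos (2 * Real.pi * s * ‖η‖) : ℂ) * K η)
      (-(2 * Real.pi) * ∫ η, (Real.sin (2 * Real.pi * t * ‖η‖) : ℂ) * (‖η‖ * K η)) t := by
  have hK := h.cont
  rw [← integral_const_mul]
  refine (hasDerivAt_integral_of_dominated_loc_of_deriv_le (μ := volume) (s := univ)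
    (F := fun (s : ℝ) (η : Euc d) => (Real.cos (2 * Real.pi * s * ‖η‖) : ℂ) * K η)
    (F' := fun (s : ℝ) (η : Euc d) =>
      -(2 * Real.pi) * ((Real.sin (2 * Real.pi * s * ‖η‖) : ℂ) * (‖η‖ * K η)))
    (bound := fun η => 2 * Real.pi * (‖η‖ ^ 1 * ‖K η‖)) univ_mem
    (Eventually.of_forall fun s => ?_) ?_ ?_ ?_ ?_ ?_).2
  · exact (h.waveSymbol s).cont.aestronglyMeasurable
  · exact (h.waveSymbol t).integrable
  · exact Continuous.aestronglyMeasurable (by fun_prop)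
  · refine ae_of_all _ fun η s _ => ?_
    exact norm_two_pi_mul_le (norm_neg _) _ _ (by
      rw [Complex.norm_real]; exact Real.abs_sin_le_one _)
  · exact (h.moments 1).const_mul _
  · refine ae_of_all _ fun η s _ => ?_
    have h1 : HasDerivAt (fun s : ℝ => 2 * Real.pi * s * ‖η‖) (2 * Real.pi * ‖η‖) s := by
      simpa using ((hasDerivAt_id s).const_mul (2 * Real.pi)).mul_const ‖η‖
    refine ((h1.cos.ofReal_comp).mul_const (K η)).congr_deriv ?_
    push_cast; ring

lemma hasDerivAt_integral_sin (h : HasMoments K) (t : ℝ) :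
    HasDerivAt (fun s => ∫ η, (Real.sin (2 * Real.pi * s * ‖η‖) : ℂ) * K η)
      ((2 * Real.pi) * ∫ η, (Real.cos (2 * Real.pi * t * ‖η‖) : ℂ) * (‖η‖ * K η)) t := by
  have hK := h.cont
  have hs : ∀ s : ℝ, HasMoments (fun η => (Real.sin (2 * Real.pi * s * ‖η‖) : ℂ) * K η) := by
    intro s
    refine h.bdd_mul (C := 1) (by fun_prop) fun η => ?_
    rw [Complex.norm_real]
    exact Real.abs_sin_le_one _
  rw [← integral_const_mul]
  refine (hasDerivAt_integral_of_dominated_loc_of_deriv_le (μ := volume) (s := univ)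
    (F := fun (s : ℝ) (η : Euc d) => (Real.sin (2 * Real.pi * s * ‖η‖) : ℂ) * K η)
    (F' := fun (s : ℝ) (η : Euc d) =>
      (2 * Real.pi) * ((Real.cos (2 * Real.pi * s * ‖η‖) : ℂ) * (‖η‖ * K η)))
    (bound := fun η => 2 * Real.pi * (‖η‖ ^ 1 * ‖K η‖)) univ_mem
    (Eventually.of_forall fun s => ?_) ?_ ?_ ?_ ?_ ?_).2
  · exact (hs s).cont.aestronglyMeasurable
  · exact (hs t).integrable
  · exact Continuous.aestronglyMeasurable (by fun_prop)
  · refine ae_of_all _ fun η s _ => ?_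
    exact norm_two_pi_mul_le rfl _ _ (by
      rw [Complex.norm_real]; exact Real.abs_cos_le_one _)
  · exact (h.moments 1).const_mul _
  · refine ae_of_all _ fun η s _ => ?_
    have h1 : HasDerivAt (fun s : ℝ => 2 * Real.pi * s * ‖η‖) (2 * Real.pi * ‖η‖) s := by
      simpa using ((hasDerivAt_id s).const_mul (2 * Real.pi)).mul_const ‖η‖
    refine ((h1.sin.ofReal_comp).mul_const (K η)).congr_deriv ?_
    push_cast; ring

lemma HasMoments.modulate (h : HasMoments K) (x : Euc d) :
    HasMoments (fun η => (Real.fourierChar (-(inner ℝ η x : ℝ)) : ℂ) * K η) :=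
  h.bdd_mul (C := 1) (by fun_prop) fun η => by rw [Circle.norm_coe]

lemma fourier_waveSymbol_eq (K : Euc d → ℂ) (x : Euc d) (t : ℝ) :
    𝓕 (waveSymbol K t) x = ∫ η, (Real.cos (2 * Real.pi * t * ‖η‖) : ℂ) *
      ((Real.fourierChar (-(inner ℝ η x : ℝ)) : ℂ) * K η) := by
  rw [Real.fourier_eq]
  congr 1; ext η
  rw [Circle.smul_def, smul_eq_mul, waveSymbol]; ring

lemma hasDerivAt_waveInt (h : HasMoments K) (x : Euc d) (t : ℝ) :
    HasDerivAt (waveInt K x) (-(2 * Real.pi) * ∫ η, (Real.sin (2 * Real.pi * t * ‖η‖) : ℂ) *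
      (‖η‖ * ((Real.fourierChar (-(inner ℝ η x : ℝ)) : ℂ) * K η))).re t := by
  have h1 := hasDerivAt_integral_cos (h.modulate x) t
  have h2 := Complex.reCLM.hasFDerivAt.comp_hasDerivAt t h1
  refine h2.congr_of_eventuallyEq (Eventually.of_forall fun s => ?_)
  simp only [waveInt, fourier_waveSymbol_eq]
  rfl

lemma iteratedDeriv_two_waveInt (h : HasMoments K) (x : Euc d) (t : ℝ) :
    iteratedDeriv 2 (waveInt K x) t =
      (𝓕 (fun η => -((2 * Real.pi * ‖η‖) ^ 2 : ℝ) * waveSymbol K t η) x).re := by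
  rw [iteratedDeriv_succ, iteratedDeriv_one]
  have e : deriv (waveInt K x) = fun t => (-(2 * Real.pi) *
      ∫ η, (Real.sin (2 * Real.pi * t * ‖η‖) : ℂ) *
      (‖η‖ * ((Real.fourierChar (-(inner ℝ η x : ℝ)) : ℂ) * K η))).re :=
    funext fun t => (hasDerivAt_waveInt h x t).deriv
  rw [e]
  have h1 := (hasDerivAt_integral_sin (h.modulate x).norm_mul t).const_mul (-(2 * Real.pi) : ℂ)
  have h2 := Complex.reCLM.hasFDerivAt.comp_hasDerivAt t h1
  refine (HasDerivAt.deriv h2).trans ?_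
  rw [Complex.reCLM_apply, Real.fourier_eq, ← integral_const_mul, ← integral_const_mul]
  congr 2; ext η
  rw [Circle.smul_def, smul_eq_mul, waveSymbol]
  push_cast; ring

end Time

section Space

variable {d : ℕ} {K : Euc d → ℂ}

lemma HasMoments.contDiff_fourier (h : HasMoments K) : ContDiff ℝ ∞ (𝓕 K) :=
  Real.contDiff_fourier (N := ⊤) fun n _ => h.moments n

lemma laplacian_fourier (h : HasMoments K) (x : Euc d) :
    Δ (𝓕 K) x = 𝓕 (fun η => -((2 * Real.pi * ‖η‖) ^ 2 : ℝ) * K η) x := by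
  rw [InnerProductSpace.laplacian_eq_iteratedFDeriv_stdOrthonormalBasis]
  set b := stdOrthonormalBasis ℝ (Euc d)
  have hm := h.moments
  have hi := VectorFourier.integrable_fourierPowSMulRight (innerSL ℝ) (n := 2) (hm 2)
    h.cont.aestronglyMeasurable
  have hterm : ∀ i, iteratedFDeriv ℝ 2 (𝓕 K) x ![b i, b i] =
      ∫ η, Real.fourierChar (-(inner ℝ η x : ℝ)) •
        (VectorFourier.fourierPowSMulRight (innerSL ℝ) K η 2 ![b i, b i]) := by
    intro i
    rw [Real.iteratedFDeriv_fourier (N := ⊤) (fun n _ => hm n) h.cont.aestronglyMeasurable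
      (by exact le_top), Real.fourier_continuousMultilinearMap_apply hi, Real.fourier_eq]
  simp only [hterm]
  rw [← integral_finsetSum, Real.fourier_eq]
  · congr 1; ext η
    rw [← Finset.smul_sum]
    congr 1
    simp only [VectorFourier.fourierPowSMulRight_apply]
    have hsum : (∑ i, (inner ℝ η (b i) : ℝ) ^ 2) = ‖η‖ ^ 2 := by
      have := b.sum_sq_norm_inner_left η
      simpa using this
    have e : ∀ i, (-(2 * (Real.pi : ℂ) * Complex.I)) ^ 2 •
        (∏ j : Fin 2, (innerSL ℝ η) (![b i, b i] j)) • K η =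
        (((inner ℝ η (b i) : ℝ) ^ 2 : ℝ) : ℂ) * (-(2 * Real.pi) ^ 2 * K η) := by
      intro i
      rw [Fin.prod_univ_two]
      simp only [Matrix.cons_val_zero, Matrix.cons_val_one, innerSL_apply_apply, smul_eq_mul,
        Complex.real_smul]
      have hI := Complex.I_sq
      push_cast
      rw [neg_sq, mul_pow, hI]
      ring
    rw [Finset.sum_congr rfl fun i _ => e i, ← Finset.sum_mul, ← Complex.ofReal_sum, hsum]
    push_cast; ring
  · intro i _
    have h2 : Integrable (fun η => VectorFourier.fourierPowSMulRight (innerSL ℝ) K η 2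
        ![b i, b i]) := by
      exact (ContinuousMultilinearMap.apply ℝ (fun _ : Fin 2 => Euc d) ℂ
        ![b i, b i]).integrable_comp hi
    exact (Real.fourierIntegral_convergent_iff x).2 h2

end Space

section Joint

variable {d : ℕ} {K : Euc d → ℂ}

/-- The inner product of `ℝ^d` as a real bilinear map. -/
def innerBilin (d : ℕ) : Euc d →L[ℝ] Euc d →L[ℝ] ℝ := innerSL ℝ

/-- The pairing of `ℝ^d × ℝ` with itself for which the Fourier integral over the light cone
`{(η, ‖η‖)}` represents solutions of the wave equation. -/
def spaceTimePairing (d : ℕ) : (Euc d × ℝ) →L[ℝ] (Euc d × ℝ) →L[ℝ] ℝ :=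
  (innerBilin d).bilinearComp (ContinuousLinearMap.fst ℝ (Euc d) ℝ)
      (ContinuousLinearMap.fst ℝ (Euc d) ℝ) +
    (ContinuousLinearMap.mul ℝ ℝ).bilinearComp (ContinuousLinearMap.snd ℝ (Euc d) ℝ)
      (ContinuousLinearMap.snd ℝ (Euc d) ℝ)

lemma spaceTimePairing_apply (p q : Euc d × ℝ) :
    (spaceTimePairing d).toLinearMap₁₂ p q = inner ℝ p.1 q.1 + p.2 * q.2 := rfl

/-- Smoothness in space-time, by reading the integral as a Fourier integral of a measure carried
by the light cone. -/
lemma contDiff_halfWave (h : HasMoments K) :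
    ContDiff ℝ ∞ (fun z : Euc d × ℝ => ∫ η,
      (Real.fourierChar (-((inner ℝ η z.1 : ℝ) + ‖η‖ * z.2)) : ℂ) * K η) := by
  have hc : Measurable (fun η : Euc d => (η, ‖η‖)) := by fun_prop
  set μ : Measure (Euc d × ℝ) := Measure.map (fun η => (η, ‖η‖)) volume
  have hK := h.cont
  have h1 : ContDiff ℝ ∞ (VectorFourier.fourierIntegral Real.fourierChar μ
      (spaceTimePairing d).toLinearMap₁₂ (fun p => K p.1)) := by
    refine VectorFourier.contDiff_fourierIntegral (N := ⊤) _ fun n _ => ?_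
    rw [integrable_map_measure (Continuous.aestronglyMeasurable (by fun_prop)) hc.aemeasurable]
    refine (h.moments n).congr (ae_of_all _ fun η => ?_)
    simp [Prod.norm_def]
  convert h1 using 1
  ext z
  rw [VectorFourier.fourierIntegral, integral_map hc.aemeasurable]
  · simp only [spaceTimePairing_apply, Circle.smul_def, smul_eq_mul]
  · refine Continuous.aestronglyMeasurable ?_
    simp only [spaceTimePairing_apply, Circle.smul_def]
    fun_prop

lemma fourierChar_add_div_two (a b : ℝ) :
    ((Real.fourierChar (-(a + b)) : ℂ) + (Real.fourierChar (-(a + -b)) : ℂ)) / 2 =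
      (Real.cos (2 * Real.pi * b) : ℂ) * (Real.fourierChar (-a) : ℂ) := by
  simp only [Real.fourierChar_apply]
  rw [Complex.ofReal_cos, Complex.cos, div_mul_eq_mul_div, add_mul, ← Complex.exp_add,
    ← Complex.exp_add, add_comm]
  congr 3 <;> push_cast <;> ring

lemma waveInt_eq_halfWave (h : HasMoments K) (x : Euc d) (t : ℝ) :
    waveInt K x t = (((∫ η, (Real.fourierChar (-((inner ℝ η x : ℝ) + ‖η‖ * t)) : ℂ) * K η) +
      ∫ η, (Real.fourierChar (-((inner ℝ η x : ℝ) + ‖η‖ * -t)) : ℂ) * K η) / 2).re := by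
  have hint : ∀ s : ℝ, Integrable fun η => (Real.fourierChar
      (-((inner ℝ η x : ℝ) + ‖η‖ * s)) : ℂ) * K η := fun s =>
    (h.bdd_mul (C := 1) (a := fun η => (Real.fourierChar
      (-((inner ℝ η x : ℝ) + ‖η‖ * s)) : ℂ)) (by fun_prop)
      fun η => by rw [Circle.norm_coe]).integrable
  rw [waveInt, ← integral_add (hint _) (hint _), ← integral_div, fourier_waveSymbol_eq]
  congr 2; ext η
  rw [mul_neg, ← add_mul, mul_div_right_comm, fourierChar_add_div_two,
    show 2 * Real.pi * (‖η‖ * t) = 2 * Real.pi * t * ‖η‖ by ring]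
  ring

lemma contDiff_waveInt (h : HasMoments K) :
    ContDiff ℝ ∞ (fun z : Euc d × ℝ => waveInt K z.1 z.2) := by
  have h1 := contDiff_halfWave h
  have hn : ContDiff ℝ ∞ (fun z : Euc d × ℝ => (z.1, -z.2)) := contDiff_fst.prodMk contDiff_snd.neg
  have h2 := h1.comp hn
  have h3 := Complex.reCLM.contDiff.comp ((h1.add h2).div_const 2)
  have e : (fun z : Euc d × ℝ => waveInt K z.1 z.2) = _ :=
    funext fun z => waveInt_eq_halfWave h z.1 z.2
  rw [e]
  exact h3

/-- The Fourier integral solves the initial value problem of the wave equation. -/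
lemma isWaveSolution_waveInt (h : HasMoments K) {f : Euc d → ℝ} (hf : ∀ x, f x = (𝓕 K x).re) :
    IsWaveSolution f (waveInt K) := by
  refine ⟨(contDiff_waveInt h).contDiffOn, fun x t _ => ?_, fun x => ?_, fun x => ?_⟩
  · have h1 : (fun y => waveInt K y t) = Complex.reCLM ∘ 𝓕 (waveSymbol K t) := rfl
    have h2 := ((h.waveSymbol t).contDiff_fourier.contDiffAt (x := x)).of_le
      (show ((2 : ℕ∞) : WithTop ℕ∞) ≤ ((⊤ : ℕ∞) : WithTop ℕ∞) from WithTop.coe_le_coe.2 le_top)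
    rw [h1, h2.laplacian_CLM_comp_left, Function.comp_apply, laplacian_fourier (h.waveSymbol t)]
    exact sub_eq_zero.2 (iteratedDeriv_two_waveInt h x t)
  · have e : waveSymbol K 0 = K := by ext η; simp [waveSymbol]
    rw [hf x, waveInt, e]
  · have h1 := (hasDerivAt_waveInt h x 0).hasDerivWithinAt (s := Ici 0)
    have h2 := h1.derivWithin (uniqueDiffOn_Ici 0 0 self_mem_Ici)
    refine Eq.trans h2 ?_
    simp

end Joint

/-! ### Integrals of compact spatial support, and the cutoff to a light cone -/

section Slices

variable {d : ℕ} {H : Euc d × ℝ → ℝ}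

lemma hasFDerivAt_slice_space {x : Euc d} {t : ℝ} (h : DifferentiableAt ℝ H (x, t)) :
    HasFDerivAt (fun y => H (y, t))
      ((fderiv ℝ H (x, t)).comp (ContinuousLinearMap.inl ℝ (Euc d) ℝ)) x :=
  HasFDerivAt.comp (g := H) x h.hasFDerivAt (hasFDerivAt_prodMk_left x t)

lemma hasDerivAt_slice_time {x : Euc d} {t : ℝ} (h : DifferentiableAt ℝ H (x, t)) :
    HasDerivAt (fun s => H (x, s)) (fderiv ℝ H (x, t) (0, 1)) t := by
  have := HasFDerivAt.comp (g := H) t h.hasFDerivAt (hasFDerivAt_prodMk_right x t)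
  exact this.hasDerivAt.congr_deriv (by simp)

variable {T : ℝ} {K : Set (Euc d)}

lemma fderiv_eq_zero_of_notMem (hK : IsCompact K)
    (hH : ∀ x t, t ∈ Ioo 0 T → x ∉ K → H (x, t) = 0) {x : Euc d} {t : ℝ} (ht : t ∈ Ioo 0 T)
    (hx : x ∉ K) : fderiv ℝ H (x, t) = 0 := by
  have h : H =ᶠ[𝓝 (x, t)] fun _ => 0 := by
    filter_upwards [(hK.isClosed.isOpen_compl.prod isOpen_Ioo).mem_nhds ⟨hx, ht⟩] with z hz
    exact hH z.1 z.2 hz.2 hz.1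
  rw [h.fderiv_eq]; simp

lemma integrable_slice (hK : IsCompact K) {g : Euc d → ℝ} (hg : Continuous g)
    (h0 : ∀ x, x ∉ K → g x = 0) : Integrable g :=
  hg.integrable_of_hasCompactSupport (HasCompactSupport.intro hK h0)

lemma continuous_slice_fderiv (hC : ContDiffOn ℝ 1 H (univ ×ˢ Ioo 0 T)) {t : ℝ}
    (ht : t ∈ Ioo 0 T) (w : Euc d × ℝ) : Continuous (fun x => fderiv ℝ H (x, t) w) := by
  have h1 := hC.continuousOn_fderiv_of_isOpen (isOpen_univ.prod isOpen_Ioo) le_rfl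
  have h2 : Continuous (fun x : Euc d => fderiv ℝ H (x, t)) :=
    h1.comp_continuous (f := fun x : Euc d => (x, t)) (by fun_prop) fun x => ⟨mem_univ _, ht⟩
  exact h2.clm_apply continuous_const

/-- Spatial derivatives of functions with compact spatial support have integral zero. -/
lemma integral_fderiv_space_eq_zero (hK : IsCompact K)
    (hC : ContDiffOn ℝ 1 H (univ ×ˢ Ioo 0 T))
    (hH : ∀ x t, t ∈ Ioo 0 T → x ∉ K → H (x, t) = 0) {t : ℝ} (ht : t ∈ Ioo 0 T) (w : Euc d) :
    ∫ x, fderiv ℝ H (x, t) (w, 0) = 0 := by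
  have hd : ∀ x, DifferentiableAt ℝ H (x, t) := fun x =>
    ((hC.contDiffAt ((isOpen_univ.prod isOpen_Ioo).mem_nhds ⟨mem_univ x, ht⟩)).differentiableAt
      one_ne_zero)
  have e : ∀ x, fderiv ℝ (fun y => H (y, t)) x w = fderiv ℝ H (x, t) (w, 0) := fun x => by
    rw [(hasFDerivAt_slice_space (hd x)).fderiv]; simp
  have hdiff : Differentiable ℝ (fun y => H (y, t)) := fun x =>
    (hasFDerivAt_slice_space (hd x)).differentiableAt
  have hi : Integrable (fun x => fderiv ℝ (fun y => H (y, t)) x w) := by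
    simp only [e]
    refine integrable_slice hK (continuous_slice_fderiv hC ht _) fun x hx => ?_
    rw [fderiv_eq_zero_of_notMem hK hH ht hx]; simp
  have := integral_mul_fderiv_eq_neg_fderiv_mul_of_integrable (μ := volume)
    (f := fun _ : Euc d => (1 : ℝ)) (g := fun y => H (y, t)) (v := w) (by simp) (by simpa using hi)
    (by simpa using integrable_slice hK hdiff.continuous fun x hx => hH x t ht hx)
    (fun x _ => by fun_prop) (fun x _ => hdiff x)
  simpa [e] using this

/-- Differentiation in time under an integral of compact spatial support. -/
lemma hasDerivAt_integral_slice (hK : IsCompact K) (hC : ContDiffOn ℝ 1 H (univ ×ˢ Ioo 0 T))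
    (hH : ∀ x t, t ∈ Ioo 0 T → x ∉ K → H (x, t) = 0) {t : ℝ} (ht : t ∈ Ioo 0 T) :
    HasDerivAt (fun s => ∫ x, H (x, s)) (∫ x, fderiv ℝ H (x, t) (0, 1)) t := by
  obtain ⟨δ, hδ, hball⟩ := Metric.nhds_basis_closedBall.mem_iff.1 (Ioo_mem_nhds ht.1 ht.2)
  have hd : ∀ x s, s ∈ Ioo 0 T → DifferentiableAt ℝ H (x, s) := fun x s hs =>
    ((hC.contDiffAt ((isOpen_univ.prod isOpen_Ioo).mem_nhds ⟨mem_univ x, hs⟩)).differentiableAt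
      one_ne_zero)
  have hc1 := hC.continuousOn_fderiv_of_isOpen (isOpen_univ.prod isOpen_Ioo) le_rfl
  obtain ⟨C, hCb⟩ := (hK.prod (isCompact_closedBall t δ)).exists_bound_of_continuousOn
    (f := fun z => fderiv ℝ H z (0, 1))
    ((hc1.mono (prod_mono (subset_univ _) hball)).clm_apply continuousOn_const)
  have hslice : ∀ s ∈ Ioo 0 T, Continuous fun x => H (x, s) := fun s hs =>
    hC.continuousOn.comp_continuous (f := fun x : Euc d => (x, s)) (by fun_prop)
      fun x => ⟨mem_univ _, hs⟩
  refine (hasDerivAt_integral_of_dominated_loc_of_deriv_le (μ := volume)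
    (s := Metric.closedBall t δ) (F := fun s x => H (x, s))
    (F' := fun s x => fderiv ℝ H (x, s) (0, 1)) (bound := K.indicator fun _ => C)
    (Metric.closedBall_mem_nhds t hδ) ?_ ?_ ?_ ?_ ?_ ?_).2
  · filter_upwards [Ioo_mem_nhds ht.1 ht.2] with s hs
    exact (hslice s hs).aestronglyMeasurable
  · exact integrable_slice hK (hslice t ht) fun x hx => hH x t ht hx
  · exact (continuous_slice_fderiv hC ht _).aestronglyMeasurable
  · refine ae_of_all _ fun x s hs => ?_
    by_cases hx : x ∈ K
    · rw [indicator_of_mem hx]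
      exact hCb (x, s) ⟨hx, hs⟩
    · rw [indicator_of_notMem hx, fderiv_eq_zero_of_notMem hK hH (hball hs) hx]; simp
  · exact (integrable_indicator_iff hK.measurableSet).2 (integrableOn_const hK.measure_lt_top.ne)
  · exact ae_of_all _ fun x s hs => hasDerivAt_slice_time (hd x s (hball hs))

end Slices

section Cutoff

variable {d : ℕ}

/-- A smooth function, positive inside the backward light cone with vertex `(x₀, T)` and zero
outside the double cone. -/
def coneCutoff (x₀ : Euc d) (T : ℝ) (z : Euc d × ℝ) : ℝ :=
  expNegInvGlue ((T - z.2) ^ 2 - ‖z.1 - x₀‖ ^ 2)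

lemma contDiff_coneCutoff (x₀ : Euc d) (T : ℝ) : ContDiff ℝ ∞ (coneCutoff x₀ T) :=
  expNegInvGlue.contDiff.comp (((contDiff_const.sub contDiff_snd).pow 2).sub
    ((contDiff_fst.sub contDiff_const).norm_sq ℝ))

lemma coneCutoff_nonneg (x₀ : Euc d) (T : ℝ) (z : Euc d × ℝ) : 0 ≤ coneCutoff x₀ T z :=
  expNegInvGlue.nonneg _

lemma coneCutoff_eq_zero {x₀ : Euc d} {T : ℝ} {x : Euc d} {t : ℝ} (ht : t ∈ Icc 0 T)
    (hx : x ∉ Metric.closedBall x₀ T) : coneCutoff x₀ T (x, t) = 0 := by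
  refine expNegInvGlue.zero_of_nonpos ?_
  rw [Metric.mem_closedBall, dist_eq_norm, not_le] at hx
  have h1 : T - t ≤ ‖x - x₀‖ := by linarith [ht.1]
  have h2 : 0 ≤ T - t := by linarith [ht.2]
  simp only
  nlinarith

lemma deriv_expNegInvGlue_nonneg (q : ℝ) : 0 ≤ deriv expNegInvGlue q :=
  expNegInvGlue.monotone.deriv_nonneg

lemma deriv_expNegInvGlue_of_nonpos {q : ℝ} (hq : q ≤ 0) : deriv expNegInvGlue q = 0 :=
  IsLocalMin.deriv_eq_zero (Eventually.of_forall fun s => by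
    rw [expNegInvGlue.zero_of_nonpos hq]; exact expNegInvGlue.nonneg s)

lemma fderiv_coneCutoff (x₀ : Euc d) (T : ℝ) (z w : Euc d × ℝ) :
    fderiv ℝ (coneCutoff x₀ T) z w =
      deriv expNegInvGlue ((T - z.2) ^ 2 - ‖z.1 - x₀‖ ^ 2) *
        (-(2 * (T - z.2) * w.2) - 2 * inner ℝ (z.1 - x₀) w.1) := by
  have h1 : HasFDerivAt (fun z : Euc d × ℝ => (T - z.2)) (-(ContinuousLinearMap.snd ℝ (Euc d) ℝ))
      z := hasFDerivAt_snd.const_sub T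
  have h2 : HasFDerivAt (fun z : Euc d × ℝ => z.1 - x₀) (ContinuousLinearMap.fst ℝ (Euc d) ℝ)
      z := hasFDerivAt_fst.sub_const x₀
  have h3 := (h1.pow 2).sub h2.norm_sq
  have h4 : HasDerivAt expNegInvGlue (deriv expNegInvGlue ((T - z.2) ^ 2 - ‖z.1 - x₀‖ ^ 2))
      ((T - z.2) ^ 2 - ‖z.1 - x₀‖ ^ 2) :=
    ((expNegInvGlue.contDiff (n := 1)).differentiable one_ne_zero _).hasDerivAt
  have h5 := HasDerivAt.comp_hasFDerivAt z h4 h3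
  have h6 : HasFDerivAt (coneCutoff x₀ T) _ z := h5
  rw [h6.fderiv]
  simp [inner_sub_left]

/-- The gradient of the cutoff lies in the dual light cone. -/
lemma coneCutoff_flux_nonpos (x₀ : Euc d) {T : ℝ} {z : Euc d × ℝ} (hz : z.2 ≤ T) (a : ℝ)
    (b : Fin d → ℝ) :
    fderiv ℝ (coneCutoff x₀ T) z (0, 1) * (a ^ 2 + ∑ i, b i ^ 2) -
      2 * ∑ i, fderiv ℝ (coneCutoff x₀ T) z (EuclideanSpace.basisFun (Fin d) ℝ i, 0) *
        (a * b i) ≤ 0 := by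
  simp only [fderiv_coneCutoff]
  set ρ := deriv expNegInvGlue ((T - z.2) ^ 2 - ‖z.1 - x₀‖ ^ 2) with hρ
  have h0 : 0 ≤ ρ := deriv_expNegInvGlue_nonneg _
  set y : Euc d := z.1 - x₀ with hy
  have e : ∀ i, inner ℝ y (EuclideanSpace.basisFun (Fin d) ℝ i) = y i := fun i => by
    simp [EuclideanSpace.basisFun_apply, EuclideanSpace.inner_single_right]
  have key : ρ * (-(2 * (T - z.2)) * (a ^ 2 + ∑ i, b i ^ 2) + 4 * a * ∑ i, y i * b i) ≤ 0 := by
    rcases le_or_gt ((T - z.2) ^ 2 - ‖y‖ ^ 2) 0 with hq | hq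
    · rw [hρ, deriv_expNegInvGlue_of_nonpos hq, zero_mul]
    · refine mul_nonpos_of_nonneg_of_nonpos h0 ?_
      have hcs : (∑ i, y i * b i) ^ 2 ≤ (∑ i, y i ^ 2) * ∑ i, b i ^ 2 :=
        Finset.sum_mul_sq_le_sq_mul_sq _ _ _
      rw [← EuclideanSpace.real_norm_sq_eq] at hcs
      set B := ∑ i, b i ^ 2
      have hB : 0 ≤ B := Finset.sum_nonneg fun i _ => sq_nonneg _
      set s := ∑ i, y i * b i
      have hT : 0 ≤ T - z.2 := by linarith
      have h1 : s ^ 2 ≤ (T - z.2) ^ 2 * B := hcs.trans (by nlinarith)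
      have h2 : |s| ≤ (T - z.2) * √B := by
        rw [← Real.sqrt_sq hT, ← Real.sqrt_mul (sq_nonneg _)]
        exact Real.abs_le_sqrt h1
      have h3 : a * s ≤ |a| * ((T - z.2) * √B) :=
        (le_abs_self _).trans (by rw [abs_mul]; gcongr)
      have h4 : 2 * (|a| * √B) ≤ a ^ 2 + B := by
        have := two_mul_le_add_sq |a| √B
        rw [sq_abs, Real.sq_sqrt hB] at this
        linarith
      nlinarith
  calc _ = ρ * (-(2 * (T - z.2)) * (a ^ 2 + ∑ i, b i ^ 2) + 4 * a * ∑ i, y i * b i) := by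
        simp only [e, inner_zero_right, mul_zero, sub_zero, mul_one, neg_zero, zero_sub]
        have : ∑ i, ρ * -(2 * y i) * (a * b i) = -2 * ρ * a * ∑ i, y i * b i := by
          rw [Finset.mul_sum]; exact Finset.sum_congr rfl fun i _ => by ring
        rw [this]; ring
    _ ≤ 0 := key

end Cutoff

/-! ### Uniqueness for the wave equation -/

section Energy

variable {d : ℕ}

/-- The derivative of `F : ℝ^d × ℝ → ℝ` in the `i`-th spatial coordinate direction. -/
def spaceDeriv (F : Euc d × ℝ → ℝ) (i : Fin d) (z : Euc d × ℝ) : ℝ :=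
  fderiv ℝ F z (EuclideanSpace.basisFun (Fin d) ℝ i, 0)

/-- The derivative of `F : ℝ^d × ℝ → ℝ` in time. -/
def timeDeriv (F : Euc d × ℝ → ℝ) (z : Euc d × ℝ) : ℝ := fderiv ℝ F z (0, 1)

lemma _root_.ContDiffAt.fderiv_apply_const {F : Euc d × ℝ → ℝ} {z : Euc d × ℝ}
    (h : ContDiffAt ℝ ∞ F z) (w : Euc d × ℝ) : ContDiffAt ℝ ∞ (fun z => fderiv ℝ F z w) z :=
  (h.fderiv_right (m := ∞) (by simp)).clm_apply contDiffAt_const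

lemma fderiv_fderiv_apply {F : Euc d × ℝ → ℝ} {z : Euc d × ℝ} (h : ContDiffAt ℝ ∞ F z)
    (w w' : Euc d × ℝ) :
    fderiv ℝ (fun z => fderiv ℝ F z w) z w' = fderiv ℝ (fderiv ℝ F) z w' w := by
  have h1 : DifferentiableAt ℝ (fderiv ℝ F) z :=
    (h.fderiv_right (m := ∞) (by simp)).differentiableAt (by simp)
  have := h1.hasFDerivAt.clm_apply (hasFDerivAt_const w z)
  rw [this.fderiv]; simp

lemma fderiv_fderiv_comm {F : Euc d × ℝ → ℝ} {z : Euc d × ℝ} (h : ContDiffAt ℝ ∞ F z)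
    (w w' : Euc d × ℝ) :
    fderiv ℝ (fun z => fderiv ℝ F z w) z w' = fderiv ℝ (fun z => fderiv ℝ F z w') z w := by
  rw [fderiv_fderiv_apply h, fderiv_fderiv_apply h]
  exact (h.isSymmSndFDerivAt (by simpa using WithTop.coe_le_coe.2 (le_top : (2 : ℕ∞) ≤ ⊤))) w' w

/-- The wave equation as a first-order identity between space-time derivatives. -/
lemma fderiv_timeDeriv_eq {Q : Euc d → ℝ → ℝ} {f : Euc d → ℝ} (h : IsWaveSolution f Q)
    {x : Euc d} {t : ℝ} (ht : 0 < t) :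
    fderiv ℝ (timeDeriv fun z : Euc d × ℝ => Q z.1 z.2) (x, t) (0, 1) =
      ∑ i, fderiv ℝ (spaceDeriv (fun z : Euc d × ℝ => Q z.1 z.2) i) (x, t)
        (EuclideanSpace.basisFun (Fin d) ℝ i, 0) := by
  set F : Euc d × ℝ → ℝ := fun z => Q z.1 z.2 with hF
  have hC : ∀ y s, 0 < s → ContDiffAt ℝ ∞ F (y, s) := fun y s hs =>
    h.smooth.contDiffAt (prod_mem_nhds univ_mem (Ici_mem_nhds hs))
  have hd : ∀ {G : Euc d × ℝ → ℝ} {z}, ContDiffAt ℝ ∞ G z → DifferentiableAt ℝ G z := fun hG =>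
    hG.differentiableAt (by simp)
  have h1 : iteratedDeriv 2 (fun s => Q x s) t = fderiv ℝ (timeDeriv F) (x, t) (0, 1) := by
    rw [iteratedDeriv_succ, iteratedDeriv_one]
    have e : deriv (fun s => Q x s) =ᶠ[𝓝 t] fun s => timeDeriv F (x, s) := by
      filter_upwards [Ioi_mem_nhds ht] with s hs
      exact (hasDerivAt_slice_time (H := F) (hd (hC x s hs))).deriv
    rw [e.deriv_eq]
    exact (hasDerivAt_slice_time (hd ((hC x t ht).fderiv_apply_const _))).deriv
  have h2 : Δ (fun y => Q y t) x = ∑ i, fderiv ℝ (spaceDeriv F i) (x, t)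
      (EuclideanSpace.basisFun (Fin d) ℝ i, 0) := by
    rw [InnerProductSpace.laplacian_eq_iteratedFDeriv_orthonormalBasis _
      (EuclideanSpace.basisFun (Fin d) ℝ)]
    refine Finset.sum_congr rfl fun i _ => ?_
    rw [iteratedFDeriv_two_apply]
    simp only [Matrix.cons_val_zero, Matrix.cons_val_one]
    set w := EuclideanSpace.basisFun (Fin d) ℝ i
    have hs : ContDiff ℝ ∞ (fun y => Q y t) := contDiff_iff_contDiffAt.2 fun y =>
      (hC y t ht).comp y (contDiffAt_id.prodMk contDiffAt_const)
    have h3 : DifferentiableAt ℝ (fderiv ℝ fun y => Q y t) x :=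
      (hs.fderiv_right (m := ∞) (by simp)).differentiable (by simp) x
    have h4 := (h3.hasFDerivAt.clm_apply (hasFDerivAt_const w x)).fderiv
    have e : (fun y => fderiv ℝ (fun y => Q y t) y w) = fun y => spaceDeriv F i (y, t) := by
      ext y
      rw [(hasFDerivAt_slice_space (H := F) (hd (hC y t ht))).fderiv]
      simp [spaceDeriv, w]
    rw [e, (hasFDerivAt_slice_space (H := spaceDeriv F i) (hd ((hC x t ht).fderiv_apply_const _))).fderiv] at h4
    have h5 := DFunLike.congr_fun h4 w
    simpa using h5.symm
  have := h.wave x t ht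
  rw [h1, h2] at this
  linarith

/-- The energy density `p_t² + |∇p|²`, extended continuously to time `0` by one-sided derivatives:
the values at negative times are arbitrary. -/
def energyDensity (F : Euc d × ℝ → ℝ) (z : Euc d × ℝ) : ℝ :=
  fderivWithin ℝ F (univ ×ˢ Ici 0) z (0, 1) ^ 2 +
    ∑ i, fderivWithin ℝ F (univ ×ˢ Ici 0) z (EuclideanSpace.basisFun (Fin d) ℝ i, 0) ^ 2

lemma energyDensity_eq (F : Euc d × ℝ → ℝ) {z : Euc d × ℝ} (hz : 0 < z.2) :
    energyDensity F z = timeDeriv F z ^ 2 + ∑ i, spaceDeriv F i z ^ 2 := by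
  rw [energyDensity, fderivWithin_of_mem_nhds (prod_mem_nhds univ_mem (Ici_mem_nhds hz))]
  rfl

lemma energyDensity_nonneg (F : Euc d × ℝ → ℝ) (z : Euc d × ℝ) : 0 ≤ energyDensity F z :=
  add_nonneg (sq_nonneg _) (Finset.sum_nonneg fun _ _ => sq_nonneg _)

lemma uniqueDiffOn_halfSpace (d : ℕ) : UniqueDiffOn ℝ ((univ : Set (Euc d)) ×ˢ Ici (0 : ℝ)) :=
  uniqueDiffOn_univ.prod (uniqueDiffOn_Ici 0)

lemma continuousOn_energyDensity {F : Euc d × ℝ → ℝ}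
    (h : ContDiffOn ℝ ∞ F (univ ×ˢ Ici (0 : ℝ))) :
    ContinuousOn (energyDensity F) (univ ×ˢ Ici (0 : ℝ)) := by
  have h1 : ContinuousOn (fderivWithin ℝ F (univ ×ˢ Ici (0 : ℝ))) (univ ×ˢ Ici (0 : ℝ)) :=
    h.continuousOn_fderivWithin (uniqueDiffOn_halfSpace d) (by simp)
  have h2 : ∀ w : Euc d × ℝ, ContinuousOn (fun z => fderivWithin ℝ F (univ ×ˢ Ici (0 : ℝ)) z w)
      (univ ×ˢ Ici (0 : ℝ)) := fun w => h1.clm_apply continuousOn_const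
  exact ((h2 (0, 1)).pow 2).add (continuousOn_finsetSum _ fun i _ =>
    (h2 (EuclideanSpace.basisFun (Fin d) ℝ i, 0)).pow 2)

/-- The density vanishes initially: the time derivative by the initial velocity, the spatial
derivatives because the initial pressure is identically zero. -/
lemma energyDensity_zero {Q : Euc d → ℝ → ℝ} (h : IsWaveSolution (fun _ => 0) Q) (x : Euc d) :
    energyDensity (fun z => Q z.1 z.2) (x, 0) = 0 := by
  set F : Euc d × ℝ → ℝ := fun z => Q z.1 z.2 with hF
  have hz : (x, (0 : ℝ)) ∈ (univ : Set (Euc d)) ×ˢ Ici (0 : ℝ) := ⟨mem_univ _, self_mem_Ici⟩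
  have hd := ((h.smooth.differentiableOn (by simp)) _ hz).hasFDerivWithinAt
  have h1 : fderivWithin ℝ F (univ ×ˢ Ici 0) (x, 0) (0, 1) = 0 := by
    have hc := (hasFDerivAt_prodMk_right (𝕜 := ℝ) x (0 : ℝ)).hasFDerivWithinAt (s := Ici (0 : ℝ))
    have := HasFDerivWithinAt.comp (g := F) (0 : ℝ) hd hc fun s hs => ⟨mem_univ _, hs⟩
    have h2 := this.hasDerivWithinAt.derivWithin (uniqueDiffOn_Ici 0 0 self_mem_Ici)
    have h3 := h.init_vel x
    refine Eq.trans ?_ (h2.symm.trans h3)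
    simp [hF]
  have h2 : ∀ w : Euc d, fderivWithin ℝ F (univ ×ˢ Ici 0) (x, 0) (w, 0) = 0 := by
    intro w
    have hc := (hasFDerivAt_prodMk_left (𝕜 := ℝ) x (0 : ℝ)).hasFDerivWithinAt (s := univ)
    have := HasFDerivWithinAt.comp (g := F) x hd hc
      (show MapsTo (fun e : Euc d => (e, (0 : ℝ))) univ (univ ×ˢ Ici 0) from
        fun s _ => ⟨mem_univ _, self_mem_Ici⟩)
    have h3 : F ∘ (fun e => (e, (0 : ℝ))) = fun _ => 0 := funext fun y => h.init_pos y
    rw [h3, hasFDerivWithinAt_univ] at this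
    have h4 := DFunLike.congr_fun (this.unique (hasFDerivAt_const 0 x)) w
    simpa using h4
  simp [energyDensity, h1, h2]

/-- The energy in the cutoff to a backward light cone does not increase: by the wave equation
`∂_t (p_t² + |∇p|²) = 2 div (p_t ∇p)`, and integration by parts leaves only the flux of the
cutoff. -/
lemma localEnergy_hasDerivAt {Q : Euc d → ℝ → ℝ} {f : Euc d → ℝ} (h : IsWaveSolution f Q)
    (x₀ : Euc d) {T t : ℝ} (ht : t ∈ Ioo 0 T) :
    ∃ E' ≤ 0, HasDerivAt (fun s => ∫ x, coneCutoff x₀ T (x, s) *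
      energyDensity (fun z => Q z.1 z.2) (x, s)) E' t := by
  set F : Euc d × ℝ → ℝ := fun z => Q z.1 z.2 with hF
  set φ := coneCutoff x₀ T with hφ
  set e : Fin d → Euc d := fun i => EuclideanSpace.basisFun (Fin d) ℝ i with he
  have hK := isCompact_closedBall x₀ T
  have hC : ∀ z : Euc d × ℝ, 0 < z.2 → ContDiffAt ℝ ∞ F z := fun z hz =>
    h.smooth.contDiffAt (prod_mem_nhds univ_mem (Ici_mem_nhds hz))
  have ha : ∀ z : Euc d × ℝ, 0 < z.2 → ContDiffAt ℝ ∞ (timeDeriv F) z := fun z hz =>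
    (hC z hz).fderiv_apply_const _
  have hb : ∀ i, ∀ z : Euc d × ℝ, 0 < z.2 → ContDiffAt ℝ ∞ (spaceDeriv F i) z := fun i z hz =>
    (hC z hz).fderiv_apply_const _
  have hφC : ∀ z, ContDiffAt ℝ ∞ φ z := fun z => (contDiff_coneCutoff x₀ T).contDiffAt
  -- the energy density and the components of the flux, cut off to the cone
  set H : Euc d × ℝ → ℝ := fun z => φ z * (timeDeriv F z ^ 2 + ∑ i, spaceDeriv F i z ^ 2)
    with hH
  set J : Fin d → Euc d × ℝ → ℝ := fun i z => φ z * (timeDeriv F z * spaceDeriv F i z) with hJ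
  have hHC : ContDiffOn ℝ 1 H (univ ×ˢ Ioo 0 T) := fun z hz =>
    (((hφC z).mul (((ha z hz.2.1).pow 2).add (ContDiffAt.sum fun i _ =>
      (hb i z hz.2.1).pow 2))).of_le (by simp)).contDiffWithinAt
  have hJC : ∀ i, ContDiffOn ℝ 1 (J i) (univ ×ˢ Ioo 0 T) := fun i z hz =>
    (((hφC z).mul ((ha z hz.2.1).mul (hb i z hz.2.1))).of_le (by simp)).contDiffWithinAt
  have hφ0 : ∀ x t, t ∈ Ioo 0 T → x ∉ Metric.closedBall x₀ T → φ (x, t) = 0 := fun x t ht hx =>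
    coneCutoff_eq_zero (Ioo_subset_Icc_self ht) hx
  have hH0 : ∀ x t, t ∈ Ioo 0 T → x ∉ Metric.closedBall x₀ T → H (x, t) = 0 := fun x t ht hx => by
    simp [hH, hφ0 x t ht hx]
  have hJ0 : ∀ i, ∀ x t, t ∈ Ioo 0 T → x ∉ Metric.closedBall x₀ T → J i (x, t) = 0 :=
    fun i x t ht hx => by simp [hJ, hφ0 x t ht hx]
  have hE := hasDerivAt_integral_slice hK hHC hH0 ht
  have hHi : Integrable fun x => fderiv ℝ H (x, t) (0, 1) :=
    integrable_slice hK (continuous_slice_fderiv hHC ht _) fun x hx => by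
      rw [fderiv_eq_zero_of_notMem hK hH0 ht hx]; simp
  have hJi : ∀ i, Integrable fun x => fderiv ℝ (J i) (x, t) (e i, 0) := fun i =>
    integrable_slice hK (continuous_slice_fderiv (hJC i) ht _) fun x hx => by
      rw [fderiv_eq_zero_of_notMem hK (hJ0 i) ht hx]; simp
  -- the spatial divergence integrates to zero
  have hsplit : ∫ x, fderiv ℝ H (x, t) (0, 1) =
      ∫ x, (fderiv ℝ H (x, t) (0, 1) - 2 * ∑ i, fderiv ℝ (J i) (x, t) (e i, 0)) := by
    rw [integral_sub hHi ((integrable_finsetSum _ fun i _ => hJi i).const_mul 2),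
      integral_const_mul, integral_finsetSum _ fun i _ => hJi i]
    simp [integral_fderiv_space_eq_zero hK (hJC _) (hJ0 _) ht]
  refine ⟨_, ?_, hE.congr_of_eventuallyEq ?_⟩
  · rw [hsplit]
    refine integral_nonpos fun x => ?_
    have hd : ∀ {G : Euc d × ℝ → ℝ}, ContDiffAt ℝ ∞ G (x, t) →
        HasFDerivAt G (fderiv ℝ G (x, t)) (x, t) := fun hG =>
      (hG.differentiableAt (by simp)).hasFDerivAt
    have da := hd (ha (x, t) ht.1)
    have db := fun i => hd (hb i (x, t) ht.1)
    have dφ := hd (hφC (x, t))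
    have dH : HasFDerivAt H _ (x, t) :=
      dφ.mul ((da.pow 2).add (HasFDerivAt.fun_sum fun i (_ : i ∈ Finset.univ) => (db i).pow 2))
    have dJ : ∀ i, HasFDerivAt (J i) _ (x, t) := fun i => dφ.mul (da.mul (db i))
    have hwave := fderiv_timeDeriv_eq h (x := x) ht.1
    have hsymm : ∀ i, fderiv ℝ (spaceDeriv F i) (x, t) (0, 1) =
        fderiv ℝ (timeDeriv F) (x, t) (e i, 0) := fun i =>
      fderiv_fderiv_comm (hC (x, t) ht.1) _ _
    have hflux := coneCutoff_flux_nonpos x₀ (z := (x, t)) ht.2.le (timeDeriv F (x, t))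
      fun i => spaceDeriv F i (x, t)
    refine le_of_eq_of_le ?_ hflux
    rw [dH.fderiv]
    simp only [(dJ _).fderiv]
    simp only [add_apply, smul_apply, smul_eq_mul,
      sum_apply, hsymm, ← hF, ← hφ] at hwave ⊢
    rw [hwave]
    simp only [Finset.mul_sum, mul_add, Finset.sum_add_distrib, nsmul_eq_mul, Nat.cast_ofNat,
      Nat.add_one_sub_one, pow_one, he]
    have e1 : ∀ (c k : ℝ) (g : Fin d → ℝ), ∑ i, c * (2 * k * g i) = ∑ i, 2 * (c * (k * g i)) :=
      fun c k g => Finset.sum_congr rfl fun i _ => by ring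
    have e2 : ∀ (c : ℝ) (k g : Fin d → ℝ), ∑ i, c * (2 * k i * g i) = ∑ i, 2 * (c * (k i * g i)) :=
      fun c k g => Finset.sum_congr rfl fun i _ => by ring
    have e3 : ∀ (c : ℝ) (k g : Fin d → ℝ), ∑ i, 2 * (c * k i * g i) = ∑ i, 2 * (g i * (c * k i)) :=
      fun c k g => Finset.sum_congr rfl fun i _ => by ring
    rw [e1, e2, e3, ← Finset.mul_sum _ _ (fderiv ℝ φ (x, t) (0, 1))]
    ring
  · filter_upwards [Ioo_mem_nhds ht.1 ht.2] with s hs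
    congr 1; ext x
    rw [energyDensity_eq F (z := (x, s)) hs.1]

/-- A solution with vanishing initial data has no energy. -/
lemma energyDensity_eq_zero {Q : Euc d → ℝ → ℝ} (h : IsWaveSolution (fun _ => 0) Q)
    (x₀ : Euc d) {t : ℝ} (ht : 0 < t) : energyDensity (fun z => Q z.1 z.2) (x₀, t) = 0 := by
  set F : Euc d × ℝ → ℝ := fun z => Q z.1 z.2 with hF
  -- any vertex time beyond `t` makes the cutoff positive at `(x₀, t)`
  set T := t + 1 with hT
  set g : ℝ → Euc d → ℝ := fun s x => coneCutoff x₀ T (x, s) * energyDensity F (x, s) with hg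
  have hg0 : ∀ s x, s ∈ Ico 0 T → x ∉ Metric.closedBall x₀ T → g s x = 0 := fun s x hs hx => by
    simp [hg, coneCutoff_eq_zero (Ico_subset_Icc_self hs) hx]
  have hgc : ContinuousOn (Function.uncurry g) (Ico 0 T ×ˢ univ) := by
    have h1 : ContinuousOn (fun z : Euc d × ℝ => coneCutoff x₀ T z * energyDensity F z)
        (univ ×ˢ Ici 0) :=
      (contDiff_coneCutoff x₀ T).continuous.continuousOn.mul (continuousOn_energyDensity h.smooth)
    exact h1.comp (f := fun p : ℝ × Euc d => (p.2, p.1)) (by fun_prop)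
      fun p hp => ⟨mem_univ _, hp.1.1⟩
  have hcont := continuousOn_integral_of_compact_support (μ := volume)
    (isCompact_closedBall x₀ T) hgc hg0
  have hanti : AntitoneOn (fun s => ∫ x, g s x) (Ico 0 T) := by
    refine antitoneOn_of_deriv_nonpos (convex_Ico 0 T) hcont ?_ ?_ <;> rw [interior_Ico]
    · intro s hs
      obtain ⟨E', -, hE⟩ := localEnergy_hasDerivAt h x₀ hs
      exact hE.differentiableAt.differentiableWithinAt
    · intro s hs
      obtain ⟨E', hE', hE⟩ := localEnergy_hasDerivAt h x₀ hs
      exact hE.deriv.trans_le hE'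
  have htI : t ∈ Ico 0 T := ⟨ht.le, by linarith⟩
  have hle : ∫ x, g t x ≤ 0 := by
    refine (hanti ⟨le_rfl, by linarith⟩ htI ht.le).trans_eq ?_
    simp [hg, hF, energyDensity_zero h]
  have hnn : ∀ x, 0 ≤ g t x := fun x =>
    mul_nonneg (coneCutoff_nonneg _ _ _) (energyDensity_nonneg _ _)
  have hgt : Continuous (g t) :=
    hgc.comp_continuous (f := fun x : Euc d => (t, x)) (by fun_prop) fun x => ⟨htI, mem_univ _⟩
  have hz := (integral_eq_zero_iff_of_nonneg hnn (integrable_slice (isCompact_closedBall x₀ T) hgt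
    fun x hx => hg0 t x htI hx)).1 (le_antisymm hle (integral_nonneg hnn))
  have hz' := congrFun ((hgt.ae_eq_iff_eq volume continuous_const).1 hz) x₀
  rcases mul_eq_zero.1 hz' with h1 | h1
  · exact absurd h1 (expNegInvGlue.pos_of_pos (by simp [hT])).ne'
  · exact h1

lemma IsWaveSolution.differentiableWithinAt_zero {f : Euc d → ℝ} {p : Euc d → ℝ → ℝ}
    (h : IsWaveSolution f p) (x : Euc d) :
    DifferentiableWithinAt ℝ (fun s => p x s) (Ici 0) 0 :=
  ((h.smooth.comp (g := fun z : Euc d × ℝ => p z.1 z.2) (f := fun s : ℝ => (x, s))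
    (t := univ ×ˢ Ici 0) (s := Ici (0 : ℝ)) (contDiff_const.prodMk contDiff_id).contDiffOn
    fun s hs => ⟨mem_univ _, hs⟩).differentiableOn (by simp)) 0 self_mem_Ici

lemma IsWaveSolution.eq_zero {Q : Euc d → ℝ → ℝ} (h : IsWaveSolution (fun _ => 0) Q)
    (x : Euc d) {t : ℝ} (ht : 0 ≤ t) : Q x t = 0 := by
  set F : Euc d × ℝ → ℝ := fun z => Q z.1 z.2 with hF
  have hcont : ContinuousOn (fun s => Q x s) (Icc 0 t) :=
    h.smooth.continuousOn.comp (f := fun s : ℝ => (x, s)) (by fun_prop)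
      fun s hs => ⟨mem_univ _, hs.1⟩
  refine (constant_of_has_deriv_right_zero hcont (fun s hs => ?_) t ⟨ht, le_rfl⟩).trans
    (h.init_pos x)
  rcases hs.1.eq_or_lt with hs0 | hs0
  · have h1 := (h.differentiableWithinAt_zero x).hasDerivWithinAt
    rw [h.init_vel x] at h1
    exact hs0 ▸ h1
  have h1 := energyDensity_eq_zero h x hs0
  rw [energyDensity_eq _ hs0] at h1
  have h2 : timeDeriv F (x, s) = 0 := by
    have h3 : 0 ≤ ∑ i, spaceDeriv F i (x, s) ^ 2 := Finset.sum_nonneg fun _ _ => sq_nonneg _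
    have h4 := sq_nonneg (timeDeriv F (x, s))
    exact pow_eq_zero_iff two_ne_zero |>.1 (le_antisymm (by linarith) h4)
  have := hasDerivAt_slice_time (H := F) ((h.smooth.contDiffAt (x := (x, s))
    (prod_mem_nhds univ_mem (Ici_mem_nhds hs0))).differentiableAt (by simp))
  rw [← h2]
  exact this.hasDerivWithinAt

lemma IsWaveSolution.sub {f g : Euc d → ℝ} {p q : Euc d → ℝ → ℝ} (hp : IsWaveSolution f p)
    (hq : IsWaveSolution g q) :
    IsWaveSolution (fun x => f x - g x) (fun x t => p x t - q x t) := by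
  have hat : ∀ {f p} (_ : IsWaveSolution f p) (x : Euc d) (t : ℝ), 0 < t →
      ContDiffAt ℝ ∞ (fun z : Euc d × ℝ => p z.1 z.2) (x, t) := fun h x t ht =>
    h.smooth.contDiffAt (prod_mem_nhds univ_mem (Ici_mem_nhds ht))
  have hx : ∀ {f p} (_ : IsWaveSolution f p) (x : Euc d) (t : ℝ), 0 < t →
      ContDiffAt ℝ 2 (fun y => p y t) x := fun h x t ht =>
    ((hat h x t ht).comp x (contDiffAt_id.prodMk contDiffAt_const)).of_le
      (by simpa using WithTop.coe_le_coe.2 (le_top : (2 : ℕ∞) ≤ ⊤))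
  have ht : ∀ {f p} (_ : IsWaveSolution f p) (x : Euc d) (t : ℝ), 0 < t →
      ContDiffAt ℝ 2 (fun s => p x s) t := fun h x t ht =>
    ((hat h x t ht).comp t (contDiffAt_const.prodMk contDiffAt_id)).of_le
      (by simpa using WithTop.coe_le_coe.2 (le_top : (2 : ℕ∞) ≤ ⊤))
  refine ⟨hp.smooth.sub hq.smooth, fun x t h => ?_, fun x => ?_, fun x => ?_⟩
  · have h1 := (hx hp x t h).laplacian_sub (hx hq x t h)
    have h2 := iteratedDeriv_sub (ht hp x t h) (ht hq x t h)
    have h3 := hp.wave x t h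
    have h4 := hq.wave x t h
    have e1 : (fun y => p y t - q y t) = (fun y => p y t) - fun y => q y t := rfl
    have e2 : (fun s => p x s - q x s) = (fun s => p x s) - fun s => q x s := rfl
    rw [e1, e2, h1, h2]
    linarith
  · simp only [hp.init_pos, hq.init_pos]
  · have := derivWithin_sub (hp.differentiableWithinAt_zero x)
      (hq.differentiableWithinAt_zero x)
    rw [hp.init_vel, hq.init_vel, sub_zero] at this
    exact this

/-- Solutions of the initial value problem are determined at nonnegative times. -/
lemma IsWaveSolution.eq {f : Euc d → ℝ} {p q : Euc d → ℝ → ℝ} (hp : IsWaveSolution f p)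
    (hq : IsWaveSolution f q) (x : Euc d) {t : ℝ} (ht : 0 ≤ t) : p x t = q x t := by
  have h := hp.sub hq
  simp only [sub_self] at h
  exact sub_eq_zero.1 (h.eq_zero x ht)

end Energy

/-! ### Intertwining of spatial and temporal filters -/

section Intertwining

variable {d : ℕ}

lemma isWaveSolution_waveOp {f : Euc d → ℝ} {p : Euc d → ℝ → ℝ} (h : IsWaveSolution f p) :
    IsWaveSolution f (waveOp f) := by
  have hex : ∃ p, IsWaveSolution f p := ⟨p, h⟩
  rw [waveOp, dif_pos hex]
  exact hex.choose_spec

lemma waveOp_eq {f : Euc d → ℝ} {p : Euc d → ℝ → ℝ} (h : IsWaveSolution f p) (x : Euc d)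
    {t : ℝ} (ht : 0 ≤ t) : waveOp f x t = p x t :=
  (isWaveSolution_waveOp h).eq h x ht

lemma fourier_neg_of_even {V : Type*} [NormedAddCommGroup V] [InnerProductSpace ℝ V]
    [FiniteDimensional ℝ V] [MeasurableSpace V] [BorelSpace V] {f : V → ℂ}
    (hf : ∀ x, f (-x) = f x) (ξ : V) : 𝓕 f (-ξ) = 𝓕 f ξ := by
  rw [← Real.fourierInv_eq_fourier_neg, Real.fourierInv_eq_fourier_comp_neg]
  simp only [hf]

/-- Convolution acts on frequency profiles as a multiplier. -/
lemma ofReal_conv_eq_fourier {u f : Euc d → ℝ} {K : Euc d → ℂ} (hu : Integrable u)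
    (heven : ∀ ξ, 𝓕 (fun x => (u x : ℂ)) (-ξ) = 𝓕 (fun x => (u x : ℂ)) ξ)
    (hK : HasMoments K) (hf : ∀ x, (f x : ℂ) = 𝓕 K x) (x : Euc d) :
    ((conv u f x : ℝ) : ℂ) = 𝓕 (fun η => 𝓕 (fun x => (u x : ℂ)) η * K η) x := by
  set m : Euc d → ℂ := fun η => (Real.fourierChar (-(inner ℝ η x : ℝ)) : ℂ) * K η with hm
  have hmi : Integrable m := (hK.modulate x).integrable
  -- `y ↦ f (x - y)` is the transform of the reflected modulation of `K`; then the transform is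
  -- shifted to `u` by the multiplication formula
  have h1 : ∀ y, 𝓕 K (x - y) = 𝓕 (fun η => m (-η)) y := by
    intro y
    rw [← Real.fourierInv_eq_fourier_comp_neg, Real.fourierInv_eq, Real.fourier_eq]
    congr 1; ext η
    rw [hm, Circle.smul_def, Circle.smul_def, smul_eq_mul, smul_eq_mul, ← mul_assoc,
      ← Circle.coe_mul, ← AddChar.map_add_eq_mul, inner_sub_right]
    congr 3; ring
  have h2 := integral_fourier_mul_eq (hu.ofReal (𝕜 := ℂ)) hmi.comp_neg
  calc ((conv u f x : ℝ) : ℂ) = ∫ y, (u y : ℂ) * 𝓕 (fun η => m (-η)) y := by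
        rw [ofReal_conv, conv_apply]
        congr 1; ext y
        rw [hf, h1, Complex.real_smul]
    _ = ∫ η, 𝓕 (fun x => (u x : ℂ)) η * m (-η) := h2.symm
    _ = ∫ η, 𝓕 (fun x => (u x : ℂ)) η * m η := by
        rw [← integral_neg_eq_self]
        simp only [heven, neg_neg]
    _ = _ := by
        rw [Real.fourier_eq]
        congr 1; ext η
        rw [hm, Circle.smul_def, smul_eq_mul]; ring

/-- Even convolution kernels on the line act on cosines as multipliers. -/
lemma integral_mul_cos {v : ℝ → ℝ} (hv : Integrable v) (heven : ∀ t, v (-t) = v t) (t r : ℝ) :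
    ∫ s, ((v (t - s) * Real.cos (2 * Real.pi * s * r) : ℝ) : ℂ) =
      (Real.cos (2 * Real.pi * t * r) : ℂ) * 𝓕 (fun s => (v s : ℂ)) r := by
  set V := 𝓕 (fun s => (v s : ℂ)) with hV
  have hVe : V (-r) = V r := fourier_neg_of_even (fun s => by rw [heven]) r
  have hi : ∀ b : ℝ, Integrable fun s : ℝ => (Real.fourierChar (-(s * b)) : ℂ) * (v s : ℂ) :=
    fun b => (hv.ofReal (𝕜 := ℂ)).bdd_mul (c := 1) (Continuous.aestronglyMeasurable (by fun_prop))
      (ae_of_all _ fun s => by rw [Circle.norm_coe])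
  have e : ∀ b : ℝ, ∫ s : ℝ, (Real.fourierChar (-(s * b)) : ℂ) * (v s : ℂ) = V b := fun b => by
    rw [hV, Real.fourier_eq]
    congr 1; ext s
    rw [Circle.smul_def, smul_eq_mul]
    congr 4
    simp [mul_comm]
  rw [← integral_sub_left_eq_self _ volume t]
  have e2 : ∀ s : ℝ, ((v (t - (t - s)) * Real.cos (2 * Real.pi * (t - s) * r) : ℝ) : ℂ) =
      (Real.fourierChar (t * r) : ℂ) / 2 * ((Real.fourierChar (-(s * r)) : ℂ) * (v s : ℂ)) +
      (Real.fourierChar (-(t * r)) : ℂ) / 2 *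
        ((Real.fourierChar (-(s * -r)) : ℂ) * (v s : ℂ)) := by
    intro s
    have h1 := fourierChar_add_div_two 0 ((t - s) * r)
    rw [neg_zero, AddChar.map_zero_eq_one, Circle.coe_one, mul_one, zero_add, zero_add,
      neg_neg] at h1
    rw [sub_sub_cancel, Complex.ofReal_mul,
      show 2 * Real.pi * (t - s) * r = 2 * Real.pi * ((t - s) * r) by ring, ← h1,
      show -((t - s) * r) = -(t * r) + -(s * -r) by ring,
      show (t - s) * r = t * r + -(s * r) by ring, AddChar.map_add_eq_mul,
      AddChar.map_add_eq_mul, Circle.coe_mul, Circle.coe_mul]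
    ring
  simp only [e2]
  rw [integral_add ((hi r).const_mul _) ((hi (-r)).const_mul _), integral_const_mul,
    integral_const_mul, e, e, hVe]
  have h1 := fourierChar_add_div_two 0 (t * r)
  rw [neg_zero, AddChar.map_zero_eq_one, Circle.coe_one, mul_one, zero_add, zero_add,
    neg_neg] at h1
  rw [show 2 * Real.pi * t * r = 2 * Real.pi * (t * r) by ring, ← h1]
  ring

lemma waveInt_neg (K : Euc d → ℂ) (x : Euc d) (t : ℝ) : waveInt K x (-t) = waveInt K x t := by
  have e : waveSymbol K (-t) = waveSymbol K t := by
    ext η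
    rw [waveSymbol, waveSymbol, show 2 * Real.pi * -t * ‖η‖ = -(2 * Real.pi * t * ‖η‖) by ring,
      Real.cos_neg]
  rw [waveInt, e, waveInt]

lemma waveInt_abs (K : Euc d → ℂ) (x : Euc d) (t : ℝ) : waveInt K x |t| = waveInt K x t := by
  rcases abs_choice t with h | h <;> rw [h]
  exact waveInt_neg K x t

lemma abs_waveInt_le (K : Euc d → ℂ) (hK : HasMoments K) (x : Euc d) (t : ℝ) :
    |waveInt K x t| ≤ ∫ η, ‖K η‖ := by
  refine (Complex.abs_re_le_norm _).trans ((norm_fourier_le _ _).trans ?_)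
  refine integral_mono (hK.waveSymbol t).integrable.norm hK.integrable.norm fun η => ?_
  rw [waveSymbol, norm_mul, Complex.norm_real]
  exact mul_le_of_le_one_left (norm_nonneg _) (Real.abs_cos_le_one _)

lemma integrable_mul_waveInt {v : ℝ → ℝ} (hv : Integrable v) {K : Euc d → ℂ} (hK : HasMoments K)
    (x : Euc d) (t : ℝ) : Integrable fun s => v (t - s) * waveInt K x s := by
  have hc : Continuous (waveInt K x) :=
    (contDiff_waveInt hK).continuous.comp (f := fun s : ℝ => (x, s)) (by fun_prop)
  exact (hv.comp_sub_left t).mul_bdd hc.aestronglyMeasurable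
    (ae_of_all _ fun s => abs_waveInt_le K hK x s)

/-- Filtering a solution in time by an even kernel filters its frequency profile radially. -/
lemma integral_mul_waveInt {v : ℝ → ℝ} (hv : Integrable v) (heven : ∀ t, v (-t) = v t)
    {K : Euc d → ℂ} (hK : HasMoments K) (x : Euc d) (t : ℝ) :
    ∫ s, v (t - s) * waveInt K x s =
      waveInt (fun η => 𝓕 (fun s => (v s : ℂ)) ‖η‖ * K η) x t := by
  set m : Euc d → ℂ := fun η => (Real.fourierChar (-(inner ℝ η x : ℝ)) : ℂ) * K η with hm
  have hmi : Integrable m := (hK.modulate x).integrable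
  have hvt : Integrable fun s => (v (t - s) : ℂ) := (hv.comp_sub_left t).ofReal
  have hprod : Integrable (fun p : ℝ × Euc d => (Real.cos (2 * Real.pi * p.1 * ‖p.2‖) : ℂ) *
      ((v (t - p.1) : ℂ) * m p.2)) (volume.prod volume) :=
    (hvt.mul_prod hmi).bdd_mul (c := 1) (Continuous.aestronglyMeasurable (by fun_prop))
      (ae_of_all _ fun p => by rw [Complex.norm_real]; exact Real.abs_cos_le_one _)
  have hint : Integrable fun s => (v (t - s) : ℂ) * 𝓕 (waveSymbol K s) x := by
    refine hprod.integral_prod_left.congr (ae_of_all _ fun s => ?_)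
    simp only
    rw [fourier_waveSymbol_eq, ← integral_const_mul]
    congr 1; ext η; ring
  have h1 : ∀ s, v (t - s) * waveInt K x s = ((v (t - s) : ℂ) * 𝓕 (waveSymbol K s) x).re :=
    fun s => by rw [Complex.re_ofReal_mul, waveInt]
  simp only [h1]
  have h2 := Complex.reCLM.integral_comp_comm hint
  simp only [Complex.reCLM_apply] at h2
  rw [h2, waveInt]
  congr 1
  calc _ = ∫ s, ∫ η, (Real.cos (2 * Real.pi * s * ‖η‖) : ℂ) * ((v (t - s) : ℂ) * m η) := by
        congr 1; ext s
        rw [fourier_waveSymbol_eq, ← integral_const_mul]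
        congr 1; ext η; ring
    _ = ∫ η, ∫ s, (Real.cos (2 * Real.pi * s * ‖η‖) : ℂ) * ((v (t - s) : ℂ) * m η) :=
        integral_integral_swap hprod
    _ = _ := by
        rw [fourier_waveSymbol_eq]
        congr 1; ext η
        have := integral_mul_cos hv heven t ‖η‖
        rw [mul_left_comm _ (𝓕 (fun s => (v s : ℂ)) ‖η‖), ← mul_assoc, ← this,
          ← integral_mul_const]
        congr 1; ext s
        push_cast; ring

/-- Test functions are Fourier transforms of Schwartz functions. -/
lemma exists_hasMoments_fourier_eq {f : Euc d → ℝ} (hf : ContDiff ℝ ∞ f)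
    (hc : HasCompactSupport f) : ∃ K : Euc d → ℂ, HasMoments K ∧ ∀ x, (f x : ℂ) = 𝓕 K x := by
  have h1 : HasCompactSupport fun x => (f x : ℂ) := hc.comp_left (g := fun r : ℝ => (r : ℂ)) rfl
  have h2 : ContDiff ℝ ∞ fun x => (f x : ℂ) := Complex.ofRealCLM.contDiff.comp hf
  set φ := h1.toSchwartzMap h2
  refine ⟨(𝓕⁻ φ : 𝓢(Euc d, ℂ)), SchwartzMap.hasMoments _, fun x => ?_⟩
  have e : 𝓕 (𝓕⁻ φ) = φ := FourierTransform.fourier_fourierInv_eq φ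
  rw [← SchwartzMap.fourier_coe, e]
  rfl

variable {u : Euc d → ℝ} {v : ℝ → ℝ}

/-- The wave equation intertwines a radial spatial filter with the temporal filter that has the
same Fourier profile. -/
lemma waveOp_conv (hu : Integrable u) (hv : Integrable v) (heven : ∀ t, v (-t) = v t)
    (huv : ∀ ξ, 𝓕 (fun x => (u x : ℂ)) ξ = 𝓕 (fun t => (v t : ℂ)) ‖ξ‖)
    {f : Euc d → ℝ} (hf : ContDiff ℝ ∞ f) (hc : HasCompactSupport f) :
    IsWaveSolution f (waveOp f) ∧ ContDiff ℝ ∞ (conv u f) ∧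
      IsWaveSolution (conv u f) (waveOp (conv u f)) ∧ ∀ x t, 0 < t →
        Integrable (fun s => v (t - s) * waveOp f x |s|) ∧
        waveOp (conv u f) x t = timeConv v (waveOp f) x t := by
  obtain ⟨K, hK, hfK⟩ := exists_hasMoments_fourier_eq hf hc
  set L : Euc d → ℂ := fun η => 𝓕 (fun x => (u x : ℂ)) η * K η with hLdef
  have hL : HasMoments L :=
    hK.bdd_mul (continuous_fourier hu.ofReal) fun η => norm_fourier_le _ η
  have hconv := ofReal_conv_eq_fourier hu (fun ξ => by rw [huv, huv, norm_neg]) hK hfK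
  have hp : IsWaveSolution f (waveInt K) := isWaveSolution_waveInt hK fun x => by rw [← hfK]; rfl
  have hq : IsWaveSolution (conv u f) (waveInt L) := isWaveSolution_waveInt hL fun x => by
    rw [← hconv]; rfl
  have hsm : ContDiff ℝ ∞ (conv u f) := by
    have e : conv u f = Complex.reCLM ∘ 𝓕 L := funext fun x => by
      rw [Function.comp_apply, ← hconv]; rfl
    rw [e]
    exact Complex.reCLM.contDiff.comp hL.contDiff_fourier
  have hW : ∀ x s, waveOp f x |s| = waveInt K x s := fun x s => by
    rw [waveOp_eq hp x (abs_nonneg s), waveInt_abs]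
  refine ⟨isWaveSolution_waveOp hp, hsm, isWaveSolution_waveOp hq, fun x t ht => ⟨?_, ?_⟩⟩
  · simp only [hW]
    exact integrable_mul_waveInt hv hK x t
  · simp only [timeConv, hW]
    rw [waveOp_eq hq x ht.le, integral_mul_waveInt hv heven hK, hLdef]
    simp only [huv]

end Intertwining

section Dual

variable {d : ℕ}

lemma isCanonicalDual_iff (u w : ℕ → Euc d → ℝ) :
    IsCanonicalDual u w ↔ ∀ j, IsFourierPair (fun x => (w j x : ℂ)) (dualSymbol u j) := by
  refine forall_congr' fun j => ?_
  rw [isL2Fourier_iff]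
  simp only [← fourier_eq_fourierInt]
  rfl

end Dual

lemma ceil_sub_one_div_two (d : ℕ) : ⌈((d : ℝ) - 1) / 2⌉₊ = d / 2 := by
  have h1 := Nat.div_add_mod d 2
  have h2 := Nat.mod_lt d two_pos
  refine le_antisymm (Nat.ceil_le.2 ?_) (Nat.le_of_lt_succ ?_)
  · have : (d : ℝ) ≤ 2 * (d / 2 : ℕ) + 1 := by exact_mod_cast (by omega : d ≤ 2 * (d / 2) + 1)
    linarith
  · rcases Nat.eq_zero_or_pos (d / 2) with h | h
    · omega
    refine Nat.lt_succ_of_le ?_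
    obtain ⟨k, hk⟩ : ∃ k, d / 2 = k + 1 := ⟨d / 2 - 1, by omega⟩
    rw [hk]
    refine Nat.succ_le_of_lt (Nat.lt_ceil.2 ?_)
    have : (2 * (k + 1) : ℝ) ≤ d := by exact_mod_cast (by omega : 2 * (k + 1) ≤ d)
    linarith

end PAT

end

theorem theorem3p7 (d : ℕ) (hd : 1 ≤ d) (S : Set (PAT.Euc d)) (v : ℕ → ℝ → ℝ)
    (hv : PAT.IsMultiscale v)
    (heven : ∀ j, ∀ t : ℝ, v j (-t) = v j t)
    (hreg : ∀ j, ContDiff ℝ (⌈((d : ℝ) - 1) / 2⌉₊ : ℕ) (v j))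
    (hdecay : ∀ j, PAT.SufficientDecay ⌈((d : ℝ) - 1) / 2⌉₊ (v j))
    (u : ℕ → PAT.Euc d → ℝ) (hu : ∀ j, u j = PAT.radonSharp d (v j)) :
    -- the pair is a multiscale factorization
    PAT.IsMultiscaleFactorization S u v ∧
    -- the canonical dual exists and is unique up to null sets
    (∃ w, PAT.IsCanonicalDual u w) ∧
    (∀ w w', PAT.IsCanonicalDual u w → PAT.IsCanonicalDual u w' → ∀ j, w j =ᵐ[volume] w' j) ∧
    -- its Fourier representation, in which the denominator is a convergent positive series
    (∀ᵐ ξ : PAT.Euc d, Summable (fun k => ‖PAT.fourierInt (v k) ‖ξ‖‖ ^ 2) ∧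
      0 < ∑' k, ‖PAT.fourierInt (v k) ‖ξ‖‖ ^ 2) ∧
    (∀ w, PAT.IsCanonicalDual u w → ∀ j, PAT.IsL2Fourier (w j) (fun ξ =>
      PAT.fourierInt (v j) ‖ξ‖ / ((∑' k, ‖PAT.fourierInt (v k) ‖ξ‖‖ ^ 2 : ℝ) : ℂ))) ∧
    -- the expansion `f = ∑ u_j⁺ ⊛ (u_j ⊛ f)` in `L²`
    (∀ w, PAT.IsCanonicalDual u w → ∀ f : PAT.Euc d → ℝ, MemLp f 2 volume →
      PAT.HasL2Sum (fun j => PAT.conv (w j) (PAT.conv (u j) f)) f) ∧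
    -- for test functions, the factors `u_j ⊛ f` are smooth, the wave data of `f` and of the
    -- factors exist, and `W (u_j ⊛ f) = v_j ⊛_t W f`
    (∀ f : PAT.Euc d → ℝ, ContDiff ℝ ∞ f → HasCompactSupport f →
      PAT.IsWaveSolution f (PAT.waveOp f) ∧
      ∀ j, ContDiff ℝ ∞ (PAT.conv (u j) f) ∧
        PAT.IsWaveSolution (PAT.conv (u j) f) (PAT.waveOp (PAT.conv (u j) f)) ∧
        ∀ x ∈ S, ∀ t : ℝ, 0 < t →
          Integrable (fun s : ℝ => v j (t - s) * PAT.waveOp f x |s|) ∧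
          PAT.waveOp (PAT.conv (u j) f) x t = PAT.timeConv (v j) (PAT.waveOp f) x t) ∧
    -- recovery: in any class `X` of smooth functions that contains the factors and on which the
    -- data determine the initial pressure, solving `W h_j = v_j ⊛_t W f` on `S × (0, ∞)` and
    -- then summing the series gives back `f`
    (∀ w, PAT.IsCanonicalDual u w → ∀ f : PAT.Euc d → ℝ, ContDiff ℝ ∞ f → HasCompactSupport f →
      ∀ X : Set (PAT.Euc d → ℝ), (∀ h ∈ X, ContDiff ℝ ∞ h) →
        (∀ h ∈ X, ∀ h' ∈ X, (∀ x ∈ S, ∀ t : ℝ, 0 < t → PAT.waveOp h x t = PAT.waveOp h' x t) →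
          h = h') →
        (∀ j, PAT.conv (u j) f ∈ X) →
        ∀ h : ℕ → PAT.Euc d → ℝ, (∀ j, h j ∈ X) →
          (∀ j, ∀ x ∈ S, ∀ t : ℝ, 0 < t →
            PAT.waveOp (h j) x t = PAT.timeConv (v j) (PAT.waveOp f) x t) →
          PAT.HasL2Sum (fun j => PAT.conv (w j) (h j)) f) := by
  have hr := PAT.ceil_sub_one_div_two d
  rw [hr] at hreg hdecay
  obtain rfl : u = fun j => PAT.radonSharp d (v j) := funext hu
  obtain ⟨A, B, hB, hV⟩ := hv.1.exists_hasFrameSymbol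
  have hU := hV.radonSharp hd hreg heven hdecay
  have hslice : ∀ j ξ, PAT.fourierInt (PAT.radonSharp d (v j)) ξ = PAT.fourierInt (v j) ‖ξ‖ :=
    fun j => PAT.fourierInt_radonSharp hd (hreg j) (heven j) (hdecay j)
  have hslice' : ∀ j ξ, 𝓕 (fun x => (PAT.radonSharp d (v j) x : ℂ)) ξ =
      𝓕 (fun t => (v j t : ℂ)) ‖ξ‖ :=
    fun j => PAT.fourier_radonSharp hd (hreg j) (heven j) (hdecay j)
  have hreal : ∀ j ξ, (starRingEnd ℂ) (𝓕 (fun x => (PAT.radonSharp d (v j) x : ℂ)) ξ) =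
      𝓕 (fun x => (PAT.radonSharp d (v j) x : ℂ)) ξ := fun j ξ => by
    rw [← PAT.fourier_ofReal_neg, hslice', hslice', norm_neg]
  have hmulti := PAT.isMultiscale_radonSharp hd hv hreg heven hdecay
  have hwave := fun j (f : PAT.Euc d → ℝ) => PAT.waveOp_conv (f := f) (hU.integrable j)
    (hV.integrable j) (heven j) (hslice' j)
  have hexp : ∀ w, PAT.IsCanonicalDual (fun j => PAT.radonSharp d (v j)) w →
      ∀ f : PAT.Euc d → ℝ, MemLp f 2 volume →
        PAT.HasL2Sum (fun j => PAT.conv (w j) (PAT.conv (PAT.radonSharp d (v j)) f)) f :=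
    fun w hw f hf => by
      obtain ⟨h1, h2⟩ := hU.tendsto_expansion hreal ((PAT.isCanonicalDual_iff _ _).1 hw) hf
      exact ⟨h1, hf, h2⟩
  refine ⟨⟨⟨hmulti.1, hv.1, fun j f hf hc x _ t ht => ((hwave j f hf hc).2.2.2 x t ht).2⟩,
    hmulti, hv⟩, ?_, ?_, ?_, ?_, hexp, ?_, ?_⟩
  · choose w hw using hU.exists_dual
    exact ⟨w, (PAT.isCanonicalDual_iff _ _).2 hw⟩
  · intro w w' hw hw' j
    have h := ((PAT.isCanonicalDual_iff _ _).1 hw j).unique_left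
      ((PAT.isCanonicalDual_iff _ _).1 hw' j)
    filter_upwards [h] with x hx using by exact_mod_cast hx
  · have h1 : ∀ᵐ s : ℝ, Summable (fun k => ‖PAT.fourierInt (v k) s‖ ^ 2) ∧
        0 < ∑' k, ‖PAT.fourierInt (v k) s‖ ^ 2 := by
      filter_upwards [PAT.ae_comp_smul hV.bounds PAT.two_pi_inv_ne_zero] with s hs
      simp only [PAT.fourierInt_eq_fourier]
      obtain ⟨h2, h3⟩ := PAT.summable_of_frameSymbol hV.pos hs
      exact ⟨h2, hV.pos.trans_le h3⟩
    exact PAT.ae_norm_of_ae hd h1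
  · intro w hw j
    simpa only [PAT.IsCanonicalDual, hslice] using hw j
  · exact fun f hf hc => ⟨(hwave 0 f hf hc).1, fun j => ⟨(hwave j f hf hc).2.1, (hwave j f hf hc).2.2.1,
      fun x _ t ht => (hwave j f hf hc).2.2.2 x t ht⟩⟩
  · intro w hw f hf hc X _ hinj hX h hh hdata
    have e : h = fun j => PAT.conv (PAT.radonSharp d (v j)) f := funext fun j =>
      hinj _ (hh j) _ (hX j) fun x hx t ht =>
        (hdata j x hx t ht).trans ((hwave j f hf hc).2.2.2 x t ht).2.symm
    rw [e]
    exact hexp w hw f (hf.continuous.memLp_of_hasCompactSupport hc)
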